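/- **Notation.** For a field $k$ of characteristic $0$, let $k\langle\langle x,y\rangle\rangle$ be the algebra of noncommutative formal power series, with the continuous coproduct for which $x,y$ are primitive, let $F_2(k)$ be its group of group-like elements and $\mathfrak{lie}_2(k)$ its Lie series (the degree completion of the free Lie algebra on $x,y$). Put $\mathrm{ch}(x,y)=\ln(e^xe^y)$ and $z=-\mathrm{ch}(x,y)$. Let $PB_4$ be the pure braid group on four strands with standard generators $X_{i,j}$ ($X_{i,i+1}=\sigma_i^2$, $X_{1,3}=\sigma_1^{-1}\sigma_2^2\sigma_1$, $X_{2,4}=\sigma_2^{-1}\sigma_3^2\sigma_2$), and let $x_{i,j}=\ln X_{i,j}$ in its prounipotent completion $PB_4(k)$, with Lie algebra $\mathfrak{pb}_4(k)$. The group $GT(k)$ is the set of pairs $(\lambda,f)$, $\lambda\in k^*$, $f\in F_2(k)$, such that $f(x,y)=f(y,x)^{-1}$; $f(z,x)e^{mz}f(y,z)e^{my}f(x,y)e^{mx}=1$ with $m=(\lambda-1)/2$; and $$f(x_{1,2},\mathrm{ch}(x_{2,3},x_{2,4}))\,f(\mathrm{ch}(x_{1,3},x_{2,3}),x_{3,4})=f(x_{2,3},x_{3,4})\,f(\mathrm{ch}(x_{1,2},x_{1,3}),\mathrm{ch}(x_{2,4},x_{3,4}))\,f(x_{1,2},x_{2,3})$$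 in $PB_4(k)$. Its group law is $(\lambda_1,f_1)(\lambda_2,f_2)=\big(\lambda_1\lambda_2,\ f_1(\lambda_2f_2xf_2^{-1},\lambda_2y)\,f_2\big)$, with unit $(1,1)$. The Lie algebra $\mathfrak{gt}(k)$ is the set of pairs $(s,\psi)$, $s\in k$, $\psi\in\mathfrak{lie}_2(k)$, such that $\psi(x,y)=-\psi(y,x)$; $\psi(x,y)+\psi(y,z)+\psi(z,x)+\frac s2(x+y+z)=0$; and $$\psi(x_{1,2},\mathrm{ch}(x_{2,3},x_{2,4}))+\psi(\mathrm{ch}(x_{1,3},x_{2,3}),x_{3,4})=\psi(x_{2,3},x_{3,4})+\psi(\mathrm{ch}(x_{1,2},x_{1,3}),\mathrm{ch}(x_{2,4},x_{3,4}))+\psi(x_{1,2},x_{2,3})$$ in $\mathfrak{pb}_4(k)$. The logarithm is $\ln g=\sum_{n\ge1}\frac{(-1)^{n+1}}{n}(g-1)^n$ with $(g-1)^n=\sum_{j=0}^n(-1)^{n-j}\binom nj g^j$, where the powers $g^j$ are taken in the group $GT(k)$ and the sums in the vector space $k\times k\langle\langle x,y\rangle\rangle$; for $k=\mathbb{Q}_2$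 convergence is coefficientwise in the $2$-adic topology. Let $\hat x=e^x-1$, $\hat y=e^y-1$ in $\mathbb{Q}_2\langle\langle x,y\rangle\rangle$, and let $\mathbb{Z}_2\langle\langle\hat x,\hat y\rangle\rangle^{\ge m}$ be the set of noncommutative power series in $\hat x,\hat y$ with coefficients in $\mathbb{Z}_2$ and only terms of degree $\ge m$ in $\hat x,\hat y$. Let $GT_2\subset GT(\mathbb{Q}_2)$ be the set of pairs $(\lambda,f)$ with $\lambda\in\mathbb{Z}_2^*$ and $f$ in the pro-$2$ completion of the free group on $e^x,e^y$, i.e. $f$ a group-like element of $\mathbb{Z}_2\langle\langle\hat x,\hat y\rangle\rangle$. **Proposition.** Let $(\lambda,f)\in GT_2$ with $\lambda\in1+4+8\mathbb{Z}_2$. Then the series $\ln(\lambda,f)$ converges, the $2$-adic logarithm $\ln\lambda$ is nonzero, and $$\frac{\ln(\lambda,f)}{\ln\lambda}=(1,\psi)\in\mathfrak{gt}(\mathbb{Q}_2)\quad\text{with}\quad \psi\in\sum_{s\ge0}2^{-(s+2)}\,\mathbb{Z}_2\langle\langle\hat x,\hat y\rangle\rangle^{\ge2^s},$$ that is, $\psi=\sum_{s\ge0}a_s$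 for some $a_s\in2^{-(s+2)}\mathbb{Z}_2\langle\langle\hat x,\hat y\rangle\rangle^{\ge2^s}$. -/

import Mathlib

open scoped BigOperators

noncomputable section

/-- Noncommutative formal power series `K⟨⟨x, y⟩⟩` in two letters: a series is the family of its
coefficients, indexed by the words in the letters `0` (for `x`) and `1` (for `y`). -/
def NCSeries (K : Type*) : Type _ := List (Fin 2) → K

namespace NCSeries

variable {K : Type*}

instance [AddCommGroup K] : AddCommGroup (NCSeries K) :=
  inferInstanceAs (AddCommGroup (List (Fin 2) → K))

instance [CommRing K] : Module K (NCSeries K) :=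
  inferInstanceAs (Module K (List (Fin 2) → K))

/-- The topology of coefficientwise convergence. -/
instance [TopologicalSpace K] : TopologicalSpace (NCSeries K) :=
  inferInstanceAs (TopologicalSpace (List (Fin 2) → K))

@[ext] theorem ext {f g : NCSeries K} (h : ∀ w, f w = g w) : f = g := funext h

@[simp] theorem add_apply [AddCommGroup K] (f g : NCSeries K) (w : List (Fin 2)) :
    (f + g) w = f w + g w := rfl

@[simp] theorem zero_apply [AddCommGroup K] (w : List (Fin 2)) : (0 : NCSeries K) w = 0 := rfl

@[simp] theorem smul_apply [CommRing K] (c : K) (f : NCSeries K) (w : List (Fin 2)) :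
    (c • f) w = c * f w := rfl

section Ring

variable [CommRing K]

instance : One (NCSeries K) := ⟨fun w => if w = [] then 1 else 0⟩

/-- The Cauchy product: the coefficient at `w` is the sum over all cuts `w = uv`. -/
instance : Mul (NCSeries K) :=
  ⟨fun f g w => ∑ i ∈ Finset.range (w.length + 1), f (w.take i) * g (w.drop i)⟩

theorem one_apply (w : List (Fin 2)) : (1 : NCSeries K) w = if w = [] then 1 else 0 := rfl

theorem mul_apply (f g : NCSeries K) (w : List (Fin 2)) :
    (f * g) w = ∑ i ∈ Finset.range (w.length + 1), f (w.take i) * g (w.drop i) := rfl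

/-- The series `w ↦ f (aw)`. -/
def tail (a : Fin 2) (f : NCSeries K) : NCSeries K := fun w => f (a :: w)

theorem mul_nil (f g : NCSeries K) : (f * g) [] = f [] * g [] := by
  simp [mul_apply]

theorem mul_cons (f g : NCSeries K) (a : Fin 2) (w : List (Fin 2)) :
    (f * g) (a :: w) = f [] * g (a :: w) + (tail a f * g) w := by
  rw [mul_apply, List.length_cons, Finset.sum_range_succ']
  simp [mul_apply, tail, add_comm]

theorem one_mul_aux (f : NCSeries K) : 1 * f = f := by
  ext w
  rw [mul_apply, Finset.sum_eq_single 0]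
  · simp [one_apply]
  · intro i hi h0
    have : w.take i ≠ [] := by
      intro h
      rcases List.take_eq_nil_iff.1 h with h | h
      · exact h0 h
      · subst h
        simp at hi
        exact h0 hi
    simp [one_apply, this]
  · simp

theorem mul_one_aux (f : NCSeries K) : f * 1 = f := by
  ext w
  rw [mul_apply, Finset.sum_eq_single w.length]
  · simp [one_apply]
  · intro i hi h0
    have : ¬ w.length ≤ i := by
      have := Finset.mem_range.1 hi
      omega
    simp [one_apply, List.drop_eq_nil_iff, this]
  · simp

theorem add_mul_aux (f g h : NCSeries K) : (f + g) * h = f * h + g * h := by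
  ext w
  simp [mul_apply, add_mul, Finset.sum_add_distrib]

theorem mul_add_aux (f g h : NCSeries K) : f * (g + h) = f * g + f * h := by
  ext w
  simp [mul_apply, mul_add, Finset.sum_add_distrib]

theorem smul_mul_aux (c : K) (f g : NCSeries K) : (c • f) * g = c • (f * g) := by
  ext w
  simp [mul_apply, Finset.mul_sum, mul_assoc]

theorem mul_smul_aux (c : K) (f g : NCSeries K) : f * (c • g) = c • (f * g) := by
  ext w
  simp [mul_apply, Finset.mul_sum, mul_left_comm]

theorem mul_assoc_aux (f g h : NCSeries K) : f * g * h = f * (g * h) := by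
  ext w
  induction w generalizing f with
  | nil => simp [mul_nil, mul_assoc]
  | cons a w ih =>
    have ht : tail a (f * g) = f [] • tail a g + tail a f * g := by
      ext v
      exact mul_cons f g a v
    rw [mul_cons, ht, add_mul_aux, smul_mul_aux, add_apply, ih, mul_cons f, mul_cons g, mul_nil,
      smul_apply]
    ring

instance : Ring (NCSeries K) :=
  { (inferInstance : AddCommGroup (NCSeries K)) with
    mul_assoc := mul_assoc_aux
    one_mul := one_mul_aux
    mul_one := mul_one_aux
    left_distrib := mul_add_aux
    right_distrib := add_mul_aux
    zero_mul := fun f => by ext w; simp [mul_apply]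
    mul_zero := fun f => by ext w; simp [mul_apply] }

instance : Algebra K (NCSeries K) := Algebra.ofModule smul_mul_aux mul_smul_aux

/-- The commutator bracket. -/
instance : LieRing (NCSeries K) := LieRing.ofAssociativeRing

instance : LieAlgebra K (NCSeries K) := LieAlgebra.ofAssociativeAlgebra

end Ring

end NCSeries

/-! Truncated exponential, logarithm and evaluation of noncommutative series in an algebra. -/

section Truncated

variable {K A : Type*} [Field K] [Ring A] [Algebra K A]

/-- `∑_{j < N} a ^ j / j!`. -/
def truncExp (K : Type*) {A : Type*} [Field K] [Ring A] [Algebra K A] (N : ℕ) (a : A) : A :=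
  ∑ j ∈ Finset.range N, ((j.factorial : K)⁻¹) • a ^ j

/-- `∑_{1 ≤ j < N} (-1) ^ (j + 1) (u - 1) ^ j / j`. -/
def truncLog (K : Type*) {A : Type*} [Field K] [Ring A] [Algebra K A] (N : ℕ) (u : A) : A :=
  ∑ j ∈ Finset.Ico 1 N, ((-1 : K) ^ (j + 1) / (j : K)) • (u - 1) ^ j

/-- The part of degree `< N` of `f`, evaluated at `x = a`, `y = b`. -/
def truncEval (N : ℕ) (f : NCSeries K) (a b : A) : A :=
  ∑ n ∈ Finset.range N, ∑ v : Fin n → Fin 2,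
    f (List.ofFn v) • ((List.ofFn v).map ![a, b]).prod

end Truncated

namespace NCSeries

variable {K : Type*} [Field K]

/-- The letter `x`. -/
def X (K : Type*) [Field K] : NCSeries K := fun w => if w = [0] then 1 else 0

/-- The letter `y`. -/
def Y (K : Type*) [Field K] : NCSeries K := fun w => if w = [1] then 1 else 0

/-- The exponential of a series without constant term (terms of order above the length of `w` do
not contribute to the coefficient at `w`). -/
def exp (a : NCSeries K) : NCSeries K := fun w => truncExp K (w.length + 1) a w

/-- The logarithm of a series with constant term `1`. -/
def log (u : NCSeries K) : NCSeries K := fun w => truncLog K (w.length + 1) u w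

/-- The substitution `f(a, b)`, for series `a`, `b` without constant term. -/
def subst (f a b : NCSeries K) : NCSeries K := fun w => truncEval (w.length + 1) f a b w

/-- The Campbell–Hausdorff series `ch(x, y) = ln(e^x e^y)`. -/
def ch (K : Type*) [Field K] : NCSeries K := log (exp (X K) * exp (Y K))

/-- All shuffles of two words, with multiplicity. -/
def shuffles : List (Fin 2) → List (Fin 2) → List (List (Fin 2))
  | [], v => [v]
  | a :: u, [] => [a :: u]
  | a :: u, b :: v =>
    (shuffles u (b :: v)).map (fun w => a :: w) ++ (shuffles (a :: u) v).map (fun w => b :: w)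
  termination_by u v => u.length + v.length

/-- The coefficient of `u ⊗ v` in `Δ(f)`, for the continuous coproduct `Δ` with
`Δ(x) = x ⊗ 1 + 1 ⊗ x` and `Δ(y) = y ⊗ 1 + 1 ⊗ y`: the coefficient of `u ⊗ v` in `Δ(w)` is the
number of ways to obtain `w` as a shuffle of `u` and `v`. -/
def coproduct (f : NCSeries K) (u v : List (Fin 2)) : K := ((shuffles u v).map f).sum

/-- The group-like series, `Δ(f) = f ⊗ f` and `f ≠ 0` (equivalently, constant term `1`). They form
the prounipotent completion `F₂(K)` of the free group on `e^x`, `e^y`. -/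
def IsGroupLike (f : NCSeries K) : Prop :=
  f [] = 1 ∧ ∀ u v, coproduct f u v = f u * f v

/-- The component of degree `n`. -/
def component (n : ℕ) (f : NCSeries K) : NCSeries K := fun w => if w.length = n then f w else 0

/-- The Lie series, i.e. the elements of the degree completion of the free Lie algebra on `x`, `y`:
every homogeneous component is a Lie polynomial. -/
def IsLieSeries (f : NCSeries K) : Prop :=
  ∀ n, component n f ∈ LieSubalgebra.lieSpan K (NCSeries K) {X K, Y K}

end NCSeries

/-! The pure braid group on four strands. -/

/-- Artin's relations for the braid group on four strands; `0, 1, 2` stand for `σ₁, σ₂, σ₃`. -/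
def braidRels : Set (FreeGroup (Fin 3)) :=
  let s : Fin 3 → FreeGroup (Fin 3) := FreeGroup.of
  {s 0 * s 1 * s 0 * (s 1 * s 0 * s 1)⁻¹, s 1 * s 2 * s 1 * (s 2 * s 1 * s 2)⁻¹,
    s 0 * s 2 * (s 2 * s 0)⁻¹}

/-- The braid group `B₄`. -/
abbrev BraidGroup4 : Type := PresentedGroup braidRels

/-- The generators `σ₁, σ₂, σ₃` of `B₄`. -/
def braidGen (i : Fin 3) : BraidGroup4 := PresentedGroup.of i

/-- The permutation underlying a braid. -/
def braidPerm : BraidGroup4 →* Equiv.Perm (Fin 4) :=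
  PresentedGroup.toGroup (f := fun i : Fin 3 => Equiv.swap i.castSucc i.succ) (by
    intro r hr
    simp only [braidRels, Set.mem_insert_iff, Set.mem_singleton_iff] at hr
    rcases hr with rfl | rfl | rfl <;> simp only [map_mul, map_inv, FreeGroup.lift_apply_of] <;>
      decide)

/-- The pure braid group `PB₄`. -/
abbrev PureBraid4 : Type := braidPerm.ker

theorem braidPerm_gen_sq (i : Fin 3) : braidPerm (braidGen i ^ 2) = 1 := by
  rw [map_pow, braidGen, braidPerm, PresentedGroup.toGroup.of, sq, Equiv.swap_mul_self]

/-- `X₁₂ = σ₁²`. -/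
def pb12 : PureBraid4 := ⟨braidGen 0 ^ 2, braidPerm_gen_sq 0⟩

/-- `X₂₃ = σ₂²`. -/
def pb23 : PureBraid4 := ⟨braidGen 1 ^ 2, braidPerm_gen_sq 1⟩

/-- `X₃₄ = σ₃²`. -/
def pb34 : PureBraid4 := ⟨braidGen 2 ^ 2, braidPerm_gen_sq 2⟩

/-- `X₁₃ = σ₁⁻¹ σ₂² σ₁ = σ₂ σ₁² σ₂⁻¹`. -/
def pb13 : PureBraid4 := ⟨(braidGen 0)⁻¹ * braidGen 1 ^ 2 * braidGen 0, by
  rw [MonoidHom.mem_ker, map_mul, map_mul, braidPerm_gen_sq, mul_one, ← map_mul, inv_mul_cancel,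
    map_one]⟩

/-- `X₂₄ = σ₂⁻¹ σ₃² σ₂ = σ₃ σ₂² σ₃⁻¹`. -/
def pb24 : PureBraid4 := ⟨(braidGen 1)⁻¹ * braidGen 2 ^ 2 * braidGen 1, by
  rw [MonoidHom.mem_ker, map_mul, map_mul, braidPerm_gen_sq, mul_one, ← map_mul, inv_mul_cancel,
    map_one]⟩

/-! The groups `GT(K)`, `GT_p` and the Lie algebra `gt(K)`. -/

section GT

variable {K : Type*} [Field K]

/-- The augmentation ideal `I` of the group algebra `K[PB₄]`. The prounipotent completion `PB₄(K)`
and its Lie algebra `pb₄(K)` consist of the group-like, respectively primitive, elements of the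
completion `lim K[PB₄] / Iⁿ`. -/
def pbIdeal (K : Type*) [Field K] : Ideal (MonoidAlgebra K PureBraid4) :=
  RingHom.ker (MonoidAlgebra.lift K K PureBraid4 (1 : PureBraid4 →* K))

/-- `f(ln g, ln h)` modulo `Iⁿ`, for `g, h ∈ PB₄`. Since `ch(a, b) = ln(e^a e^b)`, one has
`ch(x_{i,j}, x_{k,l}) = ln(X_{i,j} X_{k,l})` for `x_{i,j} = ln X_{i,j}`. -/
def pbEval (n : ℕ) (f : NCSeries K) (g h : PureBraid4) : MonoidAlgebra K PureBraid4 :=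
  truncEval n f (truncLog K n (MonoidAlgebra.of K PureBraid4 g))
    (truncLog K n (MonoidAlgebra.of K PureBraid4 h))

/-- The Grothendieck–Teichmüller group `GT(K)`, as a set of pairs `(λ, f)`. In the second relation
`m = (λ - 1) / 2` and `z = -ch(x, y)`, i.e. `e^x e^y e^z = 1`. The last relation is an equality in
the completed group algebra of `PB₄`, i.e. modulo all powers of the augmentation ideal. -/
def GT (K : Type*) [Field K] : Set (K × NCSeries K) :=
  {g | g.1 ≠ 0 ∧ g.2.IsGroupLike ∧
    (let f := g.2
     let x := NCSeries.X K
     let y := NCSeries.Y K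
     let z := -NCSeries.ch K
     let m := (g.1 - 1) / 2
     f * f.subst y x = 1 ∧
     f.subst z x * (m • z).exp * f.subst y z * (m • y).exp * f * (m • x).exp = 1 ∧
     ∀ n : ℕ,
       pbEval n f pb12 (pb23 * pb24) * pbEval n f (pb13 * pb23) pb34 -
         pbEval n f pb23 pb34 * pbEval n f (pb12 * pb13) (pb24 * pb34) * pbEval n f pb12 pb23 ∈
           pbIdeal K ^ n)}

/-- The Grothendieck–Teichmüller Lie algebra `gt(K)`, as a set of pairs `(s, ψ)`. The last relation
is an equality in `pb₄(K)`, which is contained in the completed group algebra of `PB₄`. -/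
def gtLie (K : Type*) [Field K] : Set (K × NCSeries K) :=
  {X | X.2.IsLieSeries ∧
    (let s := X.1
     let ψ := X.2
     let x := NCSeries.X K
     let y := NCSeries.Y K
     let z := -NCSeries.ch K
     ψ = -ψ.subst y x ∧
     ψ + ψ.subst y z + ψ.subst z x + (s / 2) • (x + y + z) = 0 ∧
     ∀ n : ℕ,
       pbEval n ψ pb12 (pb23 * pb24) + pbEval n ψ (pb13 * pb23) pb34 -
         (pbEval n ψ pb23 pb34 + pbEval n ψ (pb12 * pb13) (pb24 * pb34) + pbEval n ψ pb12 pb23) ∈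
           pbIdeal K ^ n)}

/-- The group law
`(λ₁, f₁) · (λ₂, f₂) = (λ₁ λ₂, f₁(λ₂ f₂ x f₂⁻¹, λ₂ y) f₂)`. -/
def gtMul (g₁ g₂ : K × NCSeries K) : K × NCSeries K :=
  (g₁.1 * g₂.1,
    g₁.2.subst (g₂.1 • (g₂.2 * NCSeries.X K * Ring.inverse g₂.2)) (g₂.1 • NCSeries.Y K) * g₂.2)

/-- The powers of `g` for the group law `gtMul`; the unit is `(1, 1)`. -/
def gtPow (g : K × NCSeries K) : ℕ → K × NCSeries K
  | 0 => (1, 1)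
  | n + 1 => gtMul (gtPow g n) g

/-- The expression `(g - 1)ⁿ = ∑_k (-1)^(n-k) (n choose k) g^k`: the powers of `g` are taken in the
group and the linear combination is formed in the vector space `K × K⟨⟨x, y⟩⟩`. The group law is
linear in its left factor, so this is the `n`-th power of the operator `h ↦ h · g - h` applied
to the unit. -/
def gtSubOnePow (g : K × NCSeries K) (n : ℕ) : K × NCSeries K :=
  ∑ k ∈ Finset.range (n + 1), ((-1 : K) ^ (n - k) * (n.choose k : K)) • gtPow g k

/-- The term `(-1)^(n+1) (g - 1)ⁿ / n` of the Taylor series of `ln g`, with `n + 1` in place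
of `n`. -/
def gtLogTerm (g : K × NCSeries K) (n : ℕ) : K × NCSeries K :=
  ((-1 : K) ^ n / ((n : K) + 1)) • gtSubOnePow g (n + 1)

/-- The logarithm `ln g = ∑_{n ≥ 1} (-1)^(n+1) (g - 1)ⁿ / n` of the Grothendieck–Teichmüller group,
as a sum in `K × K⟨⟨x, y⟩⟩` with the topology of coefficientwise convergence. -/
def gtLog [TopologicalSpace K] (g : K × NCSeries K) : K × NCSeries K := ∑' n, gtLogTerm g n

end GT

section Padic

variable (p : ℕ) [Fact p.Prime]

/-- The `p`-adic logarithm `ln t = ∑_{n ≥ 1} (-1)^(n+1) (t - 1)ⁿ / n`. -/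
def padicLn (t : ℚ_[p]) : ℚ_[p] := ∑' n : ℕ, (-1) ^ n / ((n : ℚ_[p]) + 1) * (t - 1) ^ (n + 1)

/-- `ℤ_p⟨⟨x̂, ŷ⟩⟩^{≥ m}`, for `x̂ = e^x - 1` and `ŷ = e^y - 1`, as a subset of `ℚ_p⟨⟨x, y⟩⟩`. -/
def hatSeries (m : ℕ) : Set (NCSeries ℚ_[p]) :=
  {h | ∃ c : NCSeries ℚ_[p], (∀ w, ‖c w‖ ≤ 1) ∧ (∀ w, w.length < m → c w = 0) ∧
    h = c.subst ((NCSeries.X ℚ_[p]).exp - 1) ((NCSeries.Y ℚ_[p]).exp - 1)}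

/-- The subgroup `GT_p` of `GT(ℚ_p)`: the pairs `(λ, f)` with `λ ∈ ℤ_p^*` and `f` in the pro-`p`
completion of the free group, i.e. `f` is a group-like element of `ℤ_p⟨⟨x̂, ŷ⟩⟩`. -/
def GTp : Set (ℚ_[p] × NCSeries ℚ_[p]) :=
  {g | g ∈ GT ℚ_[p] ∧ (∃ u : ℤ_[p]ˣ, g.1 = ((u : ℤ_[p]) : ℚ_[p])) ∧ g.2 ∈ hatSeries p 0}

/-- `∑_{s ≥ 0} 2^{-(s+2)} ℤ₂⟨⟨x̂, ŷ⟩⟩^{≥ 2^s}`: the sums of all series `∑ₛ aₛ` with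
`aₛ ∈ 2^{-(s+2)} ℤ₂⟨⟨x̂, ŷ⟩⟩^{≥ 2^s}`. -/
def psiEstimate : Set (NCSeries ℚ_[2]) :=
  {ψ | ∃ a : ℕ → NCSeries ℚ_[2],
    (∀ s, ∃ h ∈ hatSeries 2 (2 ^ s), a s = ((2 : ℚ_[2]) ^ (s + 2))⁻¹ • h) ∧ HasSum a ψ}

end Padic

end

/-! Write g = (λ, f). The group law is linear in its left factor, so right multiplication by g acts
on second components as the linear operator R : h ↦ h(λ f x f⁻¹, λ y) f, and the second component of
ln g is the operator logarithm of R applied to 1.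

Convergence and the estimate. In the coordinates x̂, ŷ the operator substitutes f e^{λx} f⁻¹ - 1 for
x̂ and e^{λy} - 1 for ŷ, and then multiplies by f. These series are 2-adically integral: (1 + x̂)^λ
is a limit of natural powers (`binomialSeries_mem`), and f⁻¹ = f(y, x) by duality. Their linear
parts are λx̂ and λŷ. Hence R - 1 sends a word of length n to λⁿ - 1 times itself, which is
divisible by 4, plus integral terms of higher degree. So the coefficient at w of (R - 1)ⁿ 1 is
divisible by 4^{n - |w|} (`norm_substMul_sub_pow_le`). The denominator n of the logarithm costs at
most 2^v with 2^v ≤ n. Balancing the two, the logarithm has denominators at most 2^s at words of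
length below 2^{s+1} (`norm_hatLog_le`). As λ - 1 has valuation exactly 2, so has ln λ, and division
by it turns 2^s into 2^{s+2}. Cutting the words into dyadic blocks of lengths gives the asserted
form of ψ.

Membership in the Lie algebra. Since binom(2^k - 1, n) tends to (-1)ⁿ 2-adically, ln g is the limit
of (g^{2^k} - 1) / 2^k. The powers of g lie in GT, so ln g is a tangent vector at the unit, and the
relations of GT differentiate to those of its Lie algebra (`mem_gtLie_of_tendsto`). The derivative
of group-likeness is primitivity, which gives a Lie series by Friedrichs' criterion.

Closure of GT under products (`gtMul_mem_GT`). All relations are tested in algebras with a nilpotent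
ideal, where a series f becomes an operation on unipotent units and the relations become identities
in a group. Duality and hexagon of a product are then formal (`comp_dual`, `comp_hex`). For the
pentagon, an element of GT twists a representation of B₄ with unipotent pure braids into another one
(`exists_twist`); the pentagon of the first factor in the representation twisted by the second is,
after conjugations, the pentagon of the product. The representations of B₄ on K[B₄] modulo the
ideals generated by the powers of the augmentation ideal of PB₄ detect the relation
(`mem_of_subgroupAlgHom_mem`). -/

noncomputable section

/-! Words of bounded length. -/

/-- The words of length less than `k`. -/
def wordsLT : ℕ → Finset (List (Fin 2))
  | 0 => ∅
  | k + 1 => insert [] ((wordsLT k).image (fun w => 0 :: w) ∪ (wordsLT k).image (fun w => 1 :: w))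

theorem mem_wordsLT {k : ℕ} {w : List (Fin 2)} : w ∈ wordsLT k ↔ w.length < k := by
  induction k generalizing w with
  | zero => simp [wordsLT]
  | succ k ih =>
    rcases w with _ | ⟨a, w⟩
    · simp [wordsLT]
    · fin_cases a <;> simp [wordsLT, ih]

theorem sum_wordsLT_succ {M : Type*} [AddCommMonoid M] (g : List (Fin 2) → M) (k : ℕ) :
    ∑ w ∈ wordsLT (k + 1), g w =
      g [] + (∑ w ∈ wordsLT k, g (0 :: w) + ∑ w ∈ wordsLT k, g (1 :: w)) := by
  rw [wordsLT, Finset.sum_insert (by simp), Finset.sum_union, Finset.sum_image, Finset.sum_image]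
  · intro a _ b _ h; simpa using h
  · intro a _ b _ h; simpa using h
  · rw [Finset.disjoint_left]
    intro x hx hx'
    simp only [Finset.mem_image] at hx hx'
    obtain ⟨u, _, rfl⟩ := hx
    obtain ⟨v, _, h⟩ := hx'
    simp at h

theorem sum_ofFn_succ {M : Type*} [AddCommMonoid M] (g : List (Fin 2) → M) (n : ℕ) :
    ∑ v : Fin (n + 1) → Fin 2, g (List.ofFn v) =
      ∑ v : Fin n → Fin 2, g (0 :: List.ofFn v) + ∑ v : Fin n → Fin 2, g (1 :: List.ofFn v) := by
  rw [← (Fin.consEquiv (fun _ : Fin (n + 1) => Fin 2)).sum_comp, Fintype.sum_prod_type]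
  simp [Fin.consEquiv, List.ofFn_succ]

theorem sum_range_ofFn {M : Type*} [AddCommMonoid M] (g : List (Fin 2) → M) (k : ℕ) :
    ∑ n ∈ Finset.range k, ∑ v : Fin n → Fin 2, g (List.ofFn v) = ∑ w ∈ wordsLT k, g w := by
  induction k generalizing g with
  | zero => simp [wordsLT]
  | succ k ih =>
    rw [Finset.sum_range_succ', sum_wordsLT_succ, ← ih, ← ih]
    simp only [sum_ofFn_succ, Finset.sum_add_distrib]
    simp [add_comm]

/-! ### Evaluation of noncommutative series in an algebra with a nilpotent ideal. -/

section Eval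

variable {K A : Type*} [Field K] [Ring A] [Algebra K A]

/-- The value of a word. -/
def wordProd (a b : A) (w : List (Fin 2)) : A := (w.map ![a, b]).prod

@[simp] theorem wordProd_nil (a b : A) : wordProd a b [] = 1 := rfl

theorem wordProd_cons (a b : A) (i : Fin 2) (w : List (Fin 2)) :
    wordProd a b (i :: w) = ![a, b] i * wordProd a b w := by simp [wordProd]

theorem truncEval_eq_sum (k : ℕ) (f : NCSeries K) (a b : A) :
    truncEval k f a b = ∑ w ∈ wordsLT k, f w • wordProd a b w :=
  sum_range_ofFn (fun w => f w • wordProd a b w) k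

theorem truncEval_zero (f : NCSeries K) (a b : A) : truncEval 0 f a b = 0 := by
  simp [truncEval]

/-- Splitting every nonempty word at its first letter gives a Horner-type recursion, the engine of
the inductions on the truncation order. -/
theorem truncEval_succ (k : ℕ) (f : NCSeries K) (a b : A) :
    truncEval (k + 1) f a b = f [] • (1 : A) +
      (a * truncEval k (f.tail 0) a b + b * truncEval k (f.tail 1) a b) := by
  simp only [truncEval_eq_sum, sum_wordsLT_succ, Finset.mul_sum, wordProd_cons, NCSeries.tail]
  simp [Algebra.mul_smul_comm]

theorem truncEval_add (k : ℕ) (f g : NCSeries K) (a b : A) :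
    truncEval k (f + g) a b = truncEval k f a b + truncEval k g a b := by
  simp [truncEval_eq_sum, add_smul, Finset.sum_add_distrib]

theorem truncEval_smul (k : ℕ) (c : K) (f : NCSeries K) (a b : A) :
    truncEval k (c • f) a b = c • truncEval k f a b := by
  simp [truncEval_eq_sum, Finset.smul_sum, mul_smul]

theorem truncEval_one (k : ℕ) (a b : A) : truncEval (k + 1) (1 : NCSeries K) a b = 1 := by
  rw [truncEval_eq_sum, Finset.sum_eq_single []]
  · simp [NCSeries.one_apply]
  · intro w _ h; simp [NCSeries.one_apply, h]
  · intro h; simp [mem_wordsLT] at h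

theorem truncEval_X (k : ℕ) (a b : A) : truncEval (k + 2) (NCSeries.X K) a b = a := by
  rw [truncEval_eq_sum, Finset.sum_eq_single [0]]
  · simp [NCSeries.X, wordProd]
  · intro w _ h; simp [NCSeries.X, h]
  · intro h; simp [mem_wordsLT] at h

theorem truncEval_Y (k : ℕ) (a b : A) : truncEval (k + 2) (NCSeries.Y K) a b = b := by
  rw [truncEval_eq_sum, Finset.sum_eq_single [1]]
  · simp [NCSeries.Y, wordProd]
  · intro w _ h; simp [NCSeries.Y, h]
  · intro h; simp [mem_wordsLT] at h

theorem map_wordProd {B : Type*} [Ring B] [Algebra K B] (φ : A →ₐ[K] B) (a b : A)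
    (w : List (Fin 2)) : φ (wordProd a b w) = wordProd (φ a) (φ b) w := by
  induction w with
  | nil => simp
  | cons i w ih => rw [wordProd_cons, map_mul, ih, wordProd_cons]; fin_cases i <;> rfl

theorem map_truncEval {B : Type*} [Ring B] [Algebra K B] (φ : A →ₐ[K] B) (k : ℕ)
    (f : NCSeries K) (a b : A) : φ (truncEval k f a b) = truncEval k f (φ a) (φ b) := by
  simp only [truncEval_eq_sum, map_sum, map_smul, map_wordProd]

theorem map_truncExp {B : Type*} [Ring B] [Algebra K B] (φ : A →ₐ[K] B) (k : ℕ) (a : A) :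
    φ (truncExp K k a) = truncExp K k (φ a) := by
  simp only [truncExp, map_sum, map_smul, map_pow]

theorem map_truncLog {B : Type*} [Ring B] [Algebra K B] (φ : A →ₐ[K] B) (k : ℕ) (a : A) :
    φ (truncLog K k a) = truncLog K k (φ a) := by
  simp only [truncLog, map_sum, map_smul, map_pow, map_sub, map_one]

theorem mem_ideal_pow_zero (N : Ideal A) (a : A) : a ∈ N ^ 0 := by
  rw [Submodule.pow_zero, Ideal.one_eq_top]
  exact Submodule.mem_top

theorem wordProd_mem_pow {N : Ideal A} [N.IsTwoSided] {a b : A} (ha : a ∈ N) (hb : b ∈ N)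
    (w : List (Fin 2)) : wordProd a b w ∈ N ^ w.length := by
  induction w with
  | nil => exact mem_ideal_pow_zero N _
  | cons i w ih =>
    rw [wordProd_cons, List.length_cons, Ideal.IsTwoSided.pow_succ]
    refine Ideal.mul_mem_mul ?_ ih
    fin_cases i <;> assumption

theorem algebra_smul_mem {N : Ideal A} (c : K) {a : A} (ha : a ∈ N) : c • a ∈ N := by
  rw [Algebra.smul_def]
  exact N.mul_mem_left _ ha

theorem truncEval_succ_sub_mem {N : Ideal A} [N.IsTwoSided] {a b : A} (ha : a ∈ N) (hb : b ∈ N)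
    (k : ℕ) (f : NCSeries K) : truncEval (k + 1) f a b - truncEval k f a b ∈ N ^ k := by
  induction k generalizing f with
  | zero => exact mem_ideal_pow_zero N _
  | succ k ih =>
    rw [truncEval_succ (k + 1) f, truncEval_succ k f, add_sub_add_left_eq_sub, add_sub_add_comm,
      ← mul_sub, ← mul_sub, Ideal.IsTwoSided.pow_succ]
    exact add_mem (Ideal.mul_mem_mul ha (ih _)) (Ideal.mul_mem_mul hb (ih _))

/-- The two sides differ by products of words of total length at least `k`, and these lie in `N ^
k`. Consequently evaluation is multiplicative as soon as `N ^ k = ⊥`. -/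
theorem truncEval_mul_sub_mem {N : Ideal A} [N.IsTwoSided] {a b : A} (ha : a ∈ N) (hb : b ∈ N)
    (k : ℕ) (f g : NCSeries K) :
    truncEval k f a b * truncEval k g a b - truncEval k (f * g) a b ∈ N ^ k := by
  induction k generalizing f with
  | zero => exact mem_ideal_pow_zero N _
  | succ k ih =>
    have ht : ∀ i, (f * g).tail i = f [] • g.tail i + f.tail i * g := by
      intro i
      ext v
      exact NCSeries.mul_cons f g i v
    -- The recursion lowers the truncation of the left factor only. The surplus layer of `g`, of
    -- degree `k`, lies in `N ^ k`, so the induction hypothesis still applies.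
    have key : ∀ i, truncEval k (f.tail i) a b * truncEval (k + 1) g a b
        - truncEval k (f.tail i * g) a b ∈ N ^ k := by
      intro i
      have h1 := ih (f.tail i)
      have h2 := (N ^ k).mul_mem_left (truncEval k (f.tail i) a b)
        (truncEval_succ_sub_mem ha hb k g)
      have := add_mem h1 h2
      rwa [mul_sub, add_comm, sub_add_sub_cancel] at this
    have e : truncEval (k + 1) f a b * truncEval (k + 1) g a b - truncEval (k + 1) (f * g) a b =
        a * (truncEval k (f.tail 0) a b * truncEval (k + 1) g a b
          - truncEval k (f.tail 0 * g) a b) +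
        b * (truncEval k (f.tail 1) a b * truncEval (k + 1) g a b
          - truncEval k (f.tail 1 * g) a b) := by
      rw [truncEval_succ k f, truncEval_succ k (f * g), ht, ht]
      simp only [truncEval_add, truncEval_smul, NCSeries.mul_nil]
      have : truncEval (k + 1) g a b = g [] • (1 : A) +
        (a * truncEval k (g.tail 0) a b + b * truncEval k (g.tail 1) a b) := truncEval_succ _ _ _ _
      simp only [add_mul, smul_mul_assoc, one_mul, mul_sub, mul_add, mul_smul_comm, mul_assoc]
      nth_rw 1 [this]
      simp only [smul_add, smul_smul]
      abel
    rw [e, Ideal.IsTwoSided.pow_succ]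
    exact add_mem (Ideal.mul_mem_mul ha (key _)) (Ideal.mul_mem_mul hb (key _))

/-- Evaluation of noncommutative series at two elements of a nilpotent ideal. -/
def evalHom {N : Ideal A} [N.IsTwoSided] {k : ℕ} (hN : N ^ k = ⊥) {a b : A} (ha : a ∈ N)
    (hb : b ∈ N) : NCSeries K →ₐ[K] A :=
  AlgHom.ofLinearMap
    { toFun := fun f => truncEval k f a b
      map_add' := fun f g => truncEval_add k f g a b
      map_smul' := fun c f => truncEval_smul k c f a b }
    (by
      change truncEval k 1 a b = 1
      -- For `k = 0` the hypothesis on `N` makes `A` the zero ring, so the empty truncation is still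
      -- equal to `1`.
      rcases k with _ | k
      · have : (1 : A) ∈ N ^ 0 := mem_ideal_pow_zero N 1
        rw [hN, Submodule.mem_bot] at this
        rw [truncEval_zero, this]
      · exact truncEval_one k a b)
    (fun f g => by
      have := truncEval_mul_sub_mem ha hb k f g
      rw [hN, Submodule.mem_bot, sub_eq_zero] at this
      exact this.symm)

theorem evalHom_apply {N : Ideal A} [N.IsTwoSided] {k : ℕ} (hN : N ^ k = ⊥) {a b : A} (ha : a ∈ N)
    (hb : b ∈ N) (f : NCSeries K) : evalHom hN ha hb f = truncEval k f a b := rfl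

/-- Truncation at order below two drops the letter, but then nilpotency forces `a = 0`: either the
ring or the ideal is zero. -/
theorem truncEval_X_of_nilpotent {N : Ideal A} [N.IsTwoSided] {k : ℕ} (hN : N ^ k = ⊥) {a : A}
    (ha : a ∈ N) (b : A) : truncEval k (NCSeries.X K) a b = a := by
  rcases k with _ | _ | k
  · have : (1 : A) ∈ N ^ 0 := mem_ideal_pow_zero N 1
    rw [hN, Submodule.mem_bot] at this
    rw [truncEval_zero, ← mul_one a, this, mul_zero]
  · rw [Submodule.pow_one] at hN
    rw [hN, Submodule.mem_bot] at ha
    simp [truncEval_succ, truncEval_zero, NCSeries.X, ha]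
  · exact truncEval_X k a b

theorem truncEval_Y_of_nilpotent {N : Ideal A} [N.IsTwoSided] {k : ℕ} (hN : N ^ k = ⊥) (a : A)
    {b : A} (hb : b ∈ N) : truncEval k (NCSeries.Y K) a b = b := by
  rcases k with _ | _ | k
  · have : (1 : A) ∈ N ^ 0 := mem_ideal_pow_zero N 1
    rw [hN, Submodule.mem_bot] at this
    rw [truncEval_zero, ← mul_one b, this, mul_zero]
  · rw [Submodule.pow_one] at hN
    rw [hN, Submodule.mem_bot] at hb
    simp [truncEval_succ, truncEval_zero, NCSeries.Y, hb]
  · exact truncEval_Y k a b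

end Eval

namespace NCSeries

/-! ### Filtration by order, and reduction of identities of series to nilpotent truncations. -/

section Order

variable {K : Type*} [Field K]

/-- The series of order at least `n`. -/
def orderIdeal (K : Type*) [Field K] (n : ℕ) : Ideal (NCSeries K) where
  carrier := {f | ∀ w, w.length < n → f w = 0}
  add_mem' := fun {f g} hf hg w hw => by simp [hf w hw, hg w hw]
  zero_mem' := fun w _ => rfl
  smul_mem' := fun c f hf w hw => by
    rw [smul_eq_mul, mul_apply]
    refine Finset.sum_eq_zero fun i _ => ?_
    rw [hf (w.drop i) (by simp; omega), mul_zero]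

theorem mem_orderIdeal {n : ℕ} {f : NCSeries K} :
    f ∈ orderIdeal K n ↔ ∀ w, w.length < n → f w = 0 := Iff.rfl

theorem mul_mem_orderIdeal {m n : ℕ} {f g : NCSeries K} (hf : f ∈ orderIdeal K m)
    (hg : g ∈ orderIdeal K n) : f * g ∈ orderIdeal K (m + n) := by
  intro w hw
  rw [mul_apply]
  refine Finset.sum_eq_zero fun i hi => ?_
  rw [Finset.mem_range] at hi
  by_cases h : i < m
  · rw [hf (w.take i) (by simp; omega), zero_mul]
  · rw [hg (w.drop i) (by simp; omega), mul_zero]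

instance (n : ℕ) : (orderIdeal K n).IsTwoSided :=
  ⟨fun {a} b ha => by
    have : b ∈ orderIdeal K 0 := fun w hw => by simp at hw
    exact mul_mem_orderIdeal ha this⟩

theorem orderIdeal_one_pow_le (n : ℕ) : orderIdeal K 1 ^ n ≤ orderIdeal K n := by
  induction n with
  | zero => intro f _ w hw; simp at hw
  | succ n ih =>
    rw [Ideal.IsTwoSided.pow_succ, Ideal.mul_le]
    intro r hr s hs
    rw [add_comm]
    exact mul_mem_orderIdeal hr (ih hs)

theorem mem_orderIdeal_one {f : NCSeries K} : f ∈ orderIdeal K 1 ↔ f [] = 0 := by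
  rw [mem_orderIdeal]
  constructor
  · intro h; exact h [] (by simp)
  · intro h w hw
    rw [List.length_eq_zero_iff.1 (by omega : w.length = 0), h]

theorem pow_mem_orderIdeal {a : NCSeries K} (ha : a ∈ orderIdeal K 1) (n : ℕ) :
    a ^ n ∈ orderIdeal K n :=
  orderIdeal_one_pow_le n (Ideal.pow_mem_pow ha n)

@[simp] theorem neg_apply (f : NCSeries K) (w : List (Fin 2)) : (-f) w = -(f w) := rfl

@[simp] theorem sub_apply (f g : NCSeries K) (w : List (Fin 2)) : (f - g) w = f w - g w := rfl

theorem eq_of_sub_mem {f g : NCSeries K} (h : ∀ n, f - g ∈ orderIdeal K n) : f = g := by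
  ext w
  have := h (w.length + 1) w (by omega)
  rwa [sub_apply, sub_eq_zero] at this

theorem sum_apply {ι : Type*} (s : Finset ι) (g : ι → NCSeries K) (w : List (Fin 2)) :
    (∑ i ∈ s, g i) w = ∑ i ∈ s, g i w :=
  Finset.sum_apply w s g

theorem wordProd_mem_orderIdeal {a b : NCSeries K} (ha : a ∈ orderIdeal K 1)
    (hb : b ∈ orderIdeal K 1) (w : List (Fin 2)) : wordProd a b w ∈ orderIdeal K w.length :=
  orderIdeal_one_pow_le _ (wordProd_mem_pow ha hb w)

theorem X_mem : X K ∈ orderIdeal K 1 := mem_orderIdeal_one.2 (by simp [X])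

theorem Y_mem : Y K ∈ orderIdeal K 1 := mem_orderIdeal_one.2 (by simp [Y])

/-- Terms of order above the length of `w` do not contribute at `w`. Hence the word-dependent
truncations in the definitions of `exp`, `log` and `subst` can be replaced by any uniform longer
one. -/
theorem sum_apply_eq_of_order {g : ℕ → NCSeries K} (hg : ∀ j, g j ∈ orderIdeal K j)
    {m n : ℕ} {w : List (Fin 2)} (hm : w.length < m) (hn : w.length < n) :
    (∑ j ∈ Finset.range m, g j) w = (∑ j ∈ Finset.range n, g j) w := by
  have : ∀ m, w.length < m →
      (∑ j ∈ Finset.range m, g j) w = (∑ j ∈ Finset.range (w.length + 1), g j) w := by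
    intro m hm
    rw [sum_apply, sum_apply]
    symm
    apply Finset.sum_subset
    · intro i; simp; omega
    · intro i _ hi
      exact hg i w (by simpa using hi)
  rw [this m hm, this n hn]

theorem subst_apply {a b : NCSeries K} (ha : a ∈ orderIdeal K 1) (hb : b ∈ orderIdeal K 1)
    (f : NCSeries K) {n : ℕ} {w : List (Fin 2)} (h : w.length < n) :
    f.subst a b w = truncEval n f a b w := by
  refine sum_apply_eq_of_order (g := fun n => ∑ v : Fin n → Fin 2,
    f (List.ofFn v) • ((List.ofFn v).map ![a, b]).prod) (fun j => ?_) (by omega) h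
  refine sum_mem fun v _ => algebra_smul_mem _ ?_
  have := wordProd_mem_orderIdeal ha hb (List.ofFn v)
  rwa [List.length_ofFn] at this

theorem exp_apply {a : NCSeries K} (ha : a ∈ orderIdeal K 1) {n : ℕ} {w : List (Fin 2)}
    (h : w.length < n) : a.exp w = truncExp K n a w :=
  sum_apply_eq_of_order (fun j => algebra_smul_mem _ (pow_mem_orderIdeal ha j)) (by omega) h

theorem log_apply {u : NCSeries K} (hu : u - 1 ∈ orderIdeal K 1) {n : ℕ} {w : List (Fin 2)}
    (h : w.length < n) : u.log w = truncLog K n u w := by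
  have e : ∀ n, truncLog K n u = ∑ j ∈ Finset.range n, ((-1 : K) ^ (j + 1) / (j : K)) •
      (u - 1) ^ j := by
    intro n
    rw [truncLog, Finset.range_eq_Ico]
    rcases n with _ | n
    · simp
    · rw [Finset.sum_eq_sum_Ico_succ_bot (Nat.succ_pos n)]
      simp
  rw [log, e, e]
  exact sum_apply_eq_of_order (fun j => algebra_smul_mem _ (pow_mem_orderIdeal hu j)) (by omega) h

theorem subst_sub_mem {a b : NCSeries K} (ha : a ∈ orderIdeal K 1) (hb : b ∈ orderIdeal K 1)
    (f : NCSeries K) (n : ℕ) : f.subst a b - truncEval n f a b ∈ orderIdeal K n := fun w hw => by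
  rw [sub_apply, subst_apply ha hb f hw, sub_self]

theorem exp_sub_mem {a : NCSeries K} (ha : a ∈ orderIdeal K 1) (n : ℕ) :
    a.exp - truncExp K n a ∈ orderIdeal K n := fun w hw => by
  rw [sub_apply, exp_apply ha hw, sub_self]

theorem log_sub_mem {u : NCSeries K} (hu : u - 1 ∈ orderIdeal K 1) (n : ℕ) :
    u.log - truncLog K n u ∈ orderIdeal K n := fun w hw => by
  rw [sub_apply, log_apply hu hw, sub_self]

/-- The nilpotent quotient `K⟨⟨x, y⟩⟩ / (order ≥ n)`. -/
abbrev Trunc (K : Type*) [Field K] (n : ℕ) : Type _ := NCSeries K ⧸ orderIdeal K n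

/-- The projection to the truncation. -/
def toTrunc (K : Type*) [Field K] (n : ℕ) : NCSeries K →ₐ[K] Trunc K n :=
  Ideal.Quotient.mkₐ K (orderIdeal K n)

theorem toTrunc_eq_iff {n : ℕ} {f g : NCSeries K} :
    toTrunc K n f = toTrunc K n g ↔ f - g ∈ orderIdeal K n :=
  Ideal.Quotient.eq

/-- The augmentation ideal of the truncation. -/
def truncIdeal (K : Type*) [Field K] (n : ℕ) : Ideal (Trunc K n) :=
  (orderIdeal K 1).map (Ideal.Quotient.mk (orderIdeal K n))

theorem mem_truncIdeal_iff {n : ℕ} {a : Trunc K n} :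
    a ∈ truncIdeal K n ↔ ∃ f ∈ orderIdeal K 1, toTrunc K n f = a :=
  Ideal.mem_map_iff_of_surjective _ Ideal.Quotient.mk_surjective

theorem toTrunc_mem {n : ℕ} {f : NCSeries K} (hf : f ∈ orderIdeal K 1) :
    toTrunc K n f ∈ truncIdeal K n := mem_truncIdeal_iff.2 ⟨f, hf, rfl⟩

instance (n : ℕ) : (truncIdeal K n).IsTwoSided :=
  ⟨fun {a} b ha => by
    obtain ⟨f, hf, rfl⟩ := mem_truncIdeal_iff.1 ha
    obtain ⟨g, rfl⟩ := Ideal.Quotient.mk_surjective b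
    exact mem_truncIdeal_iff.2 ⟨f * g, Ideal.mul_mem_right _ _ hf, map_mul _ _ _⟩⟩

theorem truncIdeal_pow (n : ℕ) : truncIdeal K n ^ n = ⊥ := by
  have h : ∀ m, truncIdeal K n ^ m ≤ (orderIdeal K m).map (Ideal.Quotient.mk (orderIdeal K n)) := by
    intro m
    induction m with
    | zero =>
      intro a _
      obtain ⟨f, rfl⟩ := Ideal.Quotient.mk_surjective a
      exact Ideal.mem_map_of_mem _ (fun w hw => by simp at hw)
    | succ m ih =>
      rw [Ideal.IsTwoSided.pow_succ, Ideal.mul_le]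
      intro r hr s hs
      obtain ⟨f, hf, rfl⟩ := mem_truncIdeal_iff.1 hr
      obtain ⟨g, hg, rfl⟩ := (Ideal.mem_map_iff_of_surjective _ Ideal.Quotient.mk_surjective).1
        (ih hs)
      rw [add_comm m 1]
      exact Ideal.mem_map_of_mem (Ideal.Quotient.mk _) (mul_mem_orderIdeal hf hg)
  rw [eq_bot_iff]
  refine (h n).trans ?_
  rw [Ideal.map_le_iff_le_comap]
  intro f hf
  rw [Ideal.mem_comap, Submodule.mem_bot]
  exact Ideal.Quotient.eq_zero_iff_mem.2 hf

/-- The filtration by order is separated. This reduces identities between series to nilpotent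
algebras, where exponential and logarithm are polynomials. -/
theorem eq_of_toTrunc_eq {f g : NCSeries K} (h : ∀ n, toTrunc K n f = toTrunc K n g) : f = g :=
  eq_of_sub_mem fun n => toTrunc_eq_iff.1 (h n)

theorem toTrunc_subst {a b : NCSeries K} (ha : a ∈ orderIdeal K 1) (hb : b ∈ orderIdeal K 1)
    (f : NCSeries K) (n : ℕ) :
    toTrunc K n (f.subst a b) = truncEval n f (toTrunc K n a) (toTrunc K n b) := by
  rw [← map_truncEval, toTrunc_eq_iff]
  exact subst_sub_mem ha hb f n

theorem toTrunc_exp {a : NCSeries K} (ha : a ∈ orderIdeal K 1) (n : ℕ) :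
    toTrunc K n a.exp = truncExp K n (toTrunc K n a) := by
  rw [← map_truncExp, toTrunc_eq_iff]
  exact exp_sub_mem ha n

theorem toTrunc_log {u : NCSeries K} (hu : u - 1 ∈ orderIdeal K 1) (n : ℕ) :
    toTrunc K n u.log = truncLog K n (toTrunc K n u) := by
  rw [← map_truncLog, toTrunc_eq_iff]
  exact log_sub_mem hu n

theorem letter_mul_apply (i : Fin 2) (g : NCSeries K) (v : List (Fin 2)) :
    (![X K, Y K] i * g) v = match v with
      | [] => 0
      | j :: v => if j = i then g v else 0 := by
  rcases v with _ | ⟨j, v⟩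
  · rw [mul_nil]
    fin_cases i <;> simp [X, Y]
  · have hX : tail 0 (X K) = 1 := by ext u; simp [tail, X, one_apply]
    have hX' : tail 1 (X K) = 0 := by ext u; simp [tail, X]
    have hY : tail 1 (Y K) = 1 := by ext u; simp [tail, Y, one_apply]
    have hY' : tail 0 (Y K) = 0 := by ext u; simp [tail, Y]
    rw [mul_cons]
    fin_cases i <;> fin_cases j <;> simp [hX, hX', hY, hY'] <;> simp [X, Y]

theorem wordProd_X_Y_apply (w v : List (Fin 2)) :
    wordProd (X K) (Y K) w v = if v = w then 1 else 0 := by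
  induction w generalizing v with
  | nil => rfl
  | cons i w ih =>
    rw [wordProd_cons, letter_mul_apply]
    rcases v with _ | ⟨j, v⟩
    · simp
    · simp only [ih, List.cons.injEq]
      by_cases h : j = i <;> simp [h]

/-- A series is its own value at the letters; thus an identity proved for values in all nilpotent
algebras specialises to an identity of series. -/
theorem toTrunc_self (f : NCSeries K) (n : ℕ) :
    toTrunc K n f = truncEval n f (toTrunc K n (X K)) (toTrunc K n (Y K)) := by
  rw [← map_truncEval, toTrunc_eq_iff]
  intro v hv
  rw [sub_apply, truncEval_eq_sum, sum_apply, Finset.sum_eq_single v]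
  · simp [wordProd_X_Y_apply]
  · intro w _ hw; simp [wordProd_X_Y_apply, hw.symm]
  · intro hv'; exact absurd (mem_wordsLT.2 hv) hv'

theorem evalHom_eq_zero {A : Type*} [Ring A] [Algebra K A] {N : Ideal A} [N.IsTwoSided] {k : ℕ}
    (hN : N ^ k = ⊥) {a b : A} (ha : a ∈ N) (hb : b ∈ N) {f : NCSeries K}
    (hf : f ∈ orderIdeal K k) : evalHom hN ha hb f = 0 := by
  rw [evalHom_apply, truncEval_eq_sum]
  exact Finset.sum_eq_zero fun w hw => by rw [hf w (mem_wordsLT.1 hw), zero_smul]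

section

variable {A : Type*} [Ring A] [Algebra K A] {N : Ideal A} [N.IsTwoSided] {k : ℕ}
    (hN : N ^ k = ⊥) {a b : A} (ha : a ∈ N) (hb : b ∈ N)

/-- The truncation error of the substituted series has order at least `k`, so evaluation kills it,
and what remains is a polynomial expression preserved by any algebra homomorphism. The same argument
serves `exp` and `log`. -/
theorem evalHom_subst {s t : NCSeries K} (hs : s ∈ orderIdeal K 1) (ht : t ∈ orderIdeal K 1)
    (f : NCSeries K) :
    evalHom hN ha hb (f.subst s t) = truncEval k f (evalHom hN ha hb s) (evalHom hN ha hb t) := by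
  rw [← map_truncEval, ← sub_eq_zero, ← map_sub]
  exact evalHom_eq_zero hN ha hb (subst_sub_mem hs ht f k)

theorem evalHom_exp {s : NCSeries K} (hs : s ∈ orderIdeal K 1) :
    evalHom hN ha hb s.exp = truncExp K k (evalHom hN ha hb s) := by
  rw [← map_truncExp, ← sub_eq_zero, ← map_sub]
  exact evalHom_eq_zero hN ha hb (exp_sub_mem hs k)

theorem evalHom_log {u : NCSeries K} (hu : u - 1 ∈ orderIdeal K 1) :
    evalHom hN ha hb u.log = truncLog K k (evalHom hN ha hb u) := by
  rw [← map_truncLog, ← sub_eq_zero, ← map_sub]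
  exact evalHom_eq_zero hN ha hb (log_sub_mem hu k)

theorem evalHom_mem {s : NCSeries K} (hs : s ∈ orderIdeal K 1) : evalHom hN ha hb s ∈ N := by
  rw [evalHom_apply, truncEval_eq_sum]
  refine sum_mem fun w _ => ?_
  rcases w with _ | ⟨i, w⟩
  · rw [mem_orderIdeal_one.1 hs, zero_smul]; exact zero_mem _
  · refine algebra_smul_mem _ ?_
    rw [wordProd_cons]
    apply N.mul_mem_right
    fin_cases i <;> assumption

theorem evalHom_X : evalHom hN ha hb (X K) = a := truncEval_X_of_nilpotent hN ha b

theorem evalHom_Y : evalHom hN ha hb (Y K) = b := truncEval_Y_of_nilpotent hN a hb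

end

end Order

end NCSeries

end

noncomputable section

/-! The exponential and the logarithm on a nilpotent ideal. -/

section PolynomialIdentities

open Polynomial

variable {K : Type*} [Field K]

theorem truncExp_succ {A : Type*} [Ring A] [Algebra K A] (m : ℕ) (a : A) :
    truncExp K (m + 1) a = truncExp K m a + ((m.factorial : K)⁻¹) • a ^ m := by
  rw [truncExp, Finset.sum_range_succ, truncExp]

theorem derivative_truncExp [CharZero K] (m : ℕ) (l : K[X]) :
    derivative (truncExp K (m + 1) l) = truncExp K m l * derivative l := by
  rw [truncExp, Finset.sum_range_succ', truncExp, derivative_add, derivative_sum, Finset.sum_mul]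
  simp only [pow_zero, derivative_smul, derivative_one, smul_zero, add_zero]
  refine Finset.sum_congr rfl fun j _ => ?_
  have h : (((j + 1).factorial : K))⁻¹ * (j + 1 : K) = (j.factorial : K)⁻¹ := by
    rw [Nat.factorial_succ, Nat.cast_mul, mul_inv, mul_right_comm, Nat.cast_add, Nat.cast_one,
      inv_mul_cancel₀ (Nat.cast_add_one_ne_zero j), one_mul]
  rw [derivative_pow_succ, ← h]
  simp only [smul_eq_C_mul, C_mul, map_add, map_natCast, map_one]
  ring

/-- The derivative of the truncated logarithm is a finite geometric sum in `1 - u`, so `u (ln u)' =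
u'` holds up to the last term of that sum. -/
theorem derivative_truncLog [CharZero K] (m : ℕ) (u : K[X]) :
    u * derivative (truncLog K (m + 1) u) = (1 - (1 - u) ^ m) * derivative u := by
  have h : derivative (truncLog K (m + 1) u) =
      (∑ i ∈ Finset.range m, (1 - u) ^ i) * derivative u := by
    rw [truncLog, Finset.sum_Ico_eq_sum_range, derivative_sum, Finset.sum_mul]
    refine Finset.sum_congr (by simp) fun j _ => ?_
    have h : (-1 : K) ^ (1 + j + 1) / ((1 + j : ℕ) : K) * (j + 1) = (-1) ^ j := by
      have := Nat.cast_add_one_ne_zero (R := K) j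
      push_cast
      rw [add_comm (1 : K), div_mul_cancel₀ _ this]
      ring
    have h2 : (1 - u) ^ j = C ((-1) ^ j) * (u - 1) ^ j := by
      rw [← neg_sub u 1, neg_pow]; simp
    rw [h2, ← h, derivative_smul, add_comm 1 j, derivative_pow_succ]
    simp only [smul_eq_C_mul, C_mul, map_add, map_natCast, map_one, Nat.cast_add, Nat.cast_one,
      derivative_sub, derivative_one, sub_zero]
    ring
  rw [h, ← mul_assoc]
  congr 1
  have := mul_neg_geom_sum (1 - u) m
  rwa [sub_sub_cancel] at this

theorem X_dvd_truncExp_sub_one (m : ℕ) {l : K[X]} (hl : X ∣ l) :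
    X ∣ truncExp K (m + 1) l - 1 := by
  rw [truncExp, Finset.sum_range_succ']
  simp only [Nat.factorial_zero, Nat.cast_one, inv_one, pow_zero, one_smul, add_sub_cancel_right]
  refine Finset.dvd_sum fun j _ => ?_
  rw [smul_eq_C_mul, pow_succ]
  exact Dvd.dvd.mul_left (Dvd.dvd.mul_left hl _) _

theorem X_dvd_truncLog (m : ℕ) {u : K[X]} (hu : X ∣ u - 1) : X ∣ truncLog K m u := by
  rw [truncLog]
  refine Finset.dvd_sum fun j hj => ?_
  rw [smul_eq_C_mul]
  exact Dvd.dvd.mul_left (hu.trans (dvd_pow_self _ (by have := Finset.mem_Ico.1 hj; omega))) _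

/-- The difference vanishes at `0`, and its derivative is divisible by `X ^ m` after multiplication
by the truncated exponential. In characteristic zero this can be integrated. -/
theorem X_pow_dvd_truncLog_truncExp [CharZero K] (m : ℕ) :
    X ^ (m + 1) ∣ truncLog K (m + 1) (truncExp K (m + 1) (X : K[X])) - X := by
  set E := truncExp K (m + 1) (X : K[X]) with hE
  set D := truncLog K (m + 1) E - X
  have hE1 : X ∣ E - 1 := X_dvd_truncExp_sub_one m dvd_rfl
  have h0 : D.coeff 0 = 0 := by
    rw [← X_dvd_iff]
    exact dvd_sub (X_dvd_truncLog _ hE1) dvd_rfl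
  have hD : X ^ m ∣ E * derivative D := by
    have e : E * derivative D = -(1 - E) ^ m * truncExp K m X -
        ((m.factorial : K)⁻¹) • X ^ m := by
      have h1 : derivative E = truncExp K m X := by
        rw [hE, derivative_truncExp, derivative_X, mul_one]
      rw [derivative_sub, mul_sub, derivative_truncLog, h1, derivative_X, hE, truncExp_succ]
      ring
    rw [e, smul_eq_C_mul]
    refine dvd_sub (Dvd.dvd.mul_right ?_ _) (Dvd.dvd.mul_left dvd_rfl _)
    rw [dvd_neg]
    exact pow_dvd_pow_of_dvd (by rw [← neg_sub, dvd_neg]; exact hE1) m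
  -- The truncated exponential has constant term `1`, hence is coprime to `X` and can be cancelled.
  have hcop : IsCoprime (X ^ m : K[X]) E := by
    apply IsCoprime.pow_left
    obtain ⟨q, hq⟩ := hE1
    exact ⟨-q, 1, by rw [sub_eq_iff_eq_add.1 hq]; ring⟩
  have hD' := hcop.dvd_of_dvd_mul_left hD
  rw [X_pow_dvd_iff] at hD' ⊢
  intro d hd
  rcases d with _ | d
  · exact h0
  · have := hD' d (by omega)
    rw [coeff_derivative] at this
    exact (mul_eq_zero.1 this).resolve_right (Nat.cast_add_one_ne_zero d)

/-- The difference `D` satisfies `(1 + X) D' ≡ D` modulo `X ^ m` and `D(0) = 0`. Comparing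
coefficients, each one forces the next to vanish. -/
theorem X_pow_dvd_truncExp_truncLog [CharZero K] (m : ℕ) :
    X ^ (m + 1) ∣ truncExp K (m + 1) (truncLog K (m + 1) (1 + X : K[X])) - (1 + X) := by
  set l := truncLog K (m + 1) (1 + X : K[X]) with hl
  set D := truncExp K (m + 1) l - (1 + X)
  have hl1 : X ∣ l := X_dvd_truncLog _ (by simp)
  have h0 : D.coeff 0 = 0 := by
    rw [← X_dvd_iff]
    have : D = truncExp K (m + 1) l - 1 - X := by ring
    rw [this]
    exact dvd_sub (X_dvd_truncExp_sub_one m hl1) dvd_rfl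
  have hD : X ^ m ∣ (1 + X) * derivative D - D := by
    have e : (1 + X) * derivative D - D =
        -((m.factorial : K)⁻¹) • l ^ m - truncExp K m l * (1 - (1 + X)) ^ m := by
      have h1 : (1 + X) * derivative l = 1 - (1 - (1 + X)) ^ m := by
        rw [hl, derivative_truncLog]; simp
      rw [derivative_sub, derivative_truncExp, mul_sub, mul_left_comm, h1]
      simp only [D, truncExp_succ, derivative_add, derivative_X, derivative_one, neg_smul]
      ring
    rw [e, smul_eq_C_mul]
    refine dvd_sub (Dvd.dvd.mul_left (pow_dvd_pow_of_dvd hl1 m) _) (Dvd.dvd.mul_left ?_ _)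
    exact pow_dvd_pow_of_dvd (by simp) m
  rw [X_pow_dvd_iff] at hD ⊢
  intro d
  induction d with
  | zero => intro _; exact h0
  | succ d ih =>
    intro hd
    have h1 := ih (by omega)
    have h2 := hD d (by omega)
    rw [add_mul, one_mul, coeff_sub, coeff_add, coeff_derivative, h1, sub_zero] at h2
    have h3 : (X * derivative D).coeff d = 0 := by
      rcases d with _ | d
      · simp
      · rw [coeff_X_mul, coeff_derivative, h1, zero_mul]
    rw [h3, add_zero] at h2
    exact (mul_eq_zero.1 h2).resolve_right (Nat.cast_add_one_ne_zero d)

end PolynomialIdentities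

/-! ### Exponential and logarithm of nilpotent elements, by specialising the polynomial congruences.
-/

section Nilpotent

variable {K A : Type*} [Field K] [Ring A] [Algebra K A]

theorem subsingleton_of_pow_zero_eq {a : A} (h : a ^ 0 = 0) (x y : A) : x = y := by
  rw [pow_zero] at h
  rw [← mul_one x, ← mul_one y, h, mul_zero, mul_zero]

theorem truncLog_truncExp [CharZero K] {k : ℕ} {a : A} (ha : a ^ k = 0) :
    truncLog K k (truncExp K k a) = a := by
  rcases k with _ | m
  · exact subsingleton_of_pow_zero_eq ha _ _
  · obtain ⟨q, hq⟩ := X_pow_dvd_truncLog_truncExp (K := K) m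
    have := congrArg (Polynomial.aeval a) hq
    rw [map_mul, map_pow, Polynomial.aeval_X, ha, zero_mul, map_sub, map_truncLog, map_truncExp,
      Polynomial.aeval_X, sub_eq_zero] at this
    exact this

theorem truncExp_truncLog [CharZero K] {k : ℕ} {u : A} (hu : (u - 1) ^ k = 0) :
    truncExp K k (truncLog K k u) = u := by
  rcases k with _ | m
  · exact subsingleton_of_pow_zero_eq hu _ _
  · obtain ⟨q, hq⟩ := X_pow_dvd_truncExp_truncLog (K := K) m
    have := congrArg (Polynomial.aeval (u - 1)) hq
    rw [map_mul, map_pow, Polynomial.aeval_X, hu, zero_mul, map_sub, map_truncExp, map_truncLog,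
      map_add, map_one, Polynomial.aeval_X, add_sub_cancel, sub_eq_zero] at this
    exact this

/-- The comparison with the rational exponential imports its additivity on commuting elements. -/
theorem truncExp_eq_exp [CharZero K] [Module ℚ A] {k : ℕ} {a : A} (ha : a ^ k = 0) :
    truncExp K k a = IsNilpotent.exp a := by
  rw [IsNilpotent.exp_eq_sum ha, truncExp]
  refine Finset.sum_congr rfl fun j _ => ?_
  have h : ((j.factorial : ℕ) : K) • ((j.factorial : K)⁻¹ • a ^ j) =
      ((j.factorial : ℕ) : K) • ((j.factorial : ℚ)⁻¹ • a ^ j) := by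
    rw [smul_smul, mul_inv_cancel₀ (Nat.cast_ne_zero.2 (Nat.factorial_ne_zero j)), one_smul,
      Nat.cast_smul_eq_nsmul, ← Nat.cast_smul_eq_nsmul ℚ, smul_smul,
      mul_inv_cancel₀ (Nat.cast_ne_zero.2 (Nat.factorial_ne_zero j)), one_smul]
  have hne : ((j.factorial : ℕ) : K) ≠ 0 := Nat.cast_ne_zero.2 (Nat.factorial_ne_zero j)
  have := congrArg (fun x => ((j.factorial : K)⁻¹) • x) h
  simpa only [inv_smul_smul₀ hne] using this

theorem pow_eq_zero_of_mem {N : Ideal A} {k : ℕ} (hN : N ^ k = ⊥) {a : A} (ha : a ∈ N) :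
    a ^ k = 0 := by
  have := Ideal.pow_mem_pow ha k
  rwa [hN, Submodule.mem_bot] at this

theorem truncExp_add [CharZero K] {N : Ideal A} {k : ℕ} (hN : N ^ k = ⊥) {a b : A} (ha : a ∈ N)
    (hb : b ∈ N) (hab : Commute a b) :
    truncExp K k (a + b) = truncExp K k a * truncExp K k b := by
  let : Module ℚ A := Module.compHom A (algebraMap ℚ K)
  rw [truncExp_eq_exp (pow_eq_zero_of_mem hN ha), truncExp_eq_exp (pow_eq_zero_of_mem hN hb),
    truncExp_eq_exp (pow_eq_zero_of_mem hN (add_mem ha hb))]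
  exact IsNilpotent.exp_add_of_commute hab ⟨k, pow_eq_zero_of_mem hN ha⟩
    ⟨k, pow_eq_zero_of_mem hN hb⟩

theorem truncExp_zero {N : Ideal A} {k : ℕ} (hN : N ^ k = ⊥) : truncExp K k (0 : A) = 1 := by
  rcases k with _ | m
  · exact subsingleton_of_pow_zero_eq (pow_eq_zero_of_mem hN (zero_mem N)) _ _
  · rw [truncExp, Finset.sum_range_succ']
    simp

theorem truncExp_sub_one_mem {N : Ideal A} [N.IsTwoSided] {k : ℕ} (hN : N ^ k = ⊥) {a : A}
    (ha : a ∈ N) : truncExp K k a - 1 ∈ N := by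
  rcases k with _ | m
  · rw [subsingleton_of_pow_zero_eq (pow_eq_zero_of_mem hN ha) (truncExp K 0 a - 1) 0]
    exact zero_mem _
  · rw [truncExp, Finset.sum_range_succ']
    simp only [Nat.factorial_zero, Nat.cast_one, inv_one, pow_zero, one_smul, add_sub_cancel_right]
    exact sum_mem fun j _ => algebra_smul_mem _ (by rw [pow_succ]; exact N.mul_mem_left _ ha)

theorem truncLog_mem {N : Ideal A} [N.IsTwoSided] {k : ℕ} {u : A} (hu : u - 1 ∈ N) :
    truncLog K k u ∈ N := by
  rw [truncLog]
  refine sum_mem fun j hj => algebra_smul_mem _ ?_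
  obtain ⟨i, rfl⟩ : ∃ i, j = i + 1 := ⟨j - 1, by have := Finset.mem_Ico.1 hj; omega⟩
  rw [pow_succ]
  exact N.mul_mem_left _ hu

theorem Commute.truncLog_right {a u : A} (h : Commute a u) (k : ℕ) :
    Commute a (truncLog K k u) := by
  rw [truncLog]
  exact Commute.sum_right _ _ _ fun j _ =>
    ((h.sub_right (Commute.one_right a)).pow_right j).smul_right _

theorem Commute.wordProd_right {a b c : A} (hb : Commute a b) (hc : Commute a c)
    (w : List (Fin 2)) : Commute a (wordProd b c w) := by
  induction w with
  | nil => exact Commute.one_right a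
  | cons i w ih =>
    rw [wordProd_cons]
    refine Commute.mul_right ?_ ih
    fin_cases i <;> assumption

end Nilpotent

end

noncomputable section

/-! Shuffles, unshuffles and group-like series. -/

namespace NCSeries

/-- All ways of cutting a word into two complementary subwords, with multiplicity. -/
def unshuffles : List (Fin 2) → List (List (Fin 2) × List (Fin 2))
  | [] => [([], [])]
  | a :: w => (unshuffles w).map (fun p => (a :: p.1, p.2)) ++
      (unshuffles w).map (fun p => (p.1, a :: p.2))

theorem length_of_mem_unshuffles {w : List (Fin 2)} {p : List (Fin 2) × List (Fin 2)}
    (h : p ∈ unshuffles w) : p.1.length + p.2.length = w.length := by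
  induction w generalizing p with
  | nil => simp only [unshuffles, List.mem_singleton] at h; simp [h]
  | cons a w ih =>
    simp only [unshuffles, List.mem_append, List.mem_map] at h
    rcases h with ⟨q, hq, rfl⟩ | ⟨q, hq, rfl⟩ <;> have := ih hq <;> simp <;> omega

theorem shuffles_nil_left (v : List (Fin 2)) : shuffles [] v = [v] := by rw [shuffles]

theorem shuffles_nil_right (u : List (Fin 2)) : shuffles u [] = [u] := by
  cases u <;> rw [shuffles]

theorem shuffles_cons_cons (a b : Fin 2) (u v : List (Fin 2)) :
    shuffles (a :: u) (b :: v) = (shuffles u (b :: v)).map (fun w => a :: w) ++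
      (shuffles (a :: u) v).map (fun w => b :: w) := by
  rw [shuffles]

theorem count_map_cons (a c : Fin 2) (w : List (Fin 2)) (l : List (List (Fin 2))) :
    (l.map (fun w => a :: w)).count (c :: w) = if a = c then l.count w else 0 := by
  induction l with
  | nil => simp
  | cons x l ih =>
    rw [List.map_cons, List.count_cons, List.count_cons, ih]
    by_cases h : a = c <;> simp [h]

theorem count_map_cons_nil (a : Fin 2) (l : List (List (Fin 2))) :
    (l.map (fun w => a :: w)).count [] = 0 := by
  simp [List.count_eq_zero]

theorem count_map_fst (a : Fin 2) (u v : List (Fin 2))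
    (l : List (List (Fin 2) × List (Fin 2))) :
    (l.map (fun p => (a :: p.1, p.2))).count (u, v) =
      match u with
      | [] => 0
      | c :: u => if a = c then l.count (u, v) else 0 := by
  induction l with
  | nil => cases u <;> simp
  | cons x l ih =>
    rw [List.map_cons, List.count_cons, ih]
    cases u with
    | nil => simp
    | cons c u =>
      by_cases h : a = c <;> simp [h, List.count_cons, Prod.ext_iff]

theorem count_map_snd (a : Fin 2) (u v : List (Fin 2))
    (l : List (List (Fin 2) × List (Fin 2))) :
    (l.map (fun p => (p.1, a :: p.2))).count (u, v) =
      match v with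
      | [] => 0
      | c :: v => if a = c then l.count (u, v) else 0 := by
  induction l with
  | nil => cases v <;> simp
  | cons x l ih =>
    rw [List.map_cons, List.count_cons, ih]
    cases v with
    | nil => simp
    | cons c v =>
      by_cases h : a = c <;> simp [h, List.count_cons, Prod.ext_iff]

/-- Shuffling and cutting into complementary subwords are adjoint. The second operation recurses on
a single word, which makes the coproduct accessible to induction. -/
theorem count_shuffles (w u v : List (Fin 2)) :
    (shuffles u v).count w = (unshuffles w).count (u, v) := by
  induction w generalizing u v with
  | nil =>
    rcases u with _ | ⟨a, u⟩ <;> rcases v with _ | ⟨b, v⟩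
    · simp [shuffles_nil_left, unshuffles]
    · simp [shuffles_nil_left, unshuffles]
    · simp [shuffles_nil_right, unshuffles]
    · simp [shuffles_cons_cons, unshuffles, count_map_cons_nil]
  | cons c w ih =>
    rw [unshuffles, List.count_append, count_map_fst, count_map_snd]
    rcases u with _ | ⟨a, u⟩ <;> rcases v with _ | ⟨b, v⟩
    · simp [shuffles_nil_left]
    · simp only [← ih, shuffles_nil_left, List.count_cons, List.count_nil]
      rcases eq_or_ne c b with rfl | h
      · simp
      · simp [h, h.symm]
    · simp only [← ih, shuffles_nil_right, List.count_cons, List.count_nil]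
      rcases eq_or_ne c a with rfl | h
      · simp
      · simp [h, h.symm]
    · simp only [← ih, shuffles_cons_cons, List.count_append, count_map_cons, eq_comm]

theorem length_of_mem_shuffles {u v w : List (Fin 2)} (h : w ∈ shuffles u v) :
    w.length = u.length + v.length := by
  have h1 : 0 < (unshuffles w).count (u, v) := by
    rw [← count_shuffles]; exact List.count_pos_iff.2 h
  exact (length_of_mem_unshuffles (List.count_pos_iff.1 h1)).symm

theorem sum_map_eq_sum_count {α M : Type*} [BEq α] [LawfulBEq α] [AddCommMonoid M] (l : List α)
    (s : Finset α) (hs : ∀ x ∈ l, x ∈ s) (g : α → M) :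
    (l.map g).sum = ∑ x ∈ s, l.count x • g x := by
  induction l with
  | nil => simp
  | cons a l ih =>
    rw [List.map_cons, List.sum_cons, ih fun x hx => hs x (List.mem_cons_of_mem a hx)]
    simp only [List.count_cons, add_smul, Finset.sum_add_distrib]
    rw [add_comm, Finset.sum_eq_single a (f := fun x => (if a == x then 1 else 0) • g x)]
    · simp
    · intro b _ hb; simp [hb.symm]
    · intro h; exact absurd (hs a List.mem_cons_self) h

section Sum

variable {K M : Type*} [Field K] [AddCommGroup M] [Module K M]

/-- Summation over the unshuffles of words against summation of the coproduct. -/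
theorem sum_unshuffles (k : ℕ) (f : NCSeries K) (g : List (Fin 2) → List (Fin 2) → M) :
    ∑ w ∈ wordsLT k, f w • ((unshuffles w).map (fun p => g p.1 p.2)).sum =
      ∑ u ∈ wordsLT k, ∑ v ∈ wordsLT k,
        if u.length + v.length < k then coproduct f u v • g u v else 0 := by
  have h1 : ∀ u ∈ wordsLT k, ∀ v ∈ wordsLT k,
      (if u.length + v.length < k then coproduct f u v • g u v else 0) =
        ∑ w ∈ wordsLT k, f w • ((unshuffles w).count (u, v) • g u v) := by
    intro u _ v _
    split_ifs with h
    · have hs : coproduct f u v = ∑ w ∈ wordsLT k, (shuffles u v).count w • f w := by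
        refine sum_map_eq_sum_count (shuffles u v) (wordsLT k) (fun w hw => ?_) f
        rw [mem_wordsLT, length_of_mem_shuffles hw]
        exact h
      rw [hs, Finset.sum_smul]
      refine Finset.sum_congr rfl fun w _ => ?_
      rw [count_shuffles, smul_assoc, smul_comm]
    · symm
      refine Finset.sum_eq_zero fun w hw => ?_
      rw [List.count_eq_zero.2, zero_smul, smul_zero]
      intro hm
      have := length_of_mem_unshuffles hm
      have := mem_wordsLT.1 hw
      simp only at *
      omega
  rw [Finset.sum_congr rfl fun u hu => Finset.sum_congr rfl fun v hv => h1 u hu v hv]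
  rw [Finset.sum_congr rfl fun u _ => Finset.sum_comm, Finset.sum_comm]
  refine Finset.sum_congr rfl fun w hw => ?_
  rw [sum_map_eq_sum_count (unshuffles w) (wordsLT k ×ˢ wordsLT k), Finset.sum_product,
    Finset.smul_sum]
  · refine Finset.sum_congr rfl fun u _ => ?_
    rw [Finset.smul_sum]
  · intro p hp
    have := length_of_mem_unshuffles hp
    have := mem_wordsLT.1 hw
    rw [Finset.mem_product, mem_wordsLT, mem_wordsLT]
    omega

end Sum

section Eval

variable {K A : Type*} [Field K] [Ring A] [Algebra K A]

/-- Expanding the product, each letter chooses the first or the second pair; as the pairs commute,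
the chosen letters can be collected into two subwords. -/
theorem wordProd_add {a b a' b' : A} (h1 : Commute a a') (h2 : Commute a b') (h3 : Commute b a')
    (h4 : Commute b b') (w : List (Fin 2)) :
    wordProd (a + a') (b + b') w =
      ((unshuffles w).map (fun p => wordProd a b p.1 * wordProd a' b' p.2)).sum := by
  induction w with
  | nil => simp [unshuffles]
  | cons i w ih =>
    have hc : ∀ u, Commute (![a', b'] i) (wordProd a b u) := by
      intro u
      fin_cases i
      · exact Commute.wordProd_right h1.symm h3.symm u
      · exact Commute.wordProd_right h2.symm h4.symm u
    have hi : ![a + a', b + b'] i = ![a, b] i + ![a', b'] i := by fin_cases i <;> rfl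
    rw [wordProd_cons, ih, hi, add_mul, unshuffles, List.map_append, List.sum_append, List.map_map,
      List.map_map, ← List.sum_map_mul_left, ← List.sum_map_mul_left]
    congr 2
    · refine List.map_congr_left fun p _ => ?_
      simp [wordProd_cons, mul_assoc]
    · refine List.map_congr_left fun p _ => ?_
      simp only [Function.comp, wordProd_cons]
      rw [← mul_assoc, (hc p.1).eq, mul_assoc]

theorem truncEval_add_arg {a b a' b' : A} (h1 : Commute a a') (h2 : Commute a b')
    (h3 : Commute b a') (h4 : Commute b b') (k : ℕ) (f : NCSeries K) :
    truncEval k f (a + a') (b + b') = ∑ u ∈ wordsLT k, ∑ v ∈ wordsLT k,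
      if u.length + v.length < k then coproduct f u v • (wordProd a b u * wordProd a' b' v)
      else 0 := by
  rw [truncEval_eq_sum, ← sum_unshuffles]
  exact Finset.sum_congr rfl fun w _ => by rw [wordProd_add h1 h2 h3 h4]

/-- This is `Δ(f) = f ⊗ f` evaluated at two commuting pairs. The double sum for the product also
contains pairs of words of total length at least `k`; those vanish by nilpotency. -/
theorem IsGroupLike.truncEval_add {f : NCSeries K} (hf : f.IsGroupLike) {N : Ideal A}
    [N.IsTwoSided] {k : ℕ} (hN : N ^ k = ⊥) {a b a' b' : A} (ha : a ∈ N) (hb : b ∈ N)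
    (ha' : a' ∈ N) (hb' : b' ∈ N) (h1 : Commute a a') (h2 : Commute a b')
    (h3 : Commute b a') (h4 : Commute b b') :
    truncEval k f (a + a') (b + b') = truncEval k f a b * truncEval k f a' b' := by
  rw [truncEval_add_arg h1 h2 h3 h4, truncEval_eq_sum, truncEval_eq_sum, Finset.sum_mul_sum]
  refine Finset.sum_congr rfl fun u _ => Finset.sum_congr rfl fun v _ => ?_
  rw [smul_mul_smul_comm]
  split_ifs with h
  · rw [hf.2]
  · have h5 : wordProd a b u * wordProd a' b' v ∈ N ^ (u.length + v.length) := by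
      rw [Ideal.IsTwoSided.pow_add]
      exact Ideal.mul_mem_mul (wordProd_mem_pow ha hb u) (wordProd_mem_pow ha' hb' v)
    have h6 := Ideal.pow_le_pow_right (not_lt.1 h) h5
    rw [hN, Submodule.mem_bot] at h6
    rw [h6, smul_zero]

end Eval

/-! ### Multiplicativity on commuting pairs of arguments characterises group-like series. -/

section Criterion

variable (K : Type*) [Field K]

/-- The algebra of noncommutative polynomials in two pairs of letters, the first pair commuting
with the second. -/
abbrev PairAlgebra : Type _ := MonoidAlgebra K (FreeMonoid (Fin 2) × FreeMonoid (Fin 2))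

/-- The elements of `PairAlgebra` of order at least `n`. -/
def pairIdeal (n : ℕ) : Ideal (PairAlgebra K) where
  carrier := {g | ∀ u v : List (Fin 2), u.length + v.length < n →
    g.coeff (FreeMonoid.ofList u, FreeMonoid.ofList v) = 0}
  add_mem' := fun {f g} hf hg u v h => by
    rw [MonoidAlgebra.coeff_add, Finsupp.add_apply, hf u v h, hg u v h, add_zero]
  zero_mem' := fun u v _ => rfl
  smul_mem' := fun c f hf u v h => by
    classical
    rw [smul_eq_mul, MonoidAlgebra.coeff_mul]
    refine Finset.sum_eq_zero fun m _ => Finset.sum_eq_zero fun m' _ => ?_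
    dsimp only
    split_ifs with e
    · have h1 := congrArg (fun p => p.1.toList.length) e
      have h2 := congrArg (fun p => p.2.toList.length) e
      simp only [Prod.fst_mul, Prod.snd_mul, FreeMonoid.toList_mul, List.length_append,
        FreeMonoid.toList_ofList] at h1 h2
      have h3 := hf m'.1.toList m'.2.toList (by omega)
      rw [FreeMonoid.ofList_toList, FreeMonoid.ofList_toList] at h3
      rw [h3, mul_zero]
    · rfl

variable {K}

theorem mul_mem_pairIdeal {m n : ℕ} {f g : PairAlgebra K} (hf : f ∈ pairIdeal K m)
    (hg : g ∈ pairIdeal K n) : f * g ∈ pairIdeal K (m + n) := by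
  classical
  intro u v h
  rw [MonoidAlgebra.coeff_mul]
  refine Finset.sum_eq_zero fun p _ => Finset.sum_eq_zero fun q _ => ?_
  dsimp only
  split_ifs with e
  · have h1 := congrArg (fun p => p.1.toList.length) e
    have h2 := congrArg (fun p => p.2.toList.length) e
    simp only [Prod.fst_mul, Prod.snd_mul, FreeMonoid.toList_mul, List.length_append,
      FreeMonoid.toList_ofList] at h1 h2
    by_cases hm : p.1.toList.length + p.2.toList.length < m
    · have h3 := hf p.1.toList p.2.toList hm
      rw [FreeMonoid.ofList_toList, FreeMonoid.ofList_toList] at h3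
      rw [h3, zero_mul]
    · have h3 := hg q.1.toList q.2.toList (by omega)
      rw [FreeMonoid.ofList_toList, FreeMonoid.ofList_toList] at h3
      rw [h3, mul_zero]
  · rfl

theorem mem_pairIdeal_zero (f : PairAlgebra K) : f ∈ pairIdeal K 0 :=
  fun _ _ h => absurd h (Nat.not_lt_zero _)

instance (n : ℕ) : (pairIdeal K n).IsTwoSided :=
  ⟨fun {_} b ha => mul_mem_pairIdeal ha (mem_pairIdeal_zero b)⟩

variable (K) in
/-- The nilpotent quotient of `PairAlgebra`. -/
abbrev PairTrunc (n : ℕ) : Type _ := PairAlgebra K ⧸ pairIdeal K n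

variable (K) in
/-- The augmentation ideal of `PairTrunc`. -/
def pairTruncIdeal (n : ℕ) : Ideal (PairTrunc K n) :=
  (pairIdeal K 1).map (Ideal.Quotient.mk (pairIdeal K n))

theorem mem_pairTruncIdeal_iff {n : ℕ} {a : PairTrunc K n} :
    a ∈ pairTruncIdeal K n ↔ ∃ f ∈ pairIdeal K 1, Ideal.Quotient.mk (pairIdeal K n) f = a :=
  Ideal.mem_map_iff_of_surjective _ Ideal.Quotient.mk_surjective

instance (n : ℕ) : (pairTruncIdeal K n).IsTwoSided :=
  ⟨fun {a} b ha => by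
    obtain ⟨f, hf, rfl⟩ := mem_pairTruncIdeal_iff.1 ha
    obtain ⟨g, rfl⟩ := Ideal.Quotient.mk_surjective b
    exact mem_pairTruncIdeal_iff.2 ⟨f * g, Ideal.mul_mem_right _ _ hf, map_mul _ _ _⟩⟩

theorem pairTruncIdeal_pow (n : ℕ) : pairTruncIdeal K n ^ n = ⊥ := by
  have h : ∀ m, pairTruncIdeal K n ^ m ≤
      (pairIdeal K m).map (Ideal.Quotient.mk (pairIdeal K n)) := by
    intro m
    induction m with
    | zero =>
      intro a _
      obtain ⟨f, rfl⟩ := Ideal.Quotient.mk_surjective a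
      exact Ideal.mem_map_of_mem _ (mem_pairIdeal_zero f)
    | succ m ih =>
      rw [Ideal.IsTwoSided.pow_succ, Ideal.mul_le]
      intro r hr s hs
      obtain ⟨f, hf, rfl⟩ := mem_pairTruncIdeal_iff.1 hr
      obtain ⟨g, hg, rfl⟩ := (Ideal.mem_map_iff_of_surjective _ Ideal.Quotient.mk_surjective).1
        (ih hs)
      rw [add_comm m 1]
      exact Ideal.mem_map_of_mem (Ideal.Quotient.mk _) (mul_mem_pairIdeal hf hg)
  rw [eq_bot_iff]
  refine (h n).trans ?_
  rw [Ideal.map_le_iff_le_comap]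
  intro f hf
  rw [Ideal.mem_comap, Submodule.mem_bot]
  exact Ideal.Quotient.eq_zero_iff_mem.2 hf

/-- The letter `i` of the first pair. -/
def fstLetter (K : Type*) [Field K] (i : Fin 2) : PairAlgebra K :=
  MonoidAlgebra.of K _ (FreeMonoid.of i, 1)

/-- The letter `i` of the second pair. -/
def sndLetter (K : Type*) [Field K] (i : Fin 2) : PairAlgebra K :=
  MonoidAlgebra.of K _ (1, FreeMonoid.of i)

theorem fstLetter_mem (i : Fin 2) : fstLetter K i ∈ pairIdeal K 1 := by
  classical
  intro u v h
  rw [fstLetter, MonoidAlgebra.of_apply, MonoidAlgebra.coeff_single, Finsupp.single_apply,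
    if_neg]
  intro e
  have := congrArg (fun p => p.1.toList.length) e
  simp at this
  omega

theorem sndLetter_mem (i : Fin 2) : sndLetter K i ∈ pairIdeal K 1 := by
  classical
  intro u v h
  rw [sndLetter, MonoidAlgebra.of_apply, MonoidAlgebra.coeff_single, Finsupp.single_apply,
    if_neg]
  intro e
  have := congrArg (fun p => p.2.toList.length) e
  simp at this
  omega

theorem commute_fstLetter_sndLetter (i j : Fin 2) :
    Commute (fstLetter K i) (sndLetter K j) := by
  rw [Commute, SemiconjBy, fstLetter, sndLetter, ← map_mul, ← map_mul]
  simp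

theorem wordProd_fstLetter (u : List (Fin 2)) :
    wordProd (fstLetter K 0) (fstLetter K 1) u =
      MonoidAlgebra.of K _ (FreeMonoid.ofList u, 1) := by
  induction u with
  | nil => rw [wordProd_nil, FreeMonoid.ofList_nil, ← Prod.one_eq_mk, map_one]
  | cons i u ih =>
    have : ![fstLetter K 0, fstLetter K 1] i = fstLetter K i := by fin_cases i <;> rfl
    rw [wordProd_cons, ih, this, fstLetter, ← map_mul, Prod.mk_mul_mk, mul_one,
      FreeMonoid.ofList_cons]

theorem wordProd_sndLetter (u : List (Fin 2)) :
    wordProd (sndLetter K 0) (sndLetter K 1) u =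
      MonoidAlgebra.of K _ (1, FreeMonoid.ofList u) := by
  induction u with
  | nil => rw [wordProd_nil, FreeMonoid.ofList_nil, ← Prod.one_eq_mk, map_one]
  | cons i u ih =>
    have : ![sndLetter K 0, sndLetter K 1] i = sndLetter K i := by fin_cases i <;> rfl
    rw [wordProd_cons, ih, this, sndLetter, ← map_mul, Prod.mk_mul_mk, mul_one,
      FreeMonoid.ofList_cons]

theorem coeff_wordProd_mul (u v u' v' : List (Fin 2)) :
    (wordProd (fstLetter K 0) (fstLetter K 1) u' *
      wordProd (sndLetter K 0) (sndLetter K 1) v').coeff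
        (FreeMonoid.ofList u, FreeMonoid.ofList v) = if u' = u ∧ v' = v then 1 else 0 := by
  classical
  rw [wordProd_fstLetter, wordProd_sndLetter, ← map_mul, Prod.mk_mul_mk, mul_one, one_mul,
    MonoidAlgebra.of_apply, MonoidAlgebra.coeff_single, Finsupp.single_apply]
  refine if_congr ?_ rfl rfl
  rw [Prod.mk.injEq, FreeMonoid.ofList.injective.eq_iff, FreeMonoid.ofList.injective.eq_iff]

/-- A series is group-like if it is multiplicative on commuting pairs of arguments. -/
theorem isGroupLike_of_truncEval_add {f : NCSeries K} (h0 : f [] = 1)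
    (h : ∀ (k : ℕ) (a b a' b' : PairTrunc K k), a ∈ pairTruncIdeal K k → b ∈ pairTruncIdeal K k →
      a' ∈ pairTruncIdeal K k → b' ∈ pairTruncIdeal K k → Commute a a' → Commute a b' →
      Commute b a' → Commute b b' →
      truncEval k f (a + a') (b + b') = truncEval k f a b * truncEval k f a' b') :
    f.IsGroupLike := by
  refine ⟨h0, fun u v => ?_⟩
  -- The least truncation in which the coefficient at `u ⊗ v` survives.
  set k := u.length + v.length + 1 with hk
  let π : PairAlgebra K →ₐ[K] PairTrunc K k := Ideal.Quotient.mkₐ K (pairIdeal K k)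
  have hπ : ∀ {x}, x ∈ pairIdeal K 1 → π x ∈ pairTruncIdeal K k :=
    fun hx => mem_pairTruncIdeal_iff.2 ⟨_, hx, rfl⟩
  have e := h k (π (fstLetter K 0)) (π (fstLetter K 1)) (π (sndLetter K 0)) (π (sndLetter K 1))
    (hπ (fstLetter_mem 0)) (hπ (fstLetter_mem 1)) (hπ (sndLetter_mem 0)) (hπ (sndLetter_mem 1))
    ((commute_fstLetter_sndLetter 0 0).map π) ((commute_fstLetter_sndLetter 0 1).map π)
    ((commute_fstLetter_sndLetter 1 0).map π) ((commute_fstLetter_sndLetter 1 1).map π)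
  rw [← map_add, ← map_add, ← map_truncEval, ← map_truncEval, ← map_truncEval, ← map_mul] at e
  have e2 := Ideal.Quotient.eq.1 e u v (by omega)
  rw [MonoidAlgebra.coeff_sub, Finsupp.sub_apply, sub_eq_zero,
    truncEval_add_arg (commute_fstLetter_sndLetter 0 0) (commute_fstLetter_sndLetter 0 1)
      (commute_fstLetter_sndLetter 1 0) (commute_fstLetter_sndLetter 1 1),
    truncEval_eq_sum, truncEval_eq_sum, Finset.sum_mul_sum] at e2
  have hu : u ∈ wordsLT k := mem_wordsLT.2 (by omega)
  have hv : v ∈ wordsLT k := mem_wordsLT.2 (by omega)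
  -- The products of a word in the first letters and a word in the second letters are distinct basis
  -- elements, so coefficients can be read off.
  have key : ∀ g : List (Fin 2) → List (Fin 2) → K,
      (∑ u' ∈ wordsLT k, ∑ v' ∈ wordsLT k, g u' v' •
        (wordProd (fstLetter K 0) (fstLetter K 1) u' *
          wordProd (sndLetter K 0) (sndLetter K 1) v')).coeff
        (FreeMonoid.ofList u, FreeMonoid.ofList v) = g u v := by
    intro g
    simp only [MonoidAlgebra.coeff_sum, Finsupp.finsetSum_apply, MonoidAlgebra.coeff_smul,
      Finsupp.smul_apply, coeff_wordProd_mul, smul_eq_mul]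
    rw [Finset.sum_eq_single u, Finset.sum_eq_single v]
    · simp
    · intro v' _ hv'; simp [hv']
    · intro h; exact absurd hv h
    · intro u' _ hu'; simp [hu']
    · intro h; exact absurd hu h
  have key1 := key (fun u v => if u.length + v.length < k then coproduct f u v else 0)
  simp only [ite_smul, zero_smul] at key1
  rw [key1, if_pos (by omega)] at e2
  simp only [smul_mul_smul_comm] at e2
  rw [e2, key (fun u v => f u * f v)]

end Criterion

end NCSeries

end

noncomputable section

/-! Calculus in a group with a normal subgroup admitting `K`-powers. -/

/-- A normal subgroup `U` of `G` in which elements can be raised to powers in `K`. -/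
structure UnipotentPower (K G : Type*) [Field K] [Group G] where
  /-- The unipotent elements. -/
  U : Subgroup G
  normal : U.Normal
  /-- The powers. -/
  pow : G → K → G
  pow_mem : ∀ {u}, u ∈ U → ∀ t, pow u t ∈ U
  pow_one : ∀ {u}, u ∈ U → pow u 1 = u
  pow_add : ∀ {u}, u ∈ U → ∀ s t, pow u (s + t) = pow u s * pow u t
  pow_pow : ∀ {u}, u ∈ U → ∀ s t, pow (pow u s) t = pow u (s * t)
  conj : ∀ {u}, u ∈ U → ∀ t g, g * pow u t * g⁻¹ = pow (g * u * g⁻¹) t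
  mul_pow : ∀ {u v}, u ∈ U → v ∈ U → Commute u v → ∀ t, pow (u * v) t = pow u t * pow v t

/-- A binary operation with the formal properties of `(X, Y) ↦ f(X, Y)` for a group-like series
`f` which satisfies the duality and hexagon relations together with `lam`. -/
structure UnipotentPower.IsGTPair {K G : Type*} [Field K] [Group G] (P : UnipotentPower K G)
    (lam : K) (F : G → G → G) : Prop where
  mem : ∀ {u v}, u ∈ P.U → v ∈ P.U → F u v ∈ P.U
  conj : ∀ {u v}, u ∈ P.U → v ∈ P.U → ∀ g, g * F u v * g⁻¹ = F (g * u * g⁻¹) (g * v * g⁻¹)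
  dual : ∀ {u v}, u ∈ P.U → v ∈ P.U → F u v * F v u = 1
  hex : ∀ {u v w}, u ∈ P.U → v ∈ P.U → w ∈ P.U → u * v * w = 1 →
    F w u * P.pow w ((lam - 1) / 2) * F v w * P.pow v ((lam - 1) / 2) * F u v *
      P.pow u ((lam - 1) / 2) = 1
  mul : ∀ {u v c d}, u ∈ P.U → v ∈ P.U → c ∈ P.U → d ∈ P.U → Commute u c → Commute u d →
    Commute v c → Commute v d → F (u * c) (v * d) = F u v * F c d

namespace UnipotentPower

variable {K G : Type*} [Field K] [Group G] (P : UnipotentPower K G)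

theorem conj_mem {u : G} (hu : u ∈ P.U) (g : G) : g * u * g⁻¹ ∈ P.U := P.normal.conj_mem u hu g

theorem commute_pow {u g : G} (hu : u ∈ P.U) (h : Commute g u) (t : K) :
    Commute g (P.pow u t) := by
  have := P.conj hu t g
  rw [h.eq, mul_inv_cancel_right] at this
  exact mul_inv_eq_iff_eq_mul.1 this

theorem pow_zero {u : G} (hu : u ∈ P.U) : P.pow u 0 = 1 := by
  have := P.pow_add hu 0 0
  rw [add_zero] at this
  exact left_eq_mul.1 this

theorem pow_neg {u : G} (hu : u ∈ P.U) (t : K) : P.pow u (-t) = (P.pow u t)⁻¹ := by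
  rw [eq_inv_iff_mul_eq_one, ← P.pow_add hu, neg_add_cancel, P.pow_zero hu]

theorem inv_pow {u : G} (hu : u ∈ P.U) (t : K) : P.pow u⁻¹ t = (P.pow u t)⁻¹ := by
  have h : u⁻¹ = P.pow u (-1) := by rw [P.pow_neg hu, P.pow_one hu]
  rw [h, P.pow_pow hu, neg_one_mul, P.pow_neg hu]

/-- The splitting `λ = m + 1 + m`, with the `m` of the hexagon relation. -/
theorem pow_lam [CharZero K] {u : G} (hu : u ∈ P.U) (lam : K) :
    P.pow u lam = P.pow u ((lam - 1) / 2) * u * P.pow u ((lam - 1) / 2) := by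
  nth_rewrite 3 [← P.pow_one hu]
  rw [← P.pow_add hu, ← P.pow_add hu]
  congr 1
  ring

variable {P} {lam : K} {F : G → G → G}

namespace IsGTPair

variable (hF : P.IsGTPair lam F)

include hF

theorem dual_eq {u v : G} (hu : u ∈ P.U) (hv : v ∈ P.U) : F v u = (F u v)⁻¹ :=
  eq_inv_of_mul_eq_one_right (hF.dual hu hv)

theorem commute {u v g : G} (hu : u ∈ P.U) (hv : v ∈ P.U) (h1 : Commute g u) (h2 : Commute g v) :
    Commute g (F u v) := by
  have := hF.conj hu hv g
  rw [h1.eq, h2.eq, mul_inv_cancel_right, mul_inv_cancel_right] at this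
  exact mul_inv_eq_iff_eq_mul.1 this

theorem conj_inv {u v : G} (hu : u ∈ P.U) (hv : v ∈ P.U) (g : G) :
    g⁻¹ * F u v * g = F (g⁻¹ * u * g) (g⁻¹ * v * g) := by
  have := hF.conj hu hv g⁻¹
  rwa [inv_inv] at this

/-- Two hexagons, for `(x, y, z)` and for `(y, x, y z y⁻¹)`, eliminate `F z x`. The outcome is that
suitable conjugates of the `λ`-th powers of `x`, `y`, `z` again have product `1`, so that a second
hexagon can be applied to them. -/
theorem triple_relation [CharZero K] {x y z : G} (hx : x ∈ P.U) (hy : y ∈ P.U) (hz : z ∈ P.U)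
    (h : x * y * z = 1) :
    F x y * P.pow x lam * (F x y)⁻¹ * P.pow y lam *
      ((F y z * P.pow y ((lam - 1) / 2))⁻¹ * P.pow z lam *
        (F y z * P.pow y ((lam - 1) / 2))) = 1 := by
  have hz0 : z = y⁻¹ * x⁻¹ := by rw [← mul_inv_rev]; exact eq_inv_of_mul_eq_one_right h
  have hz1 : y * z * y⁻¹ = x⁻¹ * z * x := by rw [hz0]; group
  have H1 := hF.hex hx hy hz h
  -- Equivariance under conjugation turns the factors at `y z y⁻¹ = x⁻¹ z x` into conjugates of `(F
  -- y z)⁻¹` and `(F z x)⁻¹`.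
  have H2 := hF.hex hy hx (P.conj_mem hz y) (by rw [hz0]; group)
  have e1 : F (y * z * y⁻¹) y = y * (F y z)⁻¹ * y⁻¹ := by
    rw [← hF.dual_eq hy hz, hF.conj hz hy, mul_inv_cancel_right y y]
  have e2 : F x (y * z * y⁻¹) = x⁻¹ * (F z x)⁻¹ * x := by
    rw [hz1, ← hF.dual_eq hz hx, hF.conj_inv hx hz, inv_mul_cancel, one_mul]
  rw [e1, e2, ← P.conj hz, hF.dual_eq hx hy] at H2
  rw [P.pow_lam hx, P.pow_lam hy, P.pow_lam hz]
  set p := F x y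
  set q := F y z
  set r := F z x
  set a := P.pow x ((lam - 1) / 2)
  set b := P.pow y ((lam - 1) / 2)
  set c := P.pow z ((lam - 1) / 2)
  have E1 : p * a = b⁻¹ * q⁻¹ * c⁻¹ * r⁻¹ := by
    calc p * a = b⁻¹ * q⁻¹ * c⁻¹ * r⁻¹ * (r * c * q * b * p * a) := by group
      _ = _ := by rw [H1, mul_one]
  have E2 : x * a * p⁻¹ * b = r * z⁻¹ * c⁻¹ * q * y⁻¹ := by
    calc x * a * p⁻¹ * b = r * x * y * c⁻¹ * q * y⁻¹ * (y * q⁻¹ * y⁻¹ * (y * c * y⁻¹) *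
          (x⁻¹ * r⁻¹ * x) * a * p⁻¹ * b) := by group
      _ = _ := by rw [H2, mul_one, hz0]; group
  calc p * (a * x * a) * p⁻¹ * (b * y * b) * ((q * b)⁻¹ * (c * z * c) * (q * b))
      = (p * a) * (x * a * p⁻¹ * b) * y * q⁻¹ * c * z * c * q * b := by group
    _ = 1 := by rw [E1, E2]; group

end IsGTPair

/-- The operation belonging to the product in the Grothendieck–Teichmüller group. -/
def comp (P : UnipotentPower K G) (lam : K) (F₁ F₂ : G → G → G) (u v : G) : G :=
  F₁ (F₂ u v * P.pow u lam * (F₂ u v)⁻¹) (P.pow v lam) * F₂ u v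

section Comp

variable {lam₁ lam₂ : K} {F₁ F₂ : G → G → G} (h₁ : P.IsGTPair lam₁ F₁) (h₂ : P.IsGTPair lam₂ F₂)

include h₁ h₂

/-- Conjugating by `F₂ u v` carries the arguments of the second factor to those of the first in
reversed order, where duality of `F₁` applies. -/
theorem comp_dual {u v : G} (hu : u ∈ P.U) (hv : v ∈ P.U) :
    P.comp lam₂ F₁ F₂ u v * P.comp lam₂ F₁ F₂ v u = 1 := by
  have hu' := P.pow_mem hu lam₂
  have hv' := P.pow_mem hv lam₂
  rw [comp, comp, h₂.dual_eq hu hv, inv_inv]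
  have e : F₂ u v * F₁ ((F₂ u v)⁻¹ * P.pow v lam₂ * F₂ u v) (P.pow u lam₂) * (F₂ u v)⁻¹ =
      F₁ (P.pow v lam₂) (F₂ u v * P.pow u lam₂ * (F₂ u v)⁻¹) := by
    rw [h₁.conj _ hu']
    · congr 1; group
    · have := P.conj_mem hv' (F₂ u v)⁻¹
      rwa [inv_inv] at this
  have d := h₁.dual (P.conj_mem hu' (F₂ u v)) hv'
  rw [← e] at d
  rw [← d]
  group

/-- The hexagon of `F₁` is applied to the triple `A`, `B`, `C` supplied by `triple_relation` for
`F₂`. -/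
theorem comp_hex [CharZero K] {x y z : G} (hx : x ∈ P.U) (hy : y ∈ P.U) (hz : z ∈ P.U)
    (h : x * y * z = 1) :
    P.comp lam₂ F₁ F₂ z x * P.pow z ((lam₁ * lam₂ - 1) / 2) * P.comp lam₂ F₁ F₂ y z *
      P.pow y ((lam₁ * lam₂ - 1) / 2) * P.comp lam₂ F₁ F₂ x y *
      P.pow x ((lam₁ * lam₂ - 1) / 2) = 1 := by
  -- The exponent of the composite is `λ₂ (λ₁ - 1) / 2 + (λ₂ - 1) / 2`; both orders of the two
  -- commuting powers are needed below.
  have hm : ∀ {u}, u ∈ P.U → P.pow u ((lam₁ * lam₂ - 1) / 2) =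
      P.pow (P.pow u lam₂) ((lam₁ - 1) / 2) * P.pow u ((lam₂ - 1) / 2) := by
    intro u hu
    rw [P.pow_pow hu, ← P.pow_add hu]
    congr 1
    ring
  have hm' : ∀ {u}, u ∈ P.U → P.pow u ((lam₁ * lam₂ - 1) / 2) =
      P.pow u ((lam₂ - 1) / 2) * P.pow (P.pow u lam₂) ((lam₁ - 1) / 2) := by
    intro u hu
    rw [P.pow_pow hu, ← P.pow_add hu]
    congr 1
    ring
  have hX := P.pow_mem hx lam₂
  have hY := P.pow_mem hy lam₂
  have hZ := P.pow_mem hz lam₂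
  set g1 := F₂ x y * P.pow x ((lam₂ - 1) / 2) with hg1
  set g2 := F₂ y z * P.pow y ((lam₂ - 1) / 2) with hg2
  set g3 := F₂ z x * P.pow z ((lam₂ - 1) / 2) with hg3
  -- The hexagon of `F₂` says that the three conjugating elements multiply to `1`.
  have hg : g3 * g2 * g1 = 1 := by
    rw [hg1, hg2, hg3]
    simpa only [mul_assoc] using h₂.hex hx hy hz h
  set A := F₂ x y * P.pow x lam₂ * (F₂ x y)⁻¹ with hA
  set B := P.pow y lam₂ with hB
  set C := g2⁻¹ * P.pow z lam₂ * g2 with hC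
  have hAm : A ∈ P.U := P.conj_mem hX _
  have hCm : C ∈ P.U := by
    have := P.conj_mem hZ g2⁻¹
    rwa [inv_inv] at this
  have habc : A * B * C = 1 := h₂.triple_relation hx hy hz h
  have hexABC := h₁.hex hAm hY hCm habc
  -- each of the three factors is a conjugate of a factor for `A`, `B`, `C`
  have k1 : P.comp lam₂ F₁ F₂ x y * P.pow x ((lam₁ * lam₂ - 1) / 2) =
      F₁ A B * P.pow A ((lam₁ - 1) / 2) * g1 := by
    rw [comp, hm hx, hA, ← P.conj hX, hg1, ← hB]
    group
  have hcomm : ∀ {u}, u ∈ P.U → ∀ s t, Commute (P.pow u s) (P.pow u t) := fun hu s t =>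
    P.commute_pow hu (P.commute_pow hu (Commute.refl _) s).symm t
  have cgen : ∀ {u v}, u ∈ P.U → v ∈ P.U → F₂ u v * P.pow u lam₂ * (F₂ u v)⁻¹ =
      F₂ u v * P.pow u ((lam₂ - 1) / 2) * P.pow u lam₂ *
        (F₂ u v * P.pow u ((lam₂ - 1) / 2))⁻¹ := by
    intro u v hu hv
    have := (hcomm hu ((lam₂ - 1) / 2) lam₂).eq
    rw [mul_inv_rev, mul_assoc (F₂ u v) (P.pow u ((lam₂ - 1) / 2)), this]
    group
  have k2 : P.comp lam₂ F₁ F₂ y z * P.pow y ((lam₁ * lam₂ - 1) / 2) =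
      g2 * F₁ B C * P.pow B ((lam₁ - 1) / 2) := by
    have e : g2 * F₁ B C * g2⁻¹ = F₁ (g2 * B * g2⁻¹) (P.pow z lam₂) := by
      rw [h₁.conj hY hCm, hC]
      congr 1
      group
    rw [comp, hm' hy, cgen hy hz, ← hg2, ← hB, ← e, hg2]
    group
  have k3 : P.comp lam₂ F₁ F₂ z x * P.pow z ((lam₁ * lam₂ - 1) / 2) =
      g3 * g2 * F₁ C A * P.pow C ((lam₁ - 1) / 2) * g2⁻¹ := by
    have e1 : g2 * A * g2⁻¹ = g3⁻¹ * P.pow x lam₂ * g3 := by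
      have : g3⁻¹ = g2 * g1 := (eq_inv_of_mul_eq_one_right (by rwa [← mul_assoc])).symm
      rw [← inv_inv g3, this, hA, cgen hx hy, ← hg1]
      group
    have e2 : g3 * g2 * F₁ C A * (g3 * g2)⁻¹ =
        F₁ (g3 * P.pow z lam₂ * g3⁻¹) (P.pow x lam₂) := by
      have : g3 * g2 * F₁ C A * (g3 * g2)⁻¹ = g3 * (g2 * F₁ C A * g2⁻¹) * g3⁻¹ := by group
      rw [this, h₁.conj hCm hAm, e1, h₁.conj]
      · rw [hC]; congr 1 <;> group
      · exact P.conj_mem hCm g2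
      · rw [← e1]; exact P.conj_mem hAm g2
    have e3 : P.pow C ((lam₁ - 1) / 2) =
        g2⁻¹ * P.pow (P.pow z lam₂) ((lam₁ - 1) / 2) * g2 := by
      have := P.conj hZ ((lam₁ - 1) / 2) g2⁻¹
      rw [inv_inv] at this
      rw [this]
    rw [comp, hm' hz, cgen hz hx, ← hg3, ← e2, e3, hg3]
    group
  calc P.comp lam₂ F₁ F₂ z x * P.pow z ((lam₁ * lam₂ - 1) / 2) * P.comp lam₂ F₁ F₂ y z *
      P.pow y ((lam₁ * lam₂ - 1) / 2) * P.comp lam₂ F₁ F₂ x y *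
      P.pow x ((lam₁ * lam₂ - 1) / 2)
      = (P.comp lam₂ F₁ F₂ z x * P.pow z ((lam₁ * lam₂ - 1) / 2)) *
        (P.comp lam₂ F₁ F₂ y z * P.pow y ((lam₁ * lam₂ - 1) / 2)) *
        (P.comp lam₂ F₁ F₂ x y * P.pow x ((lam₁ * lam₂ - 1) / 2)) := by
          simp only [mul_assoc]
    _ = g3 * g2 * (F₁ C A * P.pow C ((lam₁ - 1) / 2) * F₁ B C * P.pow B ((lam₁ - 1) / 2) *
        F₁ A B * P.pow A ((lam₁ - 1) / 2)) * g1 := by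
          rw [k1, k2, k3]; group
    _ = 1 := by rw [hexABC, mul_one, hg]

end Comp

end UnipotentPower

end

noncomputable section

namespace UnipotentPower

variable {K G : Type*} [Field K] [Group G] {P : UnipotentPower K G}
  {lam : K} {F : G → G → G}

/-! Images of a pair of braid generators. -/

section Braid

variable (P) in
/-- The power `σ ^ lam = σ (σ²) ^ ((lam - 1) / 2)`. -/
def halfPow (lam : K) (s : G) : G := s * P.pow (s * s) ((lam - 1) / 2)

theorem commute_halfPow {s g : G} (hs : s * s ∈ P.U) (h : Commute g s) :
    Commute g (P.halfPow lam s) :=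
  h.mul_right (P.commute_pow hs (h.mul_right h) _)

theorem halfPow_mul_self [CharZero K] {s : G} (hs : s * s ∈ P.U) :
    P.halfPow lam s * P.halfPow lam s = P.pow (s * s) lam := by
  have h : Commute s (P.pow (s * s) ((lam - 1) / 2)) :=
    P.commute_pow hs ((Commute.refl s).mul_right (Commute.refl s)) _
  rw [P.pow_lam hs, halfPow]
  have := h.eq
  calc s * P.pow (s * s) ((lam - 1) / 2) * (s * P.pow (s * s) ((lam - 1) / 2))
      = (s * P.pow (s * s) ((lam - 1) / 2)) * s * P.pow (s * s) ((lam - 1) / 2) := by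
        simp only [mul_assoc]
    _ = _ := by rw [this]; simp only [mul_assoc]

theorem conj_halfPow {s : G} (hs : s * s ∈ P.U) (g : G) :
    g * P.halfPow lam s * g⁻¹ = P.halfPow lam (g * s * g⁻¹) := by
  have e : g * s * g⁻¹ * (g * s * g⁻¹) = g * (s * s) * g⁻¹ := by group
  rw [halfPow, halfPow, e, ← P.conj hs]
  group

variable (hF : P.IsGTPair lam F) {s t : G} (hst : s * t * s = t * s * t) (hs : s * s ∈ P.U)
  (ht : t * t ∈ P.U)

include hst

theorem braid_mul_left : s * t * s * s = t * (s * t * s) :=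
  calc s * t * s * s = t * s * t * s := by rw [hst]
    _ = t * (s * t * s) := by simp only [mul_assoc]

theorem braid_mul_right : s * t * s * t = s * (s * t * s) :=
  calc s * t * s * t = s * (t * s * t) := by simp only [mul_assoc]
    _ = s * (s * t * s) := by rw [← hst]

/-- The half twist `s t s` exchanges the two generators under conjugation. -/
theorem braid_conj_left : s * t * s * s * (s * t * s)⁻¹ = t := by
  rw [braid_mul_left hst]; group

theorem braid_conj_right : s * t * s * t * (s * t * s)⁻¹ = s := by
  rw [braid_mul_right hst]; group

theorem braid_inv_conj_left : (s * t * s)⁻¹ * s * (s * t * s) = t := by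
  rw [mul_assoc, ← braid_mul_right hst]; group

theorem braid_inv_conj_right : (s * t * s)⁻¹ * t * (s * t * s) = s := by
  rw [mul_assoc, ← braid_mul_left hst]; group

/-- Exchanging the generators twice does nothing, so the full twist is central in the subgroup they
generate. -/
theorem commute_square_left : Commute s (s * t * s * (s * t * s)) := by
  have h1 := braid_conj_left hst
  have h2 := braid_conj_right hst
  set δ := s * t * s
  have : δ * δ * s * (δ * δ)⁻¹ = s := by
    calc δ * δ * s * (δ * δ)⁻¹ = δ * (δ * s * δ⁻¹) * δ⁻¹ := by group
      _ = s := by rw [h1, h2]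
  exact (mul_inv_eq_iff_eq_mul.1 this).symm

theorem commute_square_right : Commute t (s * t * s * (s * t * s)) := by
  have h1 := braid_conj_left hst
  have h2 := braid_conj_right hst
  set δ := s * t * s
  have : δ * δ * t * (δ * δ)⁻¹ = t := by
    calc δ * δ * t * (δ * δ)⁻¹ = δ * (δ * t * δ⁻¹) * δ⁻¹ := by group
      _ = t := by rw [h2, h1]
  exact (mul_inv_eq_iff_eq_mul.1 this).symm

/-- A factorisation of the full twist into unipotent elements. It shows that powers of the full
twist make sense and provides the triple for the hexagon relation. -/
theorem square_eq : s * t * s * (s * t * s) = s * s * (t * (s * s) * t⁻¹) * (t * t) := by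
  calc s * t * s * (s * t * s) = s * (t * s * s * t * s) := by simp only [mul_assoc]
    _ = s * (t * s * (s * t * s)) := by simp only [mul_assoc]
    _ = s * (t * s * t) * s * t := by rw [hst]; simp only [mul_assoc]
    _ = _ := by rw [← hst]; group

include hs ht

theorem square_mem : s * t * s * (s * t * s) ∈ P.U := by
  rw [square_eq hst]
  exact mul_mem (mul_mem hs (P.conj_mem hs t)) ht

include hF

/-- The hexagon relation for a pair of braid generators. -/
theorem braid_hexagon :
    F (s * s) (t * t) * P.halfPow lam s * (F (s * s) (t * t))⁻¹ *
      (F (s * s) (t * t) * (s * t * s)⁻¹) *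
      (F (s * s) (t * t) * P.halfPow lam s * (F (s * s) (t * t))⁻¹) * P.halfPow lam t =
      P.pow (s * t * s * (s * t * s)) ((lam - 1) / 2) := by
  have hω := square_mem hst hs ht
  have hωs := commute_square_left hst
  have hωt := commute_square_right hst
  have hsq := square_eq hst
  have hδs := braid_mul_left hst
  set δ := s * t * s with hδ
  set ω := δ * δ with hω'
  set X := s * s with hX
  set Y := t * t with hY
  set W := t * X * t⁻¹ with hW
  set e := F X Y with he
  set m := (lam - 1) / 2 with hm
  have hWm : W ∈ P.U := P.conj_mem hs t
  have hωi : ω⁻¹ ∈ P.U := inv_mem hω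
  have cs : Commute s ω⁻¹ := hωs.inv_right
  have ct : Commute t ω⁻¹ := hωt.inv_right
  have cX : Commute X ω⁻¹ := cs.mul_left cs
  have cY : Commute Y ω⁻¹ := ct.mul_left ct
  have cW : Commute W ω⁻¹ := (ct.mul_left cX).mul_left ct.inv_left
  -- Dividing the third factor by the central `ω` makes the product trivial, so the hexagon applies
  -- to this triple.
  have hYXW : Y * X * (W * ω⁻¹) = 1 := by
    have : Y * X * W = Y * (X * W * Y) * Y⁻¹ := by group
    have hc : Y * ω = ω * Y := (hωt.mul_left hωt).eq
    rw [← mul_assoc, this, ← hsq, hc]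
    group
  have H := hF.hex ht hs (mul_mem hWm hωi) hYXW
  have hWs : W = s⁻¹ * Y * s := by
    have h3 : s * W * s⁻¹ = Y :=
      calc s * W * s⁻¹ = s * t * s * s * t⁻¹ * s⁻¹ := by rw [hW, hX]; group
        _ = t * (t * s * t) * t⁻¹ * s⁻¹ := by rw [← hδ, hδs, hst]
        _ = Y := by rw [hY]; group
    rw [← h3]; group
  -- Multiplicativity in commuting pairs splits off the central part `F ω⁻¹ 1`; what is left is a
  -- conjugate of `F X Y`.
  have f1 : F (W * ω⁻¹) Y = t * e * t⁻¹ * F ω⁻¹ 1 := by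
    have h1 := hF.mul hWm ht hωi P.U.one_mem cW (Commute.one_right W) cY (Commute.one_right Y)
    rw [mul_one] at h1
    rw [h1, he, hF.conj hs ht, ← hW]
    congr 2
    rw [hY]; group
  have f2 : F X (W * ω⁻¹) = s⁻¹ * e * s * (F ω⁻¹ 1)⁻¹ := by
    have h1 := hF.mul hs hWm P.U.one_mem hωi (Commute.one_right X) cX (Commute.one_right W) cW
    rw [mul_one] at h1
    rw [h1, hF.dual_eq hωi P.U.one_mem, he, hF.conj_inv hs ht, ← hWs]
    congr 2
    rw [hX]; group
  have f3 : P.pow (W * ω⁻¹) m = t * P.pow X m * t⁻¹ * (P.pow ω m)⁻¹ := by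
    rw [P.mul_pow hWm hωi cW, P.inv_pow hω, P.conj hs]
  rw [f1, f2, f3, hF.dual_eq hs ht, ← he] at H
  set κ := F ω⁻¹ 1 with hκ
  set o := P.pow ω m with ho
  set a := P.pow X m with ha
  set b := P.pow Y m with hb
  have κs : Commute s κ := hF.commute hωi P.U.one_mem cs (Commute.one_right s)
  have κt : Commute t κ := hF.commute hωi P.U.one_mem ct (Commute.one_right t)
  have os : Commute s o := P.commute_pow hω hωs m
  have ot : Commute t o := P.commute_pow hω hωt m
  have κa : Commute κ a := P.commute_pow hs (κs.symm.mul_right κs.symm) m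
  have κe : Commute κ e := hF.commute hs ht (κs.symm.mul_right κs.symm) (κt.symm.mul_right κt.symm)
  have κω : Commute κ ω := by
    rw [hω', hδ]
    have := (κs.symm.mul_right κt.symm).mul_right κs.symm
    exact this.mul_right this
  have κo : Commute κ o := P.commute_pow hω κω m
  have sa : Commute s a := P.commute_pow hs ((Commute.refl s).mul_right (Commute.refl s)) m
  have tb : Commute t b := P.commute_pow ht ((Commute.refl t).mul_right (Commute.refl t)) m
  have oe : Commute o e := hF.commute hs ht (os.symm.mul_right os.symm) (ot.symm.mul_right ot.symm)
  have oa : Commute o a := P.commute_pow hs (os.symm.mul_right os.symm) m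
  -- the central factors cancel
  have cκ : Commute κ (t * a * t⁻¹ * o⁻¹ * (s⁻¹ * e * s)) :=
    (((κt.symm.mul_right κa).mul_right κt.symm.inv_right).mul_right κo.inv_right).mul_right
      ((κs.symm.inv_right.mul_right κe).mul_right κs.symm)
  have H2 : t * e * t⁻¹ * (t * a * t⁻¹ * o⁻¹ * (s⁻¹ * e * s)) * a * e⁻¹ * b = 1 := by
    rw [← H]
    have : t * e * t⁻¹ * κ * (t * a * t⁻¹ * o⁻¹) * (s⁻¹ * e * s * κ⁻¹) * a * e⁻¹ * b =
      t * e * t⁻¹ * (κ * (t * a * t⁻¹ * o⁻¹ * (s⁻¹ * e * s))) * κ⁻¹ * a * e⁻¹ * b := by group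
    rw [this, cκ.eq]
    group
  have ho2 : Commute o⁻¹ (s⁻¹ * e * s * a * e⁻¹ * b * t) := by
    have ob : Commute o b := P.commute_pow ht (ot.symm.mul_right ot.symm) m
    exact (((((os.symm.inv_right.mul_right oe).mul_right os.symm).mul_right oa).mul_right
      oe.inv_right).mul_right ob |>.mul_right ot.symm).inv_left
  have H3 : e * a * t⁻¹ * (s⁻¹ * e * s * a * e⁻¹ * b * t) * o⁻¹ = 1 := by
    rw [mul_assoc _ _ o⁻¹, ← ho2.eq]
    calc e * a * t⁻¹ * (o⁻¹ * (s⁻¹ * e * s * a * e⁻¹ * b * t)) =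
        t⁻¹ * (t * e * t⁻¹ * (t * a * t⁻¹ * o⁻¹ * (s⁻¹ * e * s)) * a * e⁻¹ * b) * t := by group
      _ = 1 := by rw [H2]; group
  rw [mul_inv_eq_one] at H3
  rw [← H3, halfPow, halfPow, ← ha, ← hb]
  calc e * (s * a) * e⁻¹ * (e * δ⁻¹) * (e * (s * a) * e⁻¹) * (t * b)
      = e * (a * s) * δ⁻¹ * (e * s * a * e⁻¹) * (b * t) := by
        rw [← sa.eq, ← tb.eq]; group
    _ = _ := by rw [hδ]; group

variable [CharZero K]

/-- With `S`, `T` the images of the generators, conjugation by `τ = F(s², t²) (s t s)⁻¹` exchanges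
`S` and `T`, just as the inverse half twist exchanges `s` and `t`. By the hexagon, `S T S` and `T S
T` both equal `τ⁻¹` times the power `(λ - 1) / 2` of the full twist, and their squares are its
`λ`-th power. The other two formulas follow because `s t² s` is the full twist divided by `t²`. -/
theorem braid_images :
    (F (s * s) (t * t) * P.halfPow lam s * (F (s * s) (t * t))⁻¹ * P.halfPow lam t *
      (F (s * s) (t * t) * P.halfPow lam s * (F (s * s) (t * t))⁻¹) =
      P.halfPow lam t * (F (s * s) (t * t) * P.halfPow lam s * (F (s * s) (t * t))⁻¹) *
        P.halfPow lam t) ∧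
    F (s * s) (t * t) * P.halfPow lam s * (F (s * s) (t * t))⁻¹ *
        (P.halfPow lam t * P.halfPow lam t) *
        (F (s * s) (t * t) * P.halfPow lam s * (F (s * s) (t * t))⁻¹) =
      P.pow (s * (t * t) * s) lam ∧
    P.halfPow lam t * (F (s * s) (t * t) * P.halfPow lam s * (F (s * s) (t * t))⁻¹ *
        (F (s * s) (t * t) * P.halfPow lam s * (F (s * s) (t * t))⁻¹)) * P.halfPow lam t =
      F (s * s) (t * t) * P.pow (t * (s * s) * t) lam * (F (s * s) (t * t))⁻¹ := by
  have H := braid_hexagon hF hst hs ht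
  have hω := square_mem hst hs ht
  have hωs := commute_square_left hst
  have hωt := commute_square_right hst
  have i1 := braid_inv_conj_left hst
  have i2 := braid_inv_conj_right hst
  have hmulS := halfPow_mul_self (lam := lam) hs
  have hmulT := halfPow_mul_self (lam := lam) ht
  have hconj1 := conj_halfPow (lam := lam) hs (s * t * s)⁻¹
  have hconj2 := conj_halfPow (lam := lam) ht (s * t * s)⁻¹
  rw [inv_inv, i1] at hconj1
  rw [inv_inv, i2] at hconj2
  have hdual := hF.dual_eq hs ht
  have hconje := hF.conj_inv hs ht (s * t * s)
  have j1 : (s * t * s)⁻¹ * (s * s) * (s * t * s) = t * t :=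
    calc (s * t * s)⁻¹ * (s * s) * (s * t * s) =
          (s * t * s)⁻¹ * s * (s * t * s) * ((s * t * s)⁻¹ * s * (s * t * s)) := by group
      _ = t * t := by rw [i1]
  have j2 : (s * t * s)⁻¹ * (t * t) * (s * t * s) = s * s :=
    calc (s * t * s)⁻¹ * (t * t) * (s * t * s) =
          (s * t * s)⁻¹ * t * (s * t * s) * ((s * t * s)⁻¹ * t * (s * t * s)) := by group
      _ = s * s := by rw [i2]
  rw [j1, j2, hdual] at hconje
  have hωY : s * (t * t) * s = s * t * s * (s * t * s) * (t * t)⁻¹ := by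
    have h1 : s * t * s * (s * t * s) * (t * t)⁻¹ = t⁻¹ * (s * t * s * (s * t * s)) * t⁻¹ := by
      have := (hωt.inv_left).eq
      rw [this]; group
    rw [h1]
    calc s * (t * t) * s = t⁻¹ * (t * s * t * (t * s * t)) * t⁻¹ := by group
      _ = _ := by rw [← hst]
  have hωX : t * (s * s) * t = s * t * s * (s * t * s) * (s * s)⁻¹ := by
    have h1 : s * t * s * (s * t * s) * (s * s)⁻¹ = s⁻¹ * (s * t * s * (s * t * s)) * s⁻¹ := by
      have := (hωs.inv_left).eq
      rw [this]; group
    rw [h1]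
    group
  have hpY : P.pow (s * (t * t) * s) lam =
      P.pow (s * t * s * (s * t * s)) lam * (P.pow (t * t) lam)⁻¹ := by
    rw [hωY, P.mul_pow hω (inv_mem ht) (hωt.mul_left hωt).symm.inv_right, P.inv_pow ht]
  have hpX : P.pow (t * (s * s) * t) lam =
      P.pow (s * t * s * (s * t * s)) lam * (P.pow (s * s) lam)⁻¹ := by
    rw [hωX, P.mul_pow hω (inv_mem hs) (hωs.mul_left hωs).symm.inv_right, P.inv_pow hs]
  have hplam := P.pow_lam hω lam
  have hos : Commute s (P.pow (s * t * s * (s * t * s)) ((lam - 1) / 2)) := P.commute_pow hω hωs _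
  have hot : Commute t (P.pow (s * t * s * (s * t * s)) ((lam - 1) / 2)) := P.commute_pow hω hωt _
  have hls : Commute s (P.pow (s * t * s * (s * t * s)) lam) := P.commute_pow hω hωs _
  have hlt : Commute t (P.pow (s * t * s * (s * t * s)) lam) := P.commute_pow hω hωt _
  have cT : ∀ {g}, Commute s g → Commute t g → Commute g (P.halfPow lam t) := fun _ h2 =>
    commute_halfPow ht h2.symm
  have cS : ∀ {g}, Commute s g → Commute t g → Commute g (P.halfPow lam s) := fun h1 _ =>
    commute_halfPow hs h1.symm
  have ce : ∀ {g}, Commute s g → Commute t g → Commute g (F (s * s) (t * t)) := fun h1 h2 =>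
    hF.commute hs ht (h1.symm.mul_right h1.symm) (h2.symm.mul_right h2.symm)
  rw [hpY, hpX, ← hmulS, ← hmulT]
  have oδ : Commute (s * t * s) (P.pow (s * t * s * (s * t * s)) ((lam - 1) / 2)) :=
    (hos.mul_left hot).mul_left hos
  have ocT := cT hos hot
  have oce := ce hos hot
  have lcT := cT hls hlt
  have lcS := cS hls hlt
  have lce := ce hls hlt
  set δ := s * t * s
  set o := P.pow (δ * δ) ((lam - 1) / 2)
  set ω' := P.pow (δ * δ) lam
  set e := F (s * s) (t * t)
  set σ := P.halfPow lam s
  set T := P.halfPow lam t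
  set S := e * σ * e⁻¹ with hS
  set τ := e * δ⁻¹ with hτ
  have oτ : Commute o τ := oce.mul_right oδ.symm.inv_right
  have t1 : τ * S * τ⁻¹ = T := by
    calc τ * S * τ⁻¹ = e * (δ⁻¹ * e * δ) * (δ⁻¹ * σ * δ) * (δ⁻¹ * e * δ)⁻¹ * e⁻¹ := by
          rw [hτ, hS]; group
      _ = T := by rw [hconje, hconj1]; group
  have t2 : τ * T * τ⁻¹ = S := by
    calc τ * T * τ⁻¹ = e * (δ⁻¹ * T * δ) * e⁻¹ := by rw [hτ]; group
      _ = S := by rw [hconj2]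
  have t3 : τ⁻¹ * τ⁻¹ = δ * δ := by
    calc τ⁻¹ * τ⁻¹ = δ * δ * (δ⁻¹ * e * δ)⁻¹ * e⁻¹ := by rw [hτ]; group
      _ = δ * δ := by rw [hconje]; group
  have sts : S * T * S = o * τ⁻¹ := by
    have : S * τ * S * T = S * (τ * S * τ⁻¹) * (τ * T * τ⁻¹) * τ := by group
    rw [this, t1, t2] at H
    rw [← H]; group
  have tst : T * S * T = o * τ⁻¹ := by
    have : T * S * T = τ * (S * T * S) * τ⁻¹ := by
      calc T * S * T = (τ * S * τ⁻¹) * (τ * T * τ⁻¹) * (τ * S * τ⁻¹) := by rw [t1, t2]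
        _ = _ := by group
    rw [this, sts, ← mul_assoc, ← oτ.eq]; group
  have sq : S * T * S * (S * T * S) = ω' := by
    rw [sts, hplam]
    have h1 : o * τ⁻¹ * (o * τ⁻¹) = o * (τ⁻¹ * o) * τ⁻¹ := by group
    rw [h1, ← oτ.inv_right.eq]
    have h2 : o * (o * τ⁻¹) * τ⁻¹ = o * (o * (τ⁻¹ * τ⁻¹)) := by group
    rw [h2, t3, mul_assoc o (δ * δ) o, ← (oδ.mul_left oδ).symm.eq]
  refine ⟨sts.trans tst.symm, ?_, ?_⟩
  · have h1 : S * (T * T) * S = T⁻¹ * ((T * S * T) * (T * S * T)) * T⁻¹ := by group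
    rw [h1, tst, ← sts, sq, lcT.inv_right.symm.eq]
    group
  · have h1 : T * (S * S) * T = S⁻¹ * ((S * T * S) * (S * T * S)) * S⁻¹ := by group
    have lS : Commute ω' S := (lce.mul_right lcS).mul_right lce.inv_right
    rw [h1, sq, lS.inv_right.symm.eq]
    calc ω' * S⁻¹ * S⁻¹ = ω' * e * (σ * σ)⁻¹ * e⁻¹ := by rw [hS]; group
      _ = _ := by rw [lce.eq]; group

end Braid

end UnipotentPower

end

/-! ### Three braid generators: the twisted generators and the pentagon relation. -/

noncomputable section

namespace UnipotentPower

variable {K G : Type*} [Field K] [Group G] {P : UnipotentPower K G}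
  {lam : K} {F : G → G → G}

theorem sandwich_mem {s t : G} (hs : s * s ∈ P.U) (ht : t * t ∈ P.U) :
    s * (t * t) * s ∈ P.U := by
  have : s * (t * t) * s = s * (t * t) * s⁻¹ * (s * s) := by group
  rw [this]
  exact mul_mem (P.conj_mem ht s) hs

/-- The element `s t² s` is the full twist divided by `t²`, hence centralised by `t`. All
commutations between strands in the pentagon come from this and from `s₁ s₃ = s₃ s₁`. -/
theorem commute_sandwich {s t : G} (hst : s * t * s = t * s * t) :
    Commute t (s * (t * t) * s) := by
  change t * (s * (t * t) * s) = s * (t * t) * s * t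
  calc t * (s * (t * t) * s) = (t * s * t) * t * s := by simp only [mul_assoc]
    _ = s * t * (s * t * s) := by rw [← hst]; simp only [mul_assoc]
    _ = s * (t * t) * s * t := by rw [hst]; simp only [mul_assoc]

/-- The pentagon relation for the squares of three braid generators. -/
def Pentagon (F : G → G → G) (s₁ s₂ s₃ : G) : Prop :=
  F (s₁ * s₁) (s₂ * (s₃ * s₃) * s₂) * F (s₂ * (s₁ * s₁) * s₂) (s₃ * s₃) =
    F (s₂ * s₂) (s₃ * s₃) * F (s₁ * (s₂ * s₂) * s₁) (s₃ * (s₂ * s₂) * s₃) * F (s₁ * s₁) (s₂ * s₂)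

/-- Three elements satisfying Artin's relations whose squares are unipotent. -/
structure IsBraidTriple (P : UnipotentPower K G) (s₁ s₂ s₃ : G) : Prop where
  braid₁₂ : s₁ * s₂ * s₁ = s₂ * s₁ * s₂
  braid₂₃ : s₂ * s₃ * s₂ = s₃ * s₂ * s₃
  comm : Commute s₁ s₃
  mem₁ : s₁ * s₁ ∈ P.U
  mem₂ : s₂ * s₂ ∈ P.U
  mem₃ : s₃ * s₃ ∈ P.U

section Image

variable (P) in
/-- The image of `σ₁`. -/
def image₁ (lam : K) (F : G → G → G) (s₁ s₂ s₃ : G) : G :=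
  F (s₁ * s₁) (s₂ * (s₃ * s₃) * s₂) * P.halfPow lam s₁ * (F (s₁ * s₁) (s₂ * (s₃ * s₃) * s₂))⁻¹

variable (P) in
/-- The image of `σ₂`. -/
def image₂ (lam : K) (F : G → G → G) (s₂ s₃ : G) : G :=
  F (s₂ * s₂) (s₃ * s₃) * P.halfPow lam s₂ * (F (s₂ * s₂) (s₃ * s₃))⁻¹

variable {s₁ s₂ s₃ : G} (hs : P.IsBraidTriple s₁ s₂ s₃) (hF : P.IsGTPair lam F)
  (hp : Pentagon F s₁ s₂ s₃)

include hs hF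

theorem commute_pentagon_arg₁ : Commute s₃ (F (s₁ * s₁) (s₂ * (s₃ * s₃) * s₂)) :=
  hF.commute hs.mem₁ (sandwich_mem hs.mem₂ hs.mem₃)
    (hs.comm.symm.mul_right hs.comm.symm) (commute_sandwich hs.braid₂₃)

theorem commute_pentagon_arg₂ : Commute s₁ (F (s₂ * (s₁ * s₁) * s₂) (s₃ * s₃)) :=
  hF.commute (sandwich_mem hs.mem₂ hs.mem₁) hs.mem₃
    (commute_sandwich hs.braid₁₂.symm) (hs.comm.mul_right hs.comm)

theorem commute_pentagon_arg₃ :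
    Commute s₂ (F (s₁ * (s₂ * s₂) * s₁) (s₃ * (s₂ * s₂) * s₃)) :=
  hF.commute (sandwich_mem hs.mem₁ hs.mem₂) (sandwich_mem hs.mem₃ hs.mem₂)
    (commute_sandwich hs.braid₁₂) (commute_sandwich hs.braid₂₃.symm)

/-- The middle pentagon factor commutes with `s₂` and may be inserted into the conjugator. This
prepares the simultaneous conjugation with the image of `s₁`. -/
theorem image₂_eq : P.image₂ lam F s₂ s₃ =
    F (s₂ * s₂) (s₃ * s₃) * F (s₁ * (s₂ * s₂) * s₁) (s₃ * (s₂ * s₂) * s₃) * P.halfPow lam s₂ *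
      (F (s₂ * s₂) (s₃ * s₃) * F (s₁ * (s₂ * s₂) * s₁) (s₃ * (s₂ * s₂) * s₃))⁻¹ := by
  have h := commute_halfPow (lam := lam) hs.mem₂ (commute_pentagon_arg₃ hs hF).symm
  rw [image₂, mul_assoc (F _ _) (F _ _) (P.halfPow _ _), h.eq]
  group

include hp

/-- The second factor on the left of the pentagon commutes with `s₁`, so the conjugator may be
replaced by the full left side, and then by the right side. Hence the images of `s₁` and `s₂` are a
common conjugate of the images attached to the pair `s₁`, `s₂` alone, and `braid_images` applies to
them. -/
theorem image₁_eq : P.image₁ lam F s₁ s₂ s₃ =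
    F (s₂ * s₂) (s₃ * s₃) * F (s₁ * (s₂ * s₂) * s₁) (s₃ * (s₂ * s₂) * s₃) *
      F (s₁ * s₁) (s₂ * s₂) * P.halfPow lam s₁ *
      (F (s₂ * s₂) (s₃ * s₃) * F (s₁ * (s₂ * s₂) * s₁) (s₃ * (s₂ * s₂) * s₃) *
        F (s₁ * s₁) (s₂ * s₂))⁻¹ := by
  have h := commute_halfPow (lam := lam) hs.mem₁ (commute_pentagon_arg₂ hs hF).symm
  rw [Pentagon] at hp
  rw [← hp, image₁, mul_assoc (F _ _) (F _ _) (P.halfPow _ _), h.eq]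
  group

variable [CharZero K]

omit hp in
omit [CharZero K] in
theorem image_comm : Commute (P.image₁ lam F s₁ s₂ s₃) (P.halfPow lam s₃) := by
  have h1 := commute_pentagon_arg₁ hs hF
  have h2 : Commute (P.halfPow lam s₁) s₃ :=
    (commute_halfPow hs.mem₁ hs.comm.symm).symm
  exact commute_halfPow hs.mem₃ ((h1.symm.mul_left h2).mul_left h1.symm.inv_left)

omit hp hF in
theorem image_mul_self :
    P.image₁ lam F s₁ s₂ s₃ * P.image₁ lam F s₁ s₂ s₃ =
      F (s₁ * s₁) (s₂ * (s₃ * s₃) * s₂) * P.pow (s₁ * s₁) lam *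
        (F (s₁ * s₁) (s₂ * (s₃ * s₃) * s₂))⁻¹ := by
  rw [image₁, ← halfPow_mul_self hs.mem₁]
  group

omit hp hF in
theorem image₂_mul_self :
    P.image₂ lam F s₂ s₃ * P.image₂ lam F s₂ s₃ =
      F (s₂ * s₂) (s₃ * s₃) * P.pow (s₂ * s₂) lam * (F (s₂ * s₂) (s₃ * s₃))⁻¹ := by
  rw [image₂, ← halfPow_mul_self hs.mem₂]
  group

omit hp in
theorem image_braid₂₃ :
    P.image₂ lam F s₂ s₃ * P.halfPow lam s₃ * P.image₂ lam F s₂ s₃ =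
      P.halfPow lam s₃ * P.image₂ lam F s₂ s₃ * P.halfPow lam s₃ :=
  (braid_images hF hs.braid₂₃ hs.mem₂ hs.mem₃).1

omit hp in
theorem image_sandwich₂₃ :
    P.image₂ lam F s₂ s₃ * (P.halfPow lam s₃ * P.halfPow lam s₃) * P.image₂ lam F s₂ s₃ =
      P.pow (s₂ * (s₃ * s₃) * s₂) lam :=
  (braid_images hF hs.braid₂₃ hs.mem₂ hs.mem₃).2.1

omit hp in
theorem image_sandwich₃₂ :
    P.halfPow lam s₃ * (P.image₂ lam F s₂ s₃ * P.image₂ lam F s₂ s₃) * P.halfPow lam s₃ =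
      F (s₂ * s₂) (s₃ * s₃) * P.pow (s₃ * (s₂ * s₂) * s₃) lam * (F (s₂ * s₂) (s₃ * s₃))⁻¹ :=
  (braid_images hF hs.braid₂₃ hs.mem₂ hs.mem₃).2.2

theorem image_braid₁₂ :
    P.image₁ lam F s₁ s₂ s₃ * P.image₂ lam F s₂ s₃ * P.image₁ lam F s₁ s₂ s₃ =
      P.image₂ lam F s₂ s₃ * P.image₁ lam F s₁ s₂ s₃ * P.image₂ lam F s₂ s₃ := by
  rw [image₁_eq hs hF hp, image₂_eq hs hF]
  have h := (braid_images hF hs.braid₁₂ hs.mem₁ hs.mem₂).1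
  set g := F (s₂ * s₂) (s₃ * s₃) * F (s₁ * (s₂ * s₂) * s₁) (s₃ * (s₂ * s₂) * s₃)
  set e := F (s₁ * s₁) (s₂ * s₂)
  set S := P.halfPow lam s₁
  set T := P.halfPow lam s₂
  calc g * e * S * (g * e)⁻¹ * (g * T * g⁻¹) * (g * e * S * (g * e)⁻¹)
      = g * (e * S * e⁻¹ * T * (e * S * e⁻¹)) * g⁻¹ := by group
    _ = _ := by rw [h]; group

theorem image_sandwich₁₂ :
    P.image₁ lam F s₁ s₂ s₃ * (P.image₂ lam F s₂ s₃ * P.image₂ lam F s₂ s₃) *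
        P.image₁ lam F s₁ s₂ s₃ =
      F (s₂ * s₂) (s₃ * s₃) * F (s₁ * (s₂ * s₂) * s₁) (s₃ * (s₂ * s₂) * s₃) *
        P.pow (s₁ * (s₂ * s₂) * s₁) lam *
      (F (s₂ * s₂) (s₃ * s₃) * F (s₁ * (s₂ * s₂) * s₁) (s₃ * (s₂ * s₂) * s₃))⁻¹ := by
  rw [image₁_eq hs hF hp, image₂_eq hs hF]
  have h := (braid_images hF hs.braid₁₂ hs.mem₁ hs.mem₂).2.1
  rw [← h]
  set g := F (s₂ * s₂) (s₃ * s₃) * F (s₁ * (s₂ * s₂) * s₁) (s₃ * (s₂ * s₂) * s₃)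
  set e := F (s₁ * s₁) (s₂ * s₂)
  group

theorem image_sandwich₂₁ :
    P.image₂ lam F s₂ s₃ * (P.image₁ lam F s₁ s₂ s₃ * P.image₁ lam F s₁ s₂ s₃) *
        P.image₂ lam F s₂ s₃ =
      F (s₂ * s₂) (s₃ * s₃) * F (s₁ * (s₂ * s₂) * s₁) (s₃ * (s₂ * s₂) * s₃) *
        F (s₁ * s₁) (s₂ * s₂) * P.pow (s₂ * (s₁ * s₁) * s₂) lam *
      (F (s₂ * s₂) (s₃ * s₃) * F (s₁ * (s₂ * s₂) * s₁) (s₃ * (s₂ * s₂) * s₃) *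
        F (s₁ * s₁) (s₂ * s₂))⁻¹ := by
  rw [image₁_eq hs hF hp, image₂_eq hs hF]
  have h := (braid_images hF hs.braid₁₂ hs.mem₁ hs.mem₂).2.2
  set g := F (s₂ * s₂) (s₃ * s₃) * F (s₁ * (s₂ * s₂) * s₁) (s₃ * (s₂ * s₂) * s₃)
  set e := F (s₁ * s₁) (s₂ * s₂)
  set S := P.halfPow lam s₁
  set T := P.halfPow lam s₂
  calc g * T * g⁻¹ * (g * e * S * (g * e)⁻¹ * (g * e * S * (g * e)⁻¹)) * (g * T * g⁻¹)
      = g * (T * (e * S * e⁻¹ * (e * S * e⁻¹)) * T) * g⁻¹ := by group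
    _ = _ := by rw [h]; group

/-- The pentagon relation for the composite operation. -/
theorem comp_pentagon {lam₁ : K} {F₁ : G → G → G} (h₁ : P.IsGTPair lam₁ F₁)
    (hp₁ : Pentagon F₁ (P.image₁ lam F s₁ s₂ s₃) (P.image₂ lam F s₂ s₃) (P.halfPow lam s₃)) :
    Pentagon (P.comp lam F₁ F) s₁ s₂ s₃ := by
  have m12 := P.pow_mem hs.mem₁ lam
  have m23 := P.pow_mem hs.mem₂ lam
  have m34 := P.pow_mem hs.mem₃ lam
  have m234 := P.pow_mem (sandwich_mem hs.mem₂ hs.mem₃) lam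
  have m213 := P.pow_mem (sandwich_mem hs.mem₂ hs.mem₁) lam
  have m123 := P.pow_mem (sandwich_mem hs.mem₁ hs.mem₂) lam
  have m324 := P.pow_mem (sandwich_mem hs.mem₃ hs.mem₂) lam
  have e1 := image_mul_self (lam := lam) (F := F) hs
  have e1' : P.image₁ lam F s₁ s₂ s₃ * P.image₁ lam F s₁ s₂ s₃ =
      F (s₂ * s₂) (s₃ * s₃) * F (s₁ * (s₂ * s₂) * s₁) (s₃ * (s₂ * s₂) * s₃) *
        F (s₁ * s₁) (s₂ * s₂) * P.pow (s₁ * s₁) lam *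
      (F (s₂ * s₂) (s₃ * s₃) * F (s₁ * (s₂ * s₂) * s₁) (s₃ * (s₂ * s₂) * s₃) *
        F (s₁ * s₁) (s₂ * s₂))⁻¹ := by
    rw [image₁_eq hs hF hp, ← halfPow_mul_self hs.mem₁]
    group
  have e2 := image₂_mul_self (lam := lam) (F := F) hs
  have e2' : P.image₂ lam F s₂ s₃ * P.image₂ lam F s₂ s₃ =
      F (s₂ * s₂) (s₃ * s₃) * F (s₁ * (s₂ * s₂) * s₁) (s₃ * (s₂ * s₂) * s₃) *
        P.pow (s₂ * s₂) lam *
      (F (s₂ * s₂) (s₃ * s₃) * F (s₁ * (s₂ * s₂) * s₁) (s₃ * (s₂ * s₂) * s₃))⁻¹ := by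
    rw [image₂_eq hs hF, ← halfPow_mul_self hs.mem₂]
    group
  have e3 := halfPow_mul_self (lam := lam) hs.mem₃
  have c1 : Commute (F (s₁ * s₁) (s₂ * (s₃ * s₃) * s₂)) (P.pow (s₃ * s₃) lam) := by
    have := (commute_pentagon_arg₁ hs hF).symm
    exact P.commute_pow hs.mem₃ (this.mul_right this) lam
  rw [Pentagon] at hp hp₁ ⊢
  -- the six factors of the pentagon relation for `F₁`
  have k1 : F₁ (P.image₁ lam F s₁ s₂ s₃ * P.image₁ lam F s₁ s₂ s₃)
      (P.image₂ lam F s₂ s₃ * (P.halfPow lam s₃ * P.halfPow lam s₃) * P.image₂ lam F s₂ s₃) *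
      F (s₁ * s₁) (s₂ * (s₃ * s₃) * s₂) =
      P.comp lam F₁ F (s₁ * s₁) (s₂ * (s₃ * s₃) * s₂) := by
    rw [comp, e1, image_sandwich₂₃ hs hF]
  have k2 : F₁ (P.image₂ lam F s₂ s₃ * (P.image₁ lam F s₁ s₂ s₃ * P.image₁ lam F s₁ s₂ s₃) *
        P.image₂ lam F s₂ s₃) (P.halfPow lam s₃ * P.halfPow lam s₃) =
      F (s₁ * s₁) (s₂ * (s₃ * s₃) * s₂) *
        P.comp lam F₁ F (s₂ * (s₁ * s₁) * s₂) (s₃ * s₃) *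
      (F (s₁ * s₁) (s₂ * (s₃ * s₃) * s₂) * F (s₂ * (s₁ * s₁) * s₂) (s₃ * s₃))⁻¹ := by
    rw [comp, image_sandwich₂₁ hs hF hp, e3, ← hp]
    set a := F (s₁ * s₁) (s₂ * (s₃ * s₃) * s₂)
    set b := F (s₂ * (s₁ * s₁) * s₂) (s₃ * s₃)
    have := h₁.conj (P.conj_mem m213 b) m34 a
    rw [c1.eq, mul_inv_cancel_right] at this
    have e : a * (b * P.pow (s₂ * (s₁ * s₁) * s₂) lam * b⁻¹) * a⁻¹ =
      a * b * P.pow (s₂ * (s₁ * s₁) * s₂) lam * (a * b)⁻¹ := by group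
    rw [← e, ← this]
    group
  have k3 : F₁ (P.image₂ lam F s₂ s₃ * P.image₂ lam F s₂ s₃)
      (P.halfPow lam s₃ * P.halfPow lam s₃) * F (s₂ * s₂) (s₃ * s₃) =
      P.comp lam F₁ F (s₂ * s₂) (s₃ * s₃) := by
    rw [comp, e2, e3]
  have k4 : F₁ (P.image₁ lam F s₁ s₂ s₃ * (P.image₂ lam F s₂ s₃ * P.image₂ lam F s₂ s₃) *
        P.image₁ lam F s₁ s₂ s₃)
      (P.halfPow lam s₃ * (P.image₂ lam F s₂ s₃ * P.image₂ lam F s₂ s₃) * P.halfPow lam s₃) =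
      F (s₂ * s₂) (s₃ * s₃) *
        P.comp lam F₁ F (s₁ * (s₂ * s₂) * s₁) (s₃ * (s₂ * s₂) * s₃) *
      (F (s₂ * s₂) (s₃ * s₃) * F (s₁ * (s₂ * s₂) * s₁) (s₃ * (s₂ * s₂) * s₃))⁻¹ := by
    rw [comp, image_sandwich₁₂ hs hF hp, image_sandwich₃₂ hs hF]
    set c := F (s₂ * s₂) (s₃ * s₃)
    set d := F (s₁ * (s₂ * s₂) * s₁) (s₃ * (s₂ * s₂) * s₃)
    have := h₁.conj (P.conj_mem m123 d) m324 c
    have e : c * (d * P.pow (s₁ * (s₂ * s₂) * s₁) lam * d⁻¹) * c⁻¹ =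
      c * d * P.pow (s₁ * (s₂ * s₂) * s₁) lam * (c * d)⁻¹ := by group
    rw [← e, ← this]
    group
  have k5 : F₁ (P.image₁ lam F s₁ s₂ s₃ * P.image₁ lam F s₁ s₂ s₃)
      (P.image₂ lam F s₂ s₃ * P.image₂ lam F s₂ s₃) =
      F (s₂ * s₂) (s₃ * s₃) * F (s₁ * (s₂ * s₂) * s₁) (s₃ * (s₂ * s₂) * s₃) *
        P.comp lam F₁ F (s₁ * s₁) (s₂ * s₂) *
      (F (s₂ * s₂) (s₃ * s₃) * F (s₁ * (s₂ * s₂) * s₁) (s₃ * (s₂ * s₂) * s₃) *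
        F (s₁ * s₁) (s₂ * s₂))⁻¹ := by
    rw [comp, e1', e2']
    set g := F (s₂ * s₂) (s₃ * s₃) * F (s₁ * (s₂ * s₂) * s₁) (s₃ * (s₂ * s₂) * s₃)
    set e := F (s₁ * s₁) (s₂ * s₂)
    have := h₁.conj (P.conj_mem m12 e) m23 g
    have e' : g * (e * P.pow (s₁ * s₁) lam * e⁻¹) * g⁻¹ =
      g * e * P.pow (s₁ * s₁) lam * (g * e)⁻¹ := by group
    rw [← e', ← this]
    group
  rw [← k1, ← k3]
  rw [k2, k4, k5] at hp₁
  set a := F (s₁ * s₁) (s₂ * (s₃ * s₃) * s₂)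
  set b := F (s₂ * (s₁ * s₁) * s₂) (s₃ * s₃)
  set c := F (s₂ * s₂) (s₃ * s₃)
  set d := F (s₁ * (s₂ * s₂) * s₁) (s₃ * (s₂ * s₂) * s₃)
  set e := F (s₁ * s₁) (s₂ * s₂)
  set p1 := F₁ (P.image₁ lam F s₁ s₂ s₃ * P.image₁ lam F s₁ s₂ s₃)
      (P.image₂ lam F s₂ s₃ * (P.halfPow lam s₃ * P.halfPow lam s₃) * P.image₂ lam F s₂ s₃)
  set p2 := P.comp lam F₁ F (s₂ * (s₁ * s₁) * s₂) (s₃ * s₃)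
  set p3 := F₁ (P.image₂ lam F s₂ s₃ * P.image₂ lam F s₂ s₃)
      (P.halfPow lam s₃ * P.halfPow lam s₃)
  set p4 := P.comp lam F₁ F (s₁ * (s₂ * s₂) * s₁) (s₃ * (s₂ * s₂) * s₃)
  set p5 := P.comp lam F₁ F (s₁ * s₁) (s₂ * s₂)
  -- The conjugators accumulated by the factors telescope, by one use of each pentagon relation.
  calc p1 * a * p2 = p1 * (a * p2 * (a * b)⁻¹) * (a * b) := by group
    _ = p3 * (c * p4 * (c * d)⁻¹) * (c * d * p5 * (c * d * e)⁻¹) * (c * d * e) := by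
      rw [hp₁, hp]
    _ = p3 * c * p4 * p5 := by group

end Image

end UnipotentPower

end

noncomputable section

/-! Unipotent units of an algebra with a nilpotent ideal. -/

section Nilpotent

variable {K A : Type*} [Field K] [Ring A] [Algebra K A]

/-- Conjugation by a unit. -/
def conjAlgHom (K : Type*) {A : Type*} [Field K] [Ring A] [Algebra K A] (g : Aˣ) : A →ₐ[K] A :=
  AlgHom.ofLinearMap
    { toFun := fun x => g * x * (g⁻¹ : Aˣ)
      map_add' := fun x y => by rw [mul_add, add_mul]
      map_smul' := fun c x => by simp }
    (by simp) (fun x y => by simp [mul_assoc])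

theorem conjAlgHom_apply (g : Aˣ) (x : A) : conjAlgHom K g x = g * x * (g⁻¹ : Aˣ) := rfl

/-- The units congruent to `1` modulo a two-sided ideal. -/
def unipotentSubgroup (N : Ideal A) [N.IsTwoSided] : Subgroup Aˣ where
  carrier := {u | (u : A) - 1 ∈ N}
  mul_mem' := fun {u v} hu hv => by
    have : ((u * v : Aˣ) : A) - 1 = (u - 1) * v + (v - 1) := by
      rw [Units.val_mul]; noncomm_ring
    rw [Set.mem_ofPred_eq, this]
    exact add_mem (N.mul_mem_right _ hu) hv
  one_mem' := by simp
  inv_mem' := fun {u} hu => by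
    have : ((u⁻¹ : Aˣ) : A) - 1 = -((u⁻¹ : Aˣ) * (u - 1)) := by
      rw [mul_sub, Units.inv_mul]; noncomm_ring
    rw [Set.mem_ofPred_eq, this]
    exact neg_mem (N.mul_mem_left _ hu)

theorem mem_unipotentSubgroup {N : Ideal A} [N.IsTwoSided] {u : Aˣ} :
    u ∈ unipotentSubgroup N ↔ (u : A) - 1 ∈ N := Iff.rfl

theorem conj_mem_ideal {N : Ideal A} [N.IsTwoSided] (g : Aˣ) {a : A} (ha : a ∈ N) :
    conjAlgHom K g a ∈ N :=
  N.mul_mem_right _ (N.mul_mem_left _ ha)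

variable [CharZero K] {N : Ideal A} [N.IsTwoSided] {k : ℕ}

variable (K) in
/-- The exponential as a unit. -/
def expUnit (hN : N ^ k = ⊥) {a : A} (ha : a ∈ N) : Aˣ where
  val := truncExp K k a
  inv := truncExp K k (-a)
  val_inv := by
    rw [← truncExp_add hN ha (neg_mem ha) ((Commute.refl a).neg_right), add_neg_cancel,
      truncExp_zero hN]
  inv_val := by
    rw [← truncExp_add hN (neg_mem ha) ha ((Commute.refl a).neg_left), neg_add_cancel,
      truncExp_zero hN]

theorem expUnit_mem (hN : N ^ k = ⊥) {a : A} (ha : a ∈ N) :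
    expUnit K hN ha ∈ unipotentSubgroup N := truncExp_sub_one_mem hN ha

omit [N.IsTwoSided] in
theorem truncLog_expUnit (hN : N ^ k = ⊥) {a : A} (ha : a ∈ N) :
    truncLog K k (expUnit K hN ha : A) = a :=
  truncLog_truncExp (pow_eq_zero_of_mem hN ha)

theorem expUnit_truncLog (hN : N ^ k = ⊥) {u : Aˣ} (hu : u ∈ unipotentSubgroup N) :
    expUnit K hN (truncLog_mem (K := K) (k := k) hu) = u :=
  Units.ext (truncExp_truncLog (pow_eq_zero_of_mem hN hu))

theorem exists_expUnit (hN : N ^ k = ⊥) {u : Aˣ} (hu : u ∈ unipotentSubgroup N) :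
    ∃ (a : A) (ha : a ∈ N), u = expUnit K hN ha :=
  ⟨_, _, (expUnit_truncLog hN hu).symm⟩

theorem conj_expUnit (hN : N ^ k = ⊥) {a : A} (ha : a ∈ N) (g : Aˣ) :
    g * expUnit K hN ha * g⁻¹ = expUnit K hN (conj_mem_ideal (K := K) g ha) :=
  Units.ext (map_truncExp (conjAlgHom K g) k a)

omit [N.IsTwoSided] in
theorem expUnit_mul (hN : N ^ k = ⊥) {a b : A} (ha : a ∈ N) (hb : b ∈ N) (hab : Commute a b) :
    expUnit K hN ha * expUnit K hN hb = expUnit K hN (add_mem ha hb) :=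
  Units.ext (truncExp_add hN ha hb hab).symm

omit [N.IsTwoSided] in
theorem expUnit_inv (hN : N ^ k = ⊥) {a : A} (ha : a ∈ N) :
    (expUnit K hN ha)⁻¹ = expUnit K hN (neg_mem ha) := Units.ext rfl

omit [N.IsTwoSided] in
-- The exponents are recovered as polynomials in the units.
theorem commute_of_commute_expUnit (hN : N ^ k = ⊥) {a b : A} (ha : a ∈ N) (hb : b ∈ N)
    (h : Commute (expUnit K hN ha) (expUnit K hN hb)) : Commute a b := by
  have h1 : Commute (expUnit K hN ha : A) (expUnit K hN hb : A) := h.map (Units.coeHom A)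
  rw [← truncLog_expUnit (K := K) hN ha, ← truncLog_expUnit (K := K) hN hb]
  exact ((h1.truncLog_right k).symm.truncLog_right k).symm

omit [N.IsTwoSided] in
theorem expUnit_congr (hN : N ^ k = ⊥) {a b : A} (ha : a ∈ N) (hb : b ∈ N) (h : a = b) :
    expUnit K hN ha = expUnit K hN hb := by subst h; rfl

variable (K) in
open scoped Classical in
/-- The powers of unipotent units with exponents in `K`. -/
def unitPow (hN : N ^ k = ⊥) (u : Aˣ) (t : K) : Aˣ :=
  if h : u ∈ unipotentSubgroup N then
    expUnit K hN (algebra_smul_mem t (truncLog_mem (K := K) (k := k) h)) else 1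

theorem unitPow_expUnit (hN : N ^ k = ⊥) {a : A} (ha : a ∈ N) (t : K) :
    unitPow K hN (expUnit K hN ha) t = expUnit K hN (algebra_smul_mem t ha) := by
  rw [unitPow, dif_pos (expUnit_mem hN ha)]
  exact expUnit_congr _ _ _ (by rw [truncLog_expUnit hN ha])

variable (K) in
/-- The powers of the unipotent units. -/
def nilpotentPower (hN : N ^ k = ⊥) : UnipotentPower K Aˣ where
  U := unipotentSubgroup N
  normal := ⟨fun u hu g => by
    have : ((g * u * g⁻¹ : Aˣ) : A) - 1 = conjAlgHom K g ((u : A) - 1) := by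
      rw [map_sub, map_one]; rfl
    rw [mem_unipotentSubgroup, this]
    exact conj_mem_ideal g hu⟩
  pow := unitPow K hN
  pow_mem := fun {u} hu t => by
    obtain ⟨a, ha, rfl⟩ := exists_expUnit (K := K) hN hu
    rw [unitPow_expUnit]
    exact expUnit_mem _ _
  pow_one := fun {u} hu => by
    obtain ⟨a, ha, rfl⟩ := exists_expUnit (K := K) hN hu
    rw [unitPow_expUnit]
    exact expUnit_congr _ _ _ (one_smul K a)
  pow_add := fun {u} hu s t => by
    obtain ⟨a, ha, rfl⟩ := exists_expUnit (K := K) hN hu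
    rw [unitPow_expUnit, unitPow_expUnit, unitPow_expUnit, expUnit_mul]
    · exact expUnit_congr _ _ _ (add_smul s t a)
    · exact ((Commute.refl a).smul_left s).smul_right t
  pow_pow := fun {u} hu s t => by
    obtain ⟨a, ha, rfl⟩ := exists_expUnit (K := K) hN hu
    rw [unitPow_expUnit, unitPow_expUnit, unitPow_expUnit]
    exact expUnit_congr _ _ _ (by rw [smul_smul, mul_comm])
  conj := fun {u} hu t g => by
    obtain ⟨a, ha, rfl⟩ := exists_expUnit (K := K) hN hu
    rw [unitPow_expUnit, conj_expUnit, conj_expUnit, unitPow_expUnit]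
    exact expUnit_congr _ _ _ (map_smul _ t a)
  mul_pow := fun {u v} hu hv huv t => by
    obtain ⟨a, ha, rfl⟩ := exists_expUnit (K := K) hN hu
    obtain ⟨b, hb, rfl⟩ := exists_expUnit (K := K) hN hv
    have hab := commute_of_commute_expUnit hN ha hb huv
    rw [expUnit_mul hN ha hb hab, unitPow_expUnit, unitPow_expUnit, unitPow_expUnit, expUnit_mul]
    · exact expUnit_congr _ _ _ (smul_add t a b)
    · exact (hab.smul_left t).smul_right t

omit [CharZero K] in
theorem truncEval_sub_one_mem (hN : N ^ k = ⊥) {f : NCSeries K} (hf : f [] = 1) {a b : A}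
    (ha : a ∈ N) (hb : b ∈ N) : truncEval k f a b - 1 ∈ N := by
  have h := NCSeries.evalHom_mem hN ha hb (s := f - 1)
    (NCSeries.mem_orderIdeal_one.2 (by simp [hf, NCSeries.one_apply]))
  rwa [map_sub, map_one] at h

omit [CharZero K] [Algebra K A] in
omit [N.IsTwoSided] in
theorem isUnit_of_sub_one_mem (hN : N ^ k = ⊥) {u : A} (hu : u - 1 ∈ N) : IsUnit u := by
  have : IsNilpotent (u - 1) := by
    refine ⟨k, ?_⟩
    have := Ideal.pow_mem_pow hu k
    rwa [hN, Submodule.mem_bot] at this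
  have h := this.isUnit_one_add
  rwa [add_sub_cancel] at h

variable (K) in
/-- The value of a series with constant term `1` as a unit. -/
def evalUnitAux (hN : N ^ k = ⊥) {f : NCSeries K} (hf : f [] = 1) {a b : A} (ha : a ∈ N)
    (hb : b ∈ N) : Aˣ :=
  (isUnit_of_sub_one_mem hN (truncEval_sub_one_mem hN hf ha hb)).unit

open scoped Classical in
/-- The operation `(e^a, e^b) ↦ f(a, b)` on unipotent units. -/
def evalUnit (hN : N ^ k = ⊥) {f : NCSeries K} (hf : f [] = 1) (u v : Aˣ) : Aˣ :=
  if h : u ∈ unipotentSubgroup N ∧ v ∈ unipotentSubgroup N then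
    evalUnitAux K hN hf (truncLog_mem (K := K) (k := k) h.1) (truncLog_mem (K := K) (k := k) h.2)
  else 1

theorem evalUnit_expUnit (hN : N ^ k = ⊥) {f : NCSeries K} (hf : f [] = 1) {a b : A}
    (ha : a ∈ N) (hb : b ∈ N) :
    (evalUnit hN hf (expUnit K hN ha) (expUnit K hN hb) : A) = truncEval k f a b := by
  rw [evalUnit, dif_pos ⟨expUnit_mem hN ha, expUnit_mem hN hb⟩, evalUnitAux, IsUnit.unit_spec,
    truncLog_expUnit, truncLog_expUnit]

omit [CharZero K] in
theorem evalUnit_val (hN : N ^ k = ⊥) {f : NCSeries K} (hf : f [] = 1) {u v : Aˣ}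
    (hu : u ∈ unipotentSubgroup N) (hv : v ∈ unipotentSubgroup N) :
    (evalUnit hN hf u v : A) = truncEval k f (truncLog K k (u : A)) (truncLog K k (v : A)) := by
  rw [evalUnit, dif_pos ⟨hu, hv⟩, evalUnitAux, IsUnit.unit_spec]

omit [CharZero K] in
theorem NCSeries.exp_X_mul_exp_Y_sub_one_mem :
    (NCSeries.X K).exp * (NCSeries.Y K).exp - 1 ∈ NCSeries.orderIdeal K 1 := by
  rw [NCSeries.mem_orderIdeal_one, NCSeries.sub_apply, NCSeries.mul_nil]
  simp [NCSeries.exp, truncExp, NCSeries.one_apply]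

omit [CharZero K] in
theorem NCSeries.ch_mem : NCSeries.ch K ∈ NCSeries.orderIdeal K 1 := by
  rw [NCSeries.mem_orderIdeal_one]
  simp [NCSeries.ch, NCSeries.log, truncLog]

theorem evalHom_ch (hN : N ^ k = ⊥) {a b : A} (ha : a ∈ N) (hb : b ∈ N) :
    evalHom hN ha hb (NCSeries.ch K) =
      truncLog K k ((expUnit K hN ha * expUnit K hN hb : Aˣ) : A) := by
  rw [NCSeries.ch, NCSeries.evalHom_log hN ha hb NCSeries.exp_X_mul_exp_Y_sub_one_mem, map_mul,
    NCSeries.evalHom_exp hN ha hb NCSeries.X_mem, NCSeries.evalHom_exp hN ha hb NCSeries.Y_mem,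
    NCSeries.evalHom_X, NCSeries.evalHom_Y]
  rfl

theorem truncLog_inv (hN : N ^ k = ⊥) {u : Aˣ} (hu : u ∈ unipotentSubgroup N) :
    truncLog K k ((u⁻¹ : Aˣ) : A) = -truncLog K k (u : A) := by
  obtain ⟨a, ha, rfl⟩ := exists_expUnit (K := K) hN hu
  rw [expUnit_inv, truncLog_expUnit, truncLog_expUnit]

/-- The first relations of `GT(K)` hold in every nilpotent algebra. -/
theorem isGTPair_of_mem_GT (hN : N ^ k = ⊥) {lam : K} {f : NCSeries K} (hg : (lam, f) ∈ GT K) :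
    (nilpotentPower K hN).IsGTPair lam (evalUnit hN hg.2.1.1) where
  mem := fun {u v} hu hv => by
    obtain ⟨a, ha, rfl⟩ := exists_expUnit (K := K) hN hu
    obtain ⟨b, hb, rfl⟩ := exists_expUnit (K := K) hN hv
    change _ - _ ∈ N
    rw [evalUnit_expUnit]
    exact truncEval_sub_one_mem hN hg.2.1.1 ha hb
  conj := fun {u v} hu hv g => by
    obtain ⟨a, ha, rfl⟩ := exists_expUnit (K := K) hN hu
    obtain ⟨b, hb, rfl⟩ := exists_expUnit (K := K) hN hv
    ext
    rw [conj_expUnit, conj_expUnit, evalUnit_expUnit, Units.val_mul, Units.val_mul,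
      evalUnit_expUnit]
    exact map_truncEval (conjAlgHom K g) k f a b
  dual := fun {u v} hu hv => by
    obtain ⟨a, ha, rfl⟩ := exists_expUnit (K := K) hN hu
    obtain ⟨b, hb, rfl⟩ := exists_expUnit (K := K) hN hv
    ext
    rw [Units.val_mul, evalUnit_expUnit, evalUnit_expUnit, Units.val_one]
    have := congrArg (evalHom hN ha hb) hg.2.2.1
    rw [map_mul, map_one, NCSeries.evalHom_subst hN ha hb NCSeries.Y_mem NCSeries.X_mem,
      NCSeries.evalHom_X, NCSeries.evalHom_Y] at this
    exact this
  hex := fun {u v w} hu hv hw h => by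
    obtain ⟨a, ha, rfl⟩ := exists_expUnit (K := K) hN hu
    obtain ⟨b, hb, rfl⟩ := exists_expUnit (K := K) hN hv
    have hz : -NCSeries.ch K ∈ NCSeries.orderIdeal K 1 := neg_mem NCSeries.ch_mem
    -- The condition on the three units reads `w = (u v)⁻¹`, so the logarithm of `w` is the value of
    -- `z = -ch(x, y)`.
    have hw' : evalHom hN ha hb (-NCSeries.ch K) = truncLog K k (w : A) := by
      rw [map_neg, evalHom_ch hN ha hb, eq_inv_of_mul_eq_one_right h,
        truncLog_inv hN (mul_mem hu hv)]
    have hww := expUnit_truncLog (K := K) hN hw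
    set c := truncLog K k (w : A) with hc
    have hcN : c ∈ N := truncLog_mem hw
    rw [← hww]
    have := congrArg (evalHom hN ha hb) hg.2.2.2.1
    ext
    change ((evalUnit hN _ _ _ * unitPow K hN _ _ * evalUnit hN _ _ _ * unitPow K hN _ _ *
      evalUnit hN _ _ _ * unitPow K hN _ _ : Aˣ) : A) = _
    simp only [map_mul, map_one, NCSeries.evalHom_subst hN ha hb hz NCSeries.X_mem,
      NCSeries.evalHom_subst hN ha hb NCSeries.Y_mem hz,
      NCSeries.evalHom_exp hN ha hb (algebra_smul_mem _ hz),
      NCSeries.evalHom_exp hN ha hb (algebra_smul_mem _ NCSeries.X_mem),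
      NCSeries.evalHom_exp hN ha hb (algebra_smul_mem _ NCSeries.Y_mem), map_smul, hw',
      NCSeries.evalHom_X, NCSeries.evalHom_Y] at this
    simp only [unitPow_expUnit, Units.val_mul, Units.val_one, evalUnit_expUnit]
    exact this
  mul := fun {u v c d} hu hv hc hd h1 h2 h3 h4 => by
    obtain ⟨a, ha, rfl⟩ := exists_expUnit (K := K) hN hu
    obtain ⟨b, hb, rfl⟩ := exists_expUnit (K := K) hN hv
    obtain ⟨a', ha', rfl⟩ := exists_expUnit (K := K) hN hc
    obtain ⟨b', hb', rfl⟩ := exists_expUnit (K := K) hN hd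
    have h1 := commute_of_commute_expUnit hN ha ha' h1
    have h2 := commute_of_commute_expUnit hN ha hb' h2
    have h3 := commute_of_commute_expUnit hN hb ha' h3
    have h4 := commute_of_commute_expUnit hN hb hb' h4
    ext
    rw [expUnit_mul hN ha ha' h1, expUnit_mul hN hb hb' h4, Units.val_mul, evalUnit_expUnit,
      evalUnit_expUnit, evalUnit_expUnit]
    exact hg.2.1.truncEval_add hN ha hb ha' hb' h1 h2 h3 h4

end Nilpotent

end

/-! ### Products in the group: group-likeness, duality and hexagon. -/

noncomputable section

namespace UnipotentPower

variable {K G : Type*} [Field K] [Group G] {P : UnipotentPower K G}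
  {lam₁ lam₂ : K} {F₁ F₂ : G → G → G} (h₁ : P.IsGTPair lam₁ F₁) (h₂ : P.IsGTPair lam₂ F₂)

include h₁ h₂

/-- Everything built from `u`, `v` commutes with everything built from `c`, `d`, so the factors can
be regrouped. By the criterion for group-like series, this is group-likeness of a product. -/
theorem comp_mul {u v c d : G} (hu : u ∈ P.U) (hv : v ∈ P.U) (hc : c ∈ P.U) (hd : d ∈ P.U)
    (huc : Commute u c) (hud : Commute u d) (hvc : Commute v c) (hvd : Commute v d) :
    P.comp lam₂ F₁ F₂ (u * c) (v * d) = P.comp lam₂ F₁ F₂ u v * P.comp lam₂ F₁ F₂ c d := by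
  have hA := P.conj_mem (P.pow_mem hu lam₂) (F₂ u v)
  have hA' := P.conj_mem (P.pow_mem hc lam₂) (F₂ c d)
  have hB := P.pow_mem hv lam₂
  have hB' := P.pow_mem hd lam₂
  have e_c : Commute (F₂ u v) c := (h₂.commute hu hv huc.symm hvc.symm).symm
  have e_d : Commute (F₂ u v) d := (h₂.commute hu hv hud.symm hvd.symm).symm
  have u_e : Commute u (F₂ c d) := h₂.commute hc hd huc hud
  have v_e : Commute v (F₂ c d) := h₂.commute hc hd hvc hvd
  have e_e : Commute (F₂ u v) (F₂ c d) := h₂.commute hc hd e_c e_d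
  have pu : ∀ {g}, Commute g u → Commute g (P.pow u lam₂) := fun h => P.commute_pow hu h lam₂
  have pv : ∀ {g}, Commute g v → Commute g (P.pow v lam₂) := fun h => P.commute_pow hv h lam₂
  have pc : ∀ {g}, Commute g c → Commute g (P.pow c lam₂) := fun h => P.commute_pow hc h lam₂
  have pd : ∀ {g}, Commute g d → Commute g (P.pow d lam₂) := fun h => P.commute_pow hd h lam₂
  have A_ : ∀ {g}, Commute g (F₂ u v) → Commute g u →
      Commute g (F₂ u v * P.pow u lam₂ * (F₂ u v)⁻¹) := fun h1 h2 =>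
    (h1.mul_right (pu h2)).mul_right h1.inv_right
  have A'_ : ∀ {g}, Commute g (F₂ c d) → Commute g c →
      Commute g (F₂ c d * P.pow c lam₂ * (F₂ c d)⁻¹) := fun h1 h2 =>
    (h1.mul_right (pc h2)).mul_right h1.inv_right
  have hAA' := A'_ (A_ e_e.symm u_e.symm).symm (A_ e_c.symm huc.symm).symm
  have hAB' := pd (A_ e_d.symm hud.symm).symm
  have hBA' := A'_ (pv v_e.symm).symm (pv hvc.symm).symm
  have hBB' := pd (pv hvd.symm).symm
  have e1 : F₂ u v * F₂ c d * (P.pow u lam₂ * P.pow c lam₂) * (F₂ u v * F₂ c d)⁻¹ =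
      F₂ u v * P.pow u lam₂ * (F₂ u v)⁻¹ * (F₂ c d * P.pow c lam₂ * (F₂ c d)⁻¹) := by
    have h1 : Commute (P.pow u lam₂) (F₂ c d) := (pu u_e.symm).symm
    have h2 : Commute (F₂ u v)⁻¹ (F₂ c d * P.pow c lam₂ * (F₂ c d)⁻¹) := (A'_ e_e e_c).inv_left
    calc F₂ u v * F₂ c d * (P.pow u lam₂ * P.pow c lam₂) * (F₂ u v * F₂ c d)⁻¹
        = F₂ u v * (F₂ c d * P.pow u lam₂) * P.pow c lam₂ * (F₂ c d)⁻¹ * (F₂ u v)⁻¹ := by group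
      _ = F₂ u v * P.pow u lam₂ * (F₂ c d * P.pow c lam₂ * (F₂ c d)⁻¹ * (F₂ u v)⁻¹) := by
          rw [← h1.eq]; group
      _ = _ := by rw [← h2.eq]; group
  have h5 : Commute (F₁ (F₂ c d * P.pow c lam₂ * (F₂ c d)⁻¹) (P.pow d lam₂)) (F₂ u v) :=
    (h₁.commute hA' hB' (A'_ e_e e_c) (pd e_d)).symm
  rw [comp, comp, comp, h₂.mul hu hv hc hd huc hud hvc hvd, P.mul_pow hu hc huc,
    P.mul_pow hv hd hvd, e1, h₁.mul hA hB hA' hB' hAA' hAB' hBA' hBB']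
  have := h5.eq
  rw [mul_assoc, ← mul_assoc _ (F₂ u v) (F₂ c d), this]
  simp only [mul_assoc]

end UnipotentPower

namespace NCSeries

variable {K : Type*} [Field K]

/-- The inverse is the geometric series, whose coefficients are finite sums. It guarantees that
`Ring.inverse` in the group law is a true inverse and not the default value `0`. -/
theorem isUnit_of_apply_nil {f : NCSeries K} (hf : f [] = 1) : IsUnit f := by
  have h1 : 1 - f ∈ orderIdeal K 1 := mem_orderIdeal_one.2 (by simp [hf, one_apply])
  let g : NCSeries K := fun w => (∑ j ∈ Finset.range (w.length + 1), (1 - f) ^ j) w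
  have hg : ∀ n, toTrunc K n g = toTrunc K n (∑ j ∈ Finset.range n, (1 - f) ^ j) := fun n =>
    toTrunc_eq_iff.2 fun w hw => by
      rw [sub_apply, sub_eq_zero]
      exact sum_apply_eq_of_order (pow_mem_orderIdeal h1) (by omega) hw
  have h0 : ∀ n, toTrunc K n ((1 - f) ^ n) = 0 := fun n => by
    rw [← map_zero (toTrunc K n), toTrunc_eq_iff, sub_zero]
    exact pow_mem_orderIdeal h1 n
  refine ⟨⟨f, g, ?_, ?_⟩, rfl⟩
  · refine eq_of_toTrunc_eq fun n => ?_
    rw [map_mul, hg, ← map_mul]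
    have := mul_neg_geom_sum (1 - f) n
    rw [sub_sub_cancel] at this
    rw [this, map_sub, h0, sub_zero]
  · refine eq_of_toTrunc_eq fun n => ?_
    rw [map_mul, hg, ← map_mul]
    have := geom_sum_mul_neg (1 - f) n
    rw [sub_sub_cancel] at this
    rw [this, map_sub, h0, sub_zero]

theorem subst_apply_nil (f a b : NCSeries K) : f.subst a b [] = f [] := by
  rw [subst, List.length_nil, truncEval_succ, truncEval_zero, truncEval_zero]
  simp [one_apply]

theorem conj_mem_orderIdeal (f : NCSeries K) :
    f * X K * Ring.inverse f ∈ orderIdeal K 1 :=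
  Ideal.mul_mem_right _ _ (Ideal.mul_mem_left _ _ X_mem)

end NCSeries

section Product

variable {K A : Type*} [Field K] [CharZero K] [Ring A] [Algebra K A] {N : Ideal A} [N.IsTwoSided]
  {k : ℕ} (hN : N ^ k = ⊥)

omit [N.IsTwoSided] in
theorem Commute.expUnit {a b : A} (ha : a ∈ N) (hb : b ∈ N) (h : Commute a b) :
    Commute (expUnit K hN ha) (expUnit K hN hb) := by
  rw [Commute, SemiconjBy, expUnit_mul hN ha hb h, expUnit_mul hN hb ha h.symm]
  exact expUnit_congr _ _ _ (add_comm _ _)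

omit [CharZero K] in
theorem gtMul_apply_nil {g₁ g₂ : K × NCSeries K} (h₁ : g₁.2 [] = 1) (h₂ : g₂.2 [] = 1) :
    (gtMul g₁ g₂).2 [] = 1 := by
  change (g₁.2.subst _ _ * g₂.2) [] = 1
  rw [NCSeries.mul_nil, NCSeries.subst_apply_nil, h₁, h₂, mul_one]

/-- The evaluation of a product in a nilpotent algebra. -/
theorem evalUnit_gtMul {g₁ g₂ : K × NCSeries K} (h₁ : g₁.2 [] = 1) (h₂ : g₂.2 [] = 1) {u v : Aˣ}
    (hu : u ∈ unipotentSubgroup N) (hv : v ∈ unipotentSubgroup N) :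
    evalUnit hN (gtMul_apply_nil h₁ h₂) u v =
      (nilpotentPower K hN).comp g₂.1 (evalUnit hN h₁) (evalUnit hN h₂) u v := by
  obtain ⟨a, ha, rfl⟩ := exists_expUnit (K := K) hN hu
  obtain ⟨b, hb, rfl⟩ := exists_expUnit (K := K) hN hv
  set e := evalUnit hN h₂ (expUnit K hN ha) (expUnit K hN hb) with he
  have he' : (e : A) = evalHom hN ha hb g₂.2 := evalUnit_expUnit hN h₂ ha hb
  have hinv : evalHom hN ha hb (Ring.inverse g₂.2) = ((e⁻¹ : Aˣ) : A) := by
    have h3 := congrArg (evalHom hN ha hb)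
      (Ring.mul_inverse_cancel _ (NCSeries.isUnit_of_apply_nil h₂))
    rw [map_mul, map_one, ← he'] at h3
    exact (Units.mul_eq_one_iff_inv_eq.1 h3).symm
  have e1 : (nilpotentPower K hN).comp g₂.1 (evalUnit hN h₁) (evalUnit hN h₂)
      (expUnit K hN ha) (expUnit K hN hb) =
      evalUnit hN h₁ (e * unitPow K hN (expUnit K hN ha) g₂.1 * e⁻¹)
        (unitPow K hN (expUnit K hN hb) g₂.1) * e := rfl
  ext
  rw [e1, evalUnit_expUnit, unitPow_expUnit, unitPow_expUnit, conj_expUnit, Units.val_mul,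
    evalUnit_expUnit, he', gtMul, ← evalHom_apply hN ha hb, map_mul,
    NCSeries.evalHom_subst hN ha hb
      (algebra_smul_mem _ (NCSeries.conj_mem_orderIdeal _)) (algebra_smul_mem _ NCSeries.Y_mem),
    map_smul, map_smul, map_mul, map_mul, hinv, NCSeries.evalHom_X, NCSeries.evalHom_Y, ← he',
    map_smul, conjAlgHom_apply]

variable {g₁ g₂ : K × NCSeries K} (h₁ : g₁ ∈ GT K) (h₂ : g₂ ∈ GT K)

include h₁ h₂

theorem isGroupLike_gtMul : (gtMul g₁ g₂).2.IsGroupLike := by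
  have hF := gtMul_apply_nil h₁.2.1.1 h₂.2.1.1
  refine NCSeries.isGroupLike_of_truncEval_add hF
    fun k a b a' b' ha hb ha' hb' c1 c2 c3 c4 => ?_
  have hN := NCSeries.pairTruncIdeal_pow (K := K) k
  have := UnipotentPower.comp_mul (isGTPair_of_mem_GT hN h₁) (isGTPair_of_mem_GT hN h₂)
    (expUnit_mem (K := K) hN ha) (expUnit_mem (K := K) hN hb) (expUnit_mem (K := K) hN ha')
    (expUnit_mem (K := K) hN hb')
    (c1.expUnit hN ha ha') (c2.expUnit hN ha hb') (c3.expUnit hN hb ha') (c4.expUnit hN hb hb')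
  rw [expUnit_mul (K := K) hN ha ha' c1, expUnit_mul (K := K) hN hb hb' c4,
    ← evalUnit_gtMul hN h₁.2.1.1 h₂.2.1.1 (expUnit_mem _ _) (expUnit_mem _ _),
    ← evalUnit_gtMul hN h₁.2.1.1 h₂.2.1.1 (expUnit_mem _ _) (expUnit_mem _ _),
    ← evalUnit_gtMul hN h₁.2.1.1 h₂.2.1.1 (expUnit_mem _ _) (expUnit_mem _ _)] at this
  have := congrArg Units.val this
  rwa [Units.val_mul, evalUnit_expUnit, evalUnit_expUnit, evalUnit_expUnit] at this

theorem gtMul_duality :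
    (gtMul g₁ g₂).2 * (gtMul g₁ g₂).2.subst (NCSeries.Y K) (NCSeries.X K) = 1 := by
  refine NCSeries.eq_of_toTrunc_eq fun n => ?_
  have hN := NCSeries.truncIdeal_pow (K := K) n
  have hx := NCSeries.toTrunc_mem (n := n) (NCSeries.X_mem (K := K))
  have hy := NCSeries.toTrunc_mem (n := n) (NCSeries.Y_mem (K := K))
  have := UnipotentPower.comp_dual (isGTPair_of_mem_GT hN h₁) (isGTPair_of_mem_GT hN h₂)
    (expUnit_mem (K := K) hN hx) (expUnit_mem (K := K) hN hy)
  rw [← evalUnit_gtMul hN h₁.2.1.1 h₂.2.1.1 (expUnit_mem _ _) (expUnit_mem _ _),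
    ← evalUnit_gtMul hN h₁.2.1.1 h₂.2.1.1 (expUnit_mem _ _) (expUnit_mem _ _)] at this
  have := congrArg Units.val this
  rw [Units.val_mul, evalUnit_expUnit, evalUnit_expUnit, Units.val_one] at this
  rw [map_mul, map_one, NCSeries.toTrunc_subst NCSeries.Y_mem NCSeries.X_mem,
    NCSeries.toTrunc_self, this]

theorem gtMul_hexagon :
    (gtMul g₁ g₂).2.subst (-NCSeries.ch K) (NCSeries.X K) *
      ((((gtMul g₁ g₂).1 - 1) / 2) • (-NCSeries.ch K)).exp *
      (gtMul g₁ g₂).2.subst (NCSeries.Y K) (-NCSeries.ch K) *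
      ((((gtMul g₁ g₂).1 - 1) / 2) • NCSeries.Y K).exp * (gtMul g₁ g₂).2 *
      ((((gtMul g₁ g₂).1 - 1) / 2) • NCSeries.X K).exp = 1 := by
  refine NCSeries.eq_of_toTrunc_eq fun n => ?_
  have hN := NCSeries.truncIdeal_pow (K := K) n
  have hx := NCSeries.toTrunc_mem (n := n) (NCSeries.X_mem (K := K))
  have hy := NCSeries.toTrunc_mem (n := n) (NCSeries.Y_mem (K := K))
  have hch : -NCSeries.ch K ∈ NCSeries.orderIdeal K 1 := neg_mem NCSeries.ch_mem
  have hz := NCSeries.toTrunc_mem (n := n) hch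
  -- This is `e^x e^y e^z = 1` in the truncation, the hypothesis of the abstract hexagon.
  have hxyz : expUnit K hN hx * expUnit K hN hy * expUnit K hN hz = 1 := by
    have h3 : NCSeries.toTrunc K n (-NCSeries.ch K) = truncLog K n
        (((expUnit K hN hx * expUnit K hN hy : (NCSeries.Trunc K n)ˣ))⁻¹ :
          (NCSeries.Trunc K n)ˣ).val := by
      rw [truncLog_inv hN (mul_mem (expUnit_mem _ _) (expUnit_mem _ _)), map_neg, NCSeries.ch,
        NCSeries.toTrunc_log NCSeries.exp_X_mul_exp_Y_sub_one_mem, map_mul,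
        NCSeries.toTrunc_exp NCSeries.X_mem, NCSeries.toTrunc_exp NCSeries.Y_mem]
      rfl
    have h5 : (expUnit K hN hx * expUnit K hN hy)⁻¹ ∈ unipotentSubgroup (NCSeries.truncIdeal K n) :=
      inv_mem (mul_mem (expUnit_mem hN hx) (expUnit_mem hN hy))
    have h4 : expUnit K hN hz = (expUnit K hN hx * expUnit K hN hy)⁻¹ :=
      (expUnit_congr hN hz (truncLog_mem h5) h3).trans (expUnit_truncLog hN h5)
    rw [h4, mul_inv_cancel]
  have := UnipotentPower.comp_hex (isGTPair_of_mem_GT hN h₁) (isGTPair_of_mem_GT hN h₂)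
    (expUnit_mem (K := K) hN hx) (expUnit_mem (K := K) hN hy) (expUnit_mem (K := K) hN hz)
    hxyz
  rw [← evalUnit_gtMul hN h₁.2.1.1 h₂.2.1.1 (expUnit_mem _ _) (expUnit_mem _ _),
    ← evalUnit_gtMul hN h₁.2.1.1 h₂.2.1.1 (expUnit_mem _ _) (expUnit_mem _ _),
    ← evalUnit_gtMul hN h₁.2.1.1 h₂.2.1.1 (expUnit_mem _ _) (expUnit_mem _ _)] at this
  have := congrArg Units.val this
  change ((evalUnit hN _ _ _ * unitPow K hN _ _ * evalUnit hN _ _ _ * unitPow K hN _ _ *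
      evalUnit hN _ _ _ * unitPow K hN _ _ : (NCSeries.Trunc K n)ˣ) : NCSeries.Trunc K n) = _
    at this
  simp only [unitPow_expUnit, Units.val_mul, Units.val_one, evalUnit_expUnit] at this
  simp only [map_mul, map_one, NCSeries.toTrunc_subst hch NCSeries.X_mem,
    NCSeries.toTrunc_subst NCSeries.Y_mem hch, NCSeries.toTrunc_exp (algebra_smul_mem _ hch),
    NCSeries.toTrunc_exp (algebra_smul_mem _ NCSeries.X_mem),
    NCSeries.toTrunc_exp (algebra_smul_mem _ NCSeries.Y_mem), map_smul]
  rw [NCSeries.toTrunc_self (gtMul g₁ g₂).2 n]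
  exact this

end Product

end

noncomputable section

theorem Ideal.map_pow_mem {A B F : Type*} [Ring A] [Ring B] [FunLike F A B] [RingHomClass F A B]
    (φ : F) {I : Ideal A} {J : Ideal B} (h : ∀ x ∈ I, φ x ∈ J) [J.IsTwoSided] [I.IsTwoSided]
    {n : ℕ} {x : A} (hx : x ∈ I ^ n) : φ x ∈ J ^ n := by
  have h1 : I ^ n ≤ (J ^ n).comap φ := by
    clear hx
    induction n with
    | zero => exact fun x _ => mem_ideal_pow_zero J _
    | succ n ih =>
      rw [Ideal.IsTwoSided.pow_succ, Ideal.mul_le]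
      intro r hr s hs
      rw [Ideal.mem_comap, map_mul, Ideal.IsTwoSided.pow_succ]
      exact Ideal.mul_mem_mul (h r hr) (ih hs)
  exact h1 hx

/-! The ideals of the group algebra of `G` induced from the powers of the augmentation ideal of a
normal subgroup `H`. -/

section Induced

variable (K : Type*) {G : Type*} [Field K] [Group G] (H : Subgroup G)

/-- The augmentation ideal. -/
abbrev augIdeal : Ideal (MonoidAlgebra K H) :=
  RingHom.ker (MonoidAlgebra.lift K K H (1 : H →* K))

/-- The inclusion of group algebras. -/
def subgroupAlgHom : MonoidAlgebra K H →ₐ[K] MonoidAlgebra K G :=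
  MonoidAlgebra.mapDomainAlgHom K K H.subtype

theorem subgroupAlgHom_single (h : H) (r : K) :
    subgroupAlgHom K H (.single h r) = .single (h : G) r := by
  simp [subgroupAlgHom]

/-- The left ideal generated by the `n`-th power of the augmentation ideal of `H`. -/
def inducedIdeal (n : ℕ) : Ideal (MonoidAlgebra K G) :=
  (augIdeal K H ^ n).map (subgroupAlgHom K H)

/-- The retraction onto the group algebra of a subgroup, killing the elements outside of it. -/
def subgroupRetract : MonoidAlgebra K G →+ MonoidAlgebra K H :=
  MonoidAlgebra.comapDomainAddMonoidHom H.subtype H.subtype_injective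

theorem subgroupRetract_single_coe (h : H) (r : K) :
    subgroupRetract K H (.single (h : G) r) = .single h r :=
  MonoidAlgebra.comapDomain_single_map _ H.subtype_injective h r

theorem subgroupRetract_single_of_notMem {g : G} (hg : g ∉ H) (r : K) :
    subgroupRetract K H (.single g r) = 0 :=
  MonoidAlgebra.comapDomain_single_of_not_mem_range
    (fun ⟨k, hk⟩ => hg (hk ▸ k.2)) H.subtype_injective

theorem subgroupRetract_subgroupAlgHom (y : MonoidAlgebra K H) :
    subgroupRetract K H (subgroupAlgHom K H y) = y := by
  induction y using MonoidAlgebra.induction_linear with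
  | zero => simp
  | add a b ha hb => rw [map_add, map_add, ha, hb]
  | single h s => rw [subgroupAlgHom_single, subgroupRetract_single_coe]

theorem subgroupRetract_single_mul (g : G) (r : K) (y : MonoidAlgebra K H) (n : ℕ)
    (hy : y ∈ augIdeal K H ^ n) :
    subgroupRetract K H (.single g r * subgroupAlgHom K H y) ∈ augIdeal K H ^ n := by
  by_cases hg : g ∈ H
  · obtain ⟨h, rfl⟩ : ∃ h : H, (h : G) = g := ⟨⟨g, hg⟩, rfl⟩
    rw [← subgroupAlgHom_single, ← map_mul, subgroupRetract_subgroupAlgHom]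
    exact Ideal.mul_mem_left _ _ hy
  · have : subgroupRetract K H (.single g r * subgroupAlgHom K H y) = 0 := by
      clear hy
      induction y using MonoidAlgebra.induction_linear with
      | zero => simp
      | add a b ha hb => rw [map_add, mul_add, map_add, ha, hb, add_zero]
      | single h s =>
        rw [subgroupAlgHom_single, MonoidAlgebra.single_mul_single]
        exact subgroupRetract_single_of_notMem K H (fun h1 => hg ((H.mul_mem_cancel_right h.2).1 h1)) _
    rw [this]
    exact zero_mem _

/-- The retraction picks out the coset of the identity, and right multiplication by `K[H]` respects
cosets. Hence the left ideal generated by a power of the augmentation ideal meets `K[H]` in nothing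
new. -/
theorem subgroupRetract_mem {n : ℕ} {a : MonoidAlgebra K G} (ha : a ∈ inducedIdeal K H n) :
    subgroupRetract K H a ∈ augIdeal K H ^ n := by
  -- The retraction is not linear over the big algebra, so the induction over the span has to carry
  -- an arbitrary left factor.
  have h : ∀ c : MonoidAlgebra K G, subgroupRetract K H (c * a) ∈ augIdeal K H ^ n := by
    refine Submodule.span_induction (p := fun a _ => ∀ c : MonoidAlgebra K G,
      subgroupRetract K H (c * a) ∈ augIdeal K H ^ n) ?_ ?_ ?_ ?_ ha
    · rintro _ ⟨y, hy, rfl⟩ c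
      induction c using MonoidAlgebra.induction_linear with
      | zero => simp
      | add a b ha hb => rw [add_mul, map_add]; exact add_mem ha hb
      | single g r => exact subgroupRetract_single_mul K H g r y n hy
    · intro c; simp
    · intro x y _ _ hx hy c
      rw [mul_add, map_add]
      exact add_mem (hx c) (hy c)
    · intro b x _ hx c
      rw [smul_eq_mul, ← mul_assoc]
      exact hx _
  simpa using h 1

/-- No information is lost when the group algebra of the subgroup modulo the `n`-th power is
embedded into a quotient of the big group algebra. This lets the pentagon in `PB₄` be tested in a
representation of `B₄`. -/
theorem mem_of_subgroupAlgHom_mem {n : ℕ} {a : MonoidAlgebra K H}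
    (ha : subgroupAlgHom K H a ∈ inducedIdeal K H n) : a ∈ augIdeal K H ^ n := by
  have h := subgroupRetract_mem K H ha
  rwa [subgroupRetract_subgroupAlgHom] at h

variable {K H} in
/-- A representation of `H` which is trivial modulo `N` maps the augmentation ideal to `N`. -/
theorem lift_mem_of_mem_augIdeal {A : Type*} [Ring A] [Algebra K A] {N : Ideal A}
    (φ : MonoidAlgebra K H →ₐ[K] A) (h : ∀ g : H, φ (.of K H g) - 1 ∈ N) {x : MonoidAlgebra K H}
    (hx : x ∈ augIdeal K H) : φ x ∈ N := by
  have h1 : ∀ x, φ x - algebraMap K A (MonoidAlgebra.lift K K H (1 : H →* K) x) ∈ N := by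
    intro x
    induction x using MonoidAlgebra.induction_on with
    | of g => simpa using h g
    | add a b ha hb =>
      rw [map_add, map_add, map_add, add_sub_add_comm]
      exact add_mem ha hb
    | smul r a ha =>
      rw [map_smul, map_smul, smul_eq_mul, map_mul, ← Algebra.smul_def, ← smul_sub,
        Algebra.smul_def]
      exact Ideal.mul_mem_left _ _ ha
  have h2 := h1 x
  rwa [RingHom.mem_ker.1 hx, map_zero, sub_zero] at h2

variable [H.Normal]

/-- Conjugation by an element of `G` on the group algebra of `H`. -/
def subgroupConj (g : G) : MonoidAlgebra K H →ₐ[K] MonoidAlgebra K H :=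
  MonoidAlgebra.mapDomainAlgHom K K (MulAut.conjNormal g : MulAut H).toMonoidHom

/-- Normality moves group elements to the left at the price of a conjugation; this is why the
induced left ideals are two-sided. -/
theorem subgroupAlgHom_mul_single (g : G) (r : K) (y : MonoidAlgebra K H) :
    subgroupAlgHom K H y * .single g r =
      .single g r * subgroupAlgHom K H (subgroupConj K H g⁻¹ y) := by
  induction y using MonoidAlgebra.induction_linear with
  | zero => simp
  | add a b ha hb => simp only [map_add, mul_add, add_mul, ha, hb]
  | single h s =>
    have : subgroupConj K H g⁻¹ (.single h s) = .single (MulAut.conjNormal g⁻¹ h) s := by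
      simp [subgroupConj]
    rw [this, subgroupAlgHom_single, subgroupAlgHom_single, MonoidAlgebra.single_mul_single,
      MonoidAlgebra.single_mul_single, MulAut.conjNormal_apply, mul_comm r]
    congr 1
    group

theorem subgroupConj_mem (g : G) {n : ℕ} {y : MonoidAlgebra K H} (hy : y ∈ augIdeal K H ^ n) :
    subgroupConj K H g y ∈ augIdeal K H ^ n := by
  refine Ideal.map_pow_mem (subgroupConj K H g) (fun x hx => ?_) hy
  refine lift_mem_of_mem_augIdeal (subgroupConj K H g) (fun h => ?_) hx
  simp [subgroupConj, RingHom.mem_ker, MonoidAlgebra.of_apply]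

instance (n : ℕ) : (inducedIdeal K H n).IsTwoSided := by
  refine ⟨fun {a} b ha => ?_⟩
  refine Submodule.span_induction (p := fun a _ => a * b ∈ inducedIdeal K H n) ?_ ?_ ?_ ?_ ha
  · rintro _ ⟨y, hy, rfl⟩
    induction b using MonoidAlgebra.induction_linear with
    | zero => simp
    | add a b ha hb => rw [mul_add]; exact add_mem ha hb
    | single g r =>
      change subgroupAlgHom K H y * _ ∈ _
      rw [subgroupAlgHom_mul_single]
      exact Ideal.mul_mem_left _ _ (Ideal.mem_map_of_mem _ (subgroupConj_mem K H _ hy))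
  · simp
  · intro x y _ _ hx hy
    rw [add_mul]
    exact add_mem hx hy
  · intro c x _ hx
    rw [smul_eq_mul, mul_assoc]
    exact Ideal.mul_mem_left _ _ hx

theorem subgroupAlgHom_mul_mul_mem {n : ℕ} {x : MonoidAlgebra K H} (hx : x ∈ augIdeal K H)
    (c : MonoidAlgebra K G) {y : MonoidAlgebra K H} (hy : y ∈ augIdeal K H ^ n) :
    subgroupAlgHom K H x * (c * subgroupAlgHom K H y) ∈ inducedIdeal K H (n + 1) := by
  induction c using MonoidAlgebra.induction_linear with
  | zero => simp
  | add a b ha hb => rw [add_mul, mul_add]; exact add_mem ha hb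
  | single g r =>
    rw [← mul_assoc, subgroupAlgHom_mul_single, mul_assoc, ← map_mul]
    refine Ideal.mul_mem_left _ _ (Ideal.mem_map_of_mem _ ?_)
    rw [Ideal.IsTwoSided.pow_succ]
    refine Ideal.mul_mem_mul ?_ hy
    have := subgroupConj_mem K H g⁻¹ (n := 1) (y := x) (by rwa [Submodule.pow_one])
    rwa [Submodule.pow_one] at this

theorem subgroupAlgHom_mul_mem {n : ℕ} {x : MonoidAlgebra K H} (hx : x ∈ augIdeal K H)
    {b : MonoidAlgebra K G} (hb : b ∈ inducedIdeal K H n) :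
    subgroupAlgHom K H x * b ∈ inducedIdeal K H (n + 1) := by
  have h : ∀ c : MonoidAlgebra K G, subgroupAlgHom K H x * (c * b) ∈ inducedIdeal K H (n + 1) := by
    refine Submodule.span_induction (p := fun b _ => ∀ c : MonoidAlgebra K G,
      subgroupAlgHom K H x * (c * b) ∈ inducedIdeal K H (n + 1)) ?_ ?_ ?_ ?_ hb
    · rintro _ ⟨y, hy, rfl⟩ c
      exact subgroupAlgHom_mul_mul_mem K H hx c hy
    · intro c
      rw [mul_zero, mul_zero]
      exact zero_mem _
    · intro a b _ _ ha hb c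
      rw [mul_add c, mul_add (subgroupAlgHom K H x)]
      exact add_mem (ha c) (hb c)
    · intro b a _ ha c
      rw [smul_eq_mul, ← mul_assoc c]
      exact ha _
  simpa using h 1

theorem inducedIdeal_mul_mem {n : ℕ} {a b : MonoidAlgebra K G} (ha : a ∈ inducedIdeal K H 1)
    (hb : b ∈ inducedIdeal K H n) : a * b ∈ inducedIdeal K H (n + 1) := by
  refine Submodule.span_induction (p := fun a _ => a * b ∈ inducedIdeal K H (n + 1))
    ?_ ?_ ?_ ?_ ha
  · rintro _ ⟨y, hy, rfl⟩
    exact subgroupAlgHom_mul_mem K H (by rwa [SetLike.mem_coe, Submodule.pow_one] at hy) hb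
  · simp
  · intro x y _ _ hx hy
    rw [add_mul]
    exact add_mem hx hy
  · intro c x _ hx
    rw [smul_eq_mul, mul_assoc]
    exact Ideal.mul_mem_left _ _ hx

/-- The quotient of the group algebra of `G` by the induced ideal. -/
abbrev InducedQuotient (n : ℕ) : Type _ := MonoidAlgebra K G ⧸ inducedIdeal K H n

/-- The image of the augmentation ideal. -/
def inducedNil (n : ℕ) : Ideal (InducedQuotient K H n) :=
  (inducedIdeal K H 1).map (Ideal.Quotient.mk (inducedIdeal K H n))

variable {K H} in
theorem mem_inducedNil {n : ℕ} {a : InducedQuotient K H n} :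
    a ∈ inducedNil K H n ↔ ∃ b ∈ inducedIdeal K H 1, Ideal.Quotient.mk _ b = a :=
  Ideal.mem_map_iff_of_surjective _ Ideal.Quotient.mk_surjective

instance (n : ℕ) : (inducedNil K H n).IsTwoSided :=
  ⟨fun {a} b ha => by
    obtain ⟨f, hf, rfl⟩ := mem_inducedNil.1 ha
    obtain ⟨g, rfl⟩ := Ideal.Quotient.mk_surjective b
    exact mem_inducedNil.2 ⟨f * g, Ideal.mul_mem_right _ _ hf, map_mul _ _ _⟩⟩

omit [H.Normal] in
theorem inducedIdeal_zero : inducedIdeal K H 0 = ⊤ := by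
  rw [Ideal.eq_top_iff_one, ← map_one (subgroupAlgHom K H)]
  exact Ideal.mem_map_of_mem _ (mem_ideal_pow_zero _ _)

theorem inducedNil_pow (n : ℕ) : inducedNil K H n ^ n = ⊥ := by
  have h : ∀ m, inducedNil K H n ^ m ≤
      (inducedIdeal K H m).map (Ideal.Quotient.mk (inducedIdeal K H n)) := by
    intro m
    induction m with
    | zero =>
      intro a _
      obtain ⟨f, rfl⟩ := Ideal.Quotient.mk_surjective a
      exact Ideal.mem_map_of_mem _ (by simp [inducedIdeal_zero])
    | succ m ih =>
      rw [Ideal.IsTwoSided.pow_succ, Ideal.mul_le]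
      intro r hr s hs
      obtain ⟨f, hf, rfl⟩ := mem_inducedNil.1 hr
      obtain ⟨g, hg, rfl⟩ := (Ideal.mem_map_iff_of_surjective _ Ideal.Quotient.mk_surjective).1
        (ih hs)
      exact Ideal.mem_map_of_mem (Ideal.Quotient.mk _) (inducedIdeal_mul_mem K H hf hg)
  rw [eq_bot_iff]
  refine (h n).trans ?_
  rw [Ideal.map_le_iff_le_comap]
  intro f hf
  rw [Ideal.mem_comap, Submodule.mem_bot]
  exact Ideal.Quotient.eq_zero_iff_mem.2 hf

/-- The group elements as units. -/
def groupUnit (n : ℕ) : G →* (InducedQuotient K H n)ˣ :=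
  (Units.map (Ideal.Quotient.mk (inducedIdeal K H n) : MonoidAlgebra K G →* _)).comp
    ((Units.map (MonoidAlgebra.of K G)).comp toUnits.toMonoidHom)

/-- The homomorphism from the group algebra of `H`. -/
def subgroupQuotient (n : ℕ) : MonoidAlgebra K H →ₐ[K] InducedQuotient K H n :=
  (Ideal.Quotient.mkₐ K (inducedIdeal K H n)).comp (subgroupAlgHom K H)

theorem subgroupQuotient_of (n : ℕ) (h : H) :
    subgroupQuotient K H n (.of K H h) = groupUnit K H n (h : G) := by
  rw [subgroupQuotient, AlgHom.comp_apply, MonoidAlgebra.of_apply, subgroupAlgHom_single]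
  rfl

theorem mem_of_subgroupQuotient_eq_zero {n : ℕ} {a : MonoidAlgebra K H}
    (ha : subgroupQuotient K H n a = 0) : a ∈ augIdeal K H ^ n :=
  mem_of_subgroupAlgHom_mem K H (Ideal.Quotient.eq_zero_iff_mem.1 ha)

theorem groupUnit_mem (n : ℕ) (h : H) :
    groupUnit K H n (h : G) ∈ unipotentSubgroup (inducedNil K H n) := by
  rw [mem_unipotentSubgroup, ← subgroupQuotient_of, ← map_one (subgroupQuotient K H n), ← map_sub]
  refine mem_inducedNil.2 ⟨_, Ideal.mem_map_of_mem _ ?_, rfl⟩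
  rw [Submodule.pow_one, RingHom.mem_ker]
  simp

end Induced

end

noncomputable section

/-! Closure of `GT(K)` under the group law. -/

section Braid

theorem braidGen_braid₁₂ :
    braidGen 0 * braidGen 1 * braidGen 0 = braidGen 1 * braidGen 0 * braidGen 1 := by
  have := PresentedGroup.one_of_mem (rels := braidRels)
    (x := FreeGroup.of 0 * FreeGroup.of 1 * FreeGroup.of 0 *
      (FreeGroup.of 1 * FreeGroup.of 0 * FreeGroup.of 1)⁻¹) (by simp [braidRels])
  simp only [map_mul, map_inv, mul_inv_eq_one] at this
  exact this

theorem braidGen_braid₂₃ :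
    braidGen 1 * braidGen 2 * braidGen 1 = braidGen 2 * braidGen 1 * braidGen 2 := by
  have := PresentedGroup.one_of_mem (rels := braidRels)
    (x := FreeGroup.of 1 * FreeGroup.of 2 * FreeGroup.of 1 *
      (FreeGroup.of 2 * FreeGroup.of 1 * FreeGroup.of 2)⁻¹) (by simp [braidRels])
  simp only [map_mul, map_inv, mul_inv_eq_one] at this
  exact this

theorem braidGen_comm : Commute (braidGen 0) (braidGen 2) := by
  have := PresentedGroup.one_of_mem (rels := braidRels)
    (x := FreeGroup.of 0 * FreeGroup.of 2 * (FreeGroup.of 2 * FreeGroup.of 0)⁻¹)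
    (by simp [braidRels])
  simp only [map_mul, map_inv, mul_inv_eq_one] at this
  exact this

/-- Brings products of the standard pure braid generators into the form `t s² t` used in `Pentagon`.
-/
theorem inv_mul_mul_mul_of_braid {G : Type*} [Group G] {s t : G} (h : s * t * s = t * s * t) :
    s⁻¹ * t ^ 2 * s * t ^ 2 = t * (s * s) * t := by
  have h2 : s⁻¹ * t * (t * s * t) = t * (s * s) := by
    calc s⁻¹ * t * (t * s * t) = s⁻¹ * (t * (s * t * s)) := by rw [h, mul_assoc]
      _ = s⁻¹ * (t * s * t) * s := by simp only [mul_assoc]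
      _ = t * (s * s) := by rw [← h]; group
  calc s⁻¹ * t ^ 2 * s * t ^ 2 = s⁻¹ * t * (t * s * t) * t := by simp only [sq, mul_assoc]
    _ = _ := by rw [h2]

theorem sq_mul_inv_mul_mul {G : Type*} [Group G] (s t : G) :
    s ^ 2 * (s⁻¹ * t ^ 2 * s) = s * (t * t) * s := by
  simp only [sq, mul_assoc, mul_inv_cancel_left]

theorem coe_pb23_mul_pb24 : ((pb23 * pb24 : PureBraid4) : BraidGroup4) =
    braidGen 1 * (braidGen 2 * braidGen 2) * braidGen 1 :=
  sq_mul_inv_mul_mul _ _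

theorem coe_pb13_mul_pb23 : ((pb13 * pb23 : PureBraid4) : BraidGroup4) =
    braidGen 1 * (braidGen 0 * braidGen 0) * braidGen 1 :=
  inv_mul_mul_mul_of_braid braidGen_braid₁₂

theorem coe_pb12_mul_pb13 : ((pb12 * pb13 : PureBraid4) : BraidGroup4) =
    braidGen 0 * (braidGen 1 * braidGen 1) * braidGen 0 :=
  sq_mul_inv_mul_mul _ _

theorem coe_pb24_mul_pb34 : ((pb24 * pb34 : PureBraid4) : BraidGroup4) =
    braidGen 2 * (braidGen 1 * braidGen 1) * braidGen 2 :=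
  inv_mul_mul_mul_of_braid braidGen_braid₂₃

theorem coe_pb12 : (pb12 : BraidGroup4) = braidGen 0 * braidGen 0 := sq _

theorem coe_pb23 : (pb23 : BraidGroup4) = braidGen 1 * braidGen 1 := sq _

theorem coe_pb34 : (pb34 : BraidGroup4) = braidGen 2 * braidGen 2 := sq _

end Braid

/-! ### Representations of the braid group with unipotent pure braids, and their twists. -/

section Representation

variable {K A : Type*} [Field K] [CharZero K] [Ring A] [Algebra K A] {N : Ideal A} [N.IsTwoSided]
  {n : ℕ} (hN : N ^ n = ⊥)

variable (K) in
/-- The homomorphism from the group algebra of `PB₄` given by a representation of `B₄`. -/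
def pbLift (ρ : BraidGroup4 →* Aˣ) : MonoidAlgebra K PureBraid4 →ₐ[K] A :=
  MonoidAlgebra.lift K A PureBraid4 ((Units.coeHom A).comp (ρ.comp braidPerm.ker.subtype))

omit [CharZero K] in
theorem pbLift_of (ρ : BraidGroup4 →* Aˣ) (g : PureBraid4) :
    pbLift K ρ (.of K PureBraid4 g) = ρ (g : BraidGroup4) := by
  simp [pbLift]

variable {ρ : BraidGroup4 →* Aˣ} (hρ : ∀ g : PureBraid4, ρ (g : BraidGroup4) ∈ unipotentSubgroup N)

include hρ

omit [CharZero K] in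
theorem pbLift_pbEval {f : NCSeries K} (hf : f [] = 1) (g h : PureBraid4) :
    pbLift K ρ (pbEval n f g h) = evalUnit hN hf (ρ (g : BraidGroup4)) (ρ (h : BraidGroup4)) := by
  rw [pbEval, map_truncEval, map_truncLog, map_truncLog, pbLift_of, pbLift_of,
    evalUnit_val hN hf (hρ g) (hρ h)]

omit [CharZero K] in
/-- The two sides of the pentagon relation have the same image if and only if the corresponding
relation between units holds. -/
theorem pbLift_pentagon_iff {f : NCSeries K} (hf : f [] = 1) :
    pbLift K ρ (pbEval n f pb12 (pb23 * pb24) * pbEval n f (pb13 * pb23) pb34 -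
      pbEval n f pb23 pb34 * pbEval n f (pb12 * pb13) (pb24 * pb34) * pbEval n f pb12 pb23) = 0 ↔
    UnipotentPower.Pentagon (evalUnit hN hf) (ρ (braidGen 0)) (ρ (braidGen 1))
      (ρ (braidGen 2)) := by
  rw [map_sub, sub_eq_zero, UnipotentPower.Pentagon, ← Units.val_inj]
  simp only [map_mul, pbLift_pbEval hN hρ hf, coe_pb12, coe_pb23, coe_pb34, coe_pb12_mul_pb13,
    coe_pb13_mul_pb23, coe_pb23_mul_pb24, coe_pb24_mul_pb34, Units.val_mul]

omit [CharZero K] in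
theorem pbLift_eq_zero (hN : N ^ n = ⊥) {a : MonoidAlgebra K PureBraid4} (ha : a ∈ pbIdeal K ^ n) :
    pbLift K ρ a = 0 := by
  have h := Ideal.map_pow_mem (pbLift K ρ) (I := augIdeal K braidPerm.ker) (J := N) (fun x hx =>
    lift_mem_of_mem_augIdeal (pbLift K ρ) (fun g => by rw [pbLift_of]; exact hρ g) hx) ha
  rwa [hN, Submodule.mem_bot] at h

omit [CharZero K] in
theorem pentagon_of_mem_GT {g : K × NCSeries K} (hg : g ∈ GT K) :
    UnipotentPower.Pentagon (evalUnit hN hg.2.1.1) (ρ (braidGen 0)) (ρ (braidGen 1))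
      (ρ (braidGen 2)) :=
  (pbLift_pentagon_iff hN hρ hg.2.1.1).1 (pbLift_eq_zero hρ hN (hg.2.2.2.2 n))

theorem isBraidTriple : (nilpotentPower K hN).IsBraidTriple (ρ (braidGen 0)) (ρ (braidGen 1))
    (ρ (braidGen 2)) where
  braid₁₂ := by simp only [← map_mul, braidGen_braid₁₂]
  braid₂₃ := by simp only [← map_mul, braidGen_braid₂₃]
  comm := braidGen_comm.map ρ
  mem₁ := by rw [← map_mul, ← coe_pb12]; exact hρ pb12
  mem₂ := by rw [← map_mul, ← coe_pb23]; exact hρ pb23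
  mem₃ := by rw [← map_mul, ← coe_pb34]; exact hρ pb34

/-- An element of `GT(K)` twists representations of the braid group. -/
theorem exists_twist {lam : K} {f : NCSeries K} (hg : (lam, f) ∈ GT K) :
    ∃ ρ' : BraidGroup4 →* Aˣ, (∀ g : PureBraid4, ρ' (g : BraidGroup4) ∈ unipotentSubgroup N) ∧
      ρ' (braidGen 0) = (nilpotentPower K hN).image₁ lam (evalUnit hN hg.2.1.1)
        (ρ (braidGen 0)) (ρ (braidGen 1)) (ρ (braidGen 2)) ∧
      ρ' (braidGen 1) = (nilpotentPower K hN).image₂ lam (evalUnit hN hg.2.1.1)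
        (ρ (braidGen 1)) (ρ (braidGen 2)) ∧
      ρ' (braidGen 2) = (nilpotentPower K hN).halfPow lam (ρ (braidGen 2)) := by
  have hs := isBraidTriple (K := K) hN hρ
  have hF := isGTPair_of_mem_GT hN hg
  have hp := pentagon_of_mem_GT hN hρ hg
  set P := nilpotentPower K hN with hP
  set F := evalUnit hN hg.2.1.1 with hF'
  set s₁ := ρ (braidGen 0) with h₁
  set s₂ := ρ (braidGen 1) with h₂
  set s₃ := ρ (braidGen 2) with h₃
  let T : Fin 3 → Aˣ := ![P.image₁ lam F s₁ s₂ s₃, P.image₂ lam F s₂ s₃, P.halfPow lam s₃]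
  have hT : ∀ r ∈ braidRels, FreeGroup.lift T r = 1 := by
    intro r hr
    simp only [braidRels, Set.mem_insert_iff, Set.mem_singleton_iff] at hr
    rcases hr with rfl | rfl | rfl <;>
      simp only [map_mul, map_inv, FreeGroup.lift_apply_of, mul_inv_eq_one]
    · exact UnipotentPower.image_braid₁₂ hs hF hp
    · exact UnipotentPower.image_braid₂₃ hs hF
    · exact UnipotentPower.image_comm hs hF
  let ρ' : BraidGroup4 →* Aˣ := PresentedGroup.toGroup hT
  have hg' : ∀ i, ρ' (braidGen i) = T i := fun i => PresentedGroup.toGroup.of hT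
  refine ⟨ρ', fun g => ?_, hg' 0, hg' 1, hg' 2⟩
  let U := unipotentSubgroup N
  have hU : U.Normal := P.normal
  have hmk : ∀ {a}, a ∈ U → QuotientGroup.mk' U a = 1 := fun h =>
    (QuotientGroup.eq_one_iff _).2 h
  have hhalf : ∀ {s}, s * s ∈ U → QuotientGroup.mk' U (P.halfPow lam s) =
      QuotientGroup.mk' U s := fun {s} h => by
    rw [UnipotentPower.halfPow, map_mul, hmk (P.pow_mem h _), mul_one]
  -- Modulo unipotent elements the twist does not change the generators, so pure braids still act
  -- unipotently.
  have hEq : (QuotientGroup.mk' U).comp ρ' = (QuotientGroup.mk' U).comp ρ := by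
    refine PresentedGroup.ext fun i => ?_
    change QuotientGroup.mk' U (ρ' (braidGen i)) = QuotientGroup.mk' U (ρ (braidGen i))
    rw [hg']
    fin_cases i
    · change QuotientGroup.mk' U (P.image₁ lam F s₁ s₂ s₃) = QuotientGroup.mk' U s₁
      rw [UnipotentPower.image₁, map_mul, map_mul, map_inv, hhalf hs.mem₁,
        hmk (hF.mem hs.mem₁ (UnipotentPower.sandwich_mem hs.mem₂ hs.mem₃))]
      simp
    · change QuotientGroup.mk' U (P.image₂ lam F s₂ s₃) = QuotientGroup.mk' U s₂
      rw [UnipotentPower.image₂, map_mul, map_mul, map_inv, hhalf hs.mem₂,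
        hmk (hF.mem hs.mem₂ hs.mem₃)]
      simp
    · exact hhalf hs.mem₃
  have h := DFunLike.congr_fun hEq (g : BraidGroup4)
  change QuotientGroup.mk' U (ρ' g) = QuotientGroup.mk' U (ρ g) at h
  rw [hmk (hρ g)] at h
  exact (QuotientGroup.eq_one_iff _).1 h

/-- The representation is twisted by `g₂`, and the pentagon of `g₁` is used in the twisted
representation. -/
theorem pentagon_gtMul {g₁ g₂ : K × NCSeries K} (h₁ : g₁ ∈ GT K) (h₂ : g₂ ∈ GT K) :
    UnipotentPower.Pentagon (evalUnit hN (gtMul_apply_nil h₁.2.1.1 h₂.2.1.1)) (ρ (braidGen 0))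
      (ρ (braidGen 1)) (ρ (braidGen 2)) := by
  obtain ⟨ρ', hρ', e₁, e₂, e₃⟩ := exists_twist hN hρ (lam := g₂.1) (f := g₂.2) h₂
  have hp := pentagon_of_mem_GT hN hρ' h₁
  rw [e₁, e₂, e₃] at hp
  have hs := isBraidTriple (K := K) hN hρ
  have h := UnipotentPower.comp_pentagon hs (isGTPair_of_mem_GT hN (lam := g₂.1) (f := g₂.2) h₂)
    (pentagon_of_mem_GT hN hρ h₂) (isGTPair_of_mem_GT hN (lam := g₁.1) (f := g₁.2) h₁) hp
  have m₁ := hs.mem₁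
  have m₂ := hs.mem₂
  have m₃ := hs.mem₃
  have m₁₂ := UnipotentPower.sandwich_mem m₁ m₂
  have m₂₁ := UnipotentPower.sandwich_mem m₂ m₁
  have m₂₃ := UnipotentPower.sandwich_mem m₂ m₃
  have m₃₂ := UnipotentPower.sandwich_mem m₃ m₂
  unfold UnipotentPower.Pentagon
  rw [evalUnit_gtMul hN h₁.2.1.1 h₂.2.1.1 m₁ m₂₃, evalUnit_gtMul hN h₁.2.1.1 h₂.2.1.1 m₂₁ m₃,
    evalUnit_gtMul hN h₁.2.1.1 h₂.2.1.1 m₂ m₃, evalUnit_gtMul hN h₁.2.1.1 h₂.2.1.1 m₁₂ m₃₂,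
    evalUnit_gtMul hN h₁.2.1.1 h₂.2.1.1 m₁ m₂]
  exact h

end Representation

/-! ### Products and powers of elements of `GT(K)`. -/

section Closure

variable {K : Type*} [Field K] [CharZero K]

/-- The pentagon modulo the `n`-th power of the augmentation ideal is tested in the action of `B₄`
on the quotient of its own group algebra by the induced ideal, which is faithful on the relevant
quotient for `PB₄`. -/
theorem gtMul_mem_GT {g₁ g₂ : K × NCSeries K} (h₁ : g₁ ∈ GT K) (h₂ : g₂ ∈ GT K) :
    gtMul g₁ g₂ ∈ GT K := by
  refine ⟨mul_ne_zero h₁.1 h₂.1, isGroupLike_gtMul h₁ h₂, gtMul_duality h₁ h₂,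
    gtMul_hexagon h₁ h₂, fun n => ?_⟩
  have hN := inducedNil_pow K braidPerm.ker n
  have hρ := groupUnit_mem K braidPerm.ker n
  have h := (pbLift_pentagon_iff (K := K) hN hρ (gtMul_apply_nil h₁.2.1.1 h₂.2.1.1)).2
    (pentagon_gtMul hN hρ h₁ h₂)
  have hq : pbLift K (groupUnit K braidPerm.ker n) = subgroupQuotient K braidPerm.ker n := by
    refine MonoidAlgebra.algHom_ext (fun g => ?_) (Subsingleton.elim _ _)
    have e := (pbLift_of (K := K) (groupUnit K braidPerm.ker n) g).trans
      (subgroupQuotient_of K braidPerm.ker n g).symm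
    exact e
  rw [hq] at h
  exact mem_of_subgroupQuotient_eq_zero K braidPerm.ker h

/-- Only positive powers occur, so membership of the unit in `GT(K)` plays no role. -/
theorem gtPow_succ_mem_GT {g : K × NCSeries K} (hg : g ∈ GT K) (h1 : gtMul (1, 1) g = g) (n : ℕ) :
    gtPow g (n + 1) ∈ GT K := by
  induction n with
  | zero => rwa [gtPow, gtPow, h1]
  | succ n ih => exact gtMul_mem_GT ih hg

end Closure

end

noncomputable section

/-! Friedrichs' criterion. -/

namespace NCSeries

section Dynkin

variable {A : Type*} [Ring A] (a b : A)

/-- The antipode of a word: the reversed word with the sign `(-1)ⁿ`. -/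
def antipodeWord : List (Fin 2) → A
  | [] => 1
  | i :: w => -(antipodeWord w * ![a, b] i)

/-- The antipode is the convolution inverse of the identity. Adding a letter produces a commutator
with the previous value, a scalar, so everything beyond the empty word cancels. -/
theorem sum_unshuffles_antipode (w : List (Fin 2)) :
    ((unshuffles w).map (fun p => wordProd a b p.1 * antipodeWord a b p.2)).sum =
      if w = [] then 1 else 0 := by
  induction w with
  | nil => simp [unshuffles, antipodeWord]
  | cons i w ih =>
    have h : ((unshuffles (i :: w)).map (fun p => wordProd a b p.1 * antipodeWord a b p.2)).sum =
        ![a, b] i * ((unshuffles w).map (fun p => wordProd a b p.1 * antipodeWord a b p.2)).sum -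
        ((unshuffles w).map (fun p => wordProd a b p.1 * antipodeWord a b p.2)).sum *
          ![a, b] i := by
      rw [unshuffles, List.map_append, List.sum_append, List.map_map, List.map_map]
      induction unshuffles w with
      | nil => simp
      | cons p l ih =>
        simp only [List.map_cons, List.sum_cons, Function.comp_apply, wordProd_cons,
          antipodeWord] at ih ⊢
        rw [add_add_add_comm, ih]
        noncomm_ring
    rw [h, ih]
    by_cases hw : w = [] <;> simp [hw]

/-- `D(w) = ∑ |u| u S(v)`, the sum over the unshuffles `(u, v)` of `w`. -/
def dynkin (w : List (Fin 2)) : A :=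
  ((unshuffles w).map (fun p => p.1.length • (wordProd a b p.1 * antipodeWord a b p.2))).sum

/-- A letter sent to the left factor raises the weight by one; the surplus is the convolution of
`sum_unshuffles_antipode`, nonzero for the empty word only. Hence `dynkin` is an iterated bracket of
letters. -/
theorem dynkin_cons (i : Fin 2) (w : List (Fin 2)) :
    dynkin a b (i :: w) = ![a, b] i * dynkin a b w - dynkin a b w * ![a, b] i +
      if w = [] then ![a, b] i else 0 := by
  have h : (if w = [] then ![a, b] i else 0) = ![a, b] i * if w = [] then 1 else 0 := by
    split <;> simp
  rw [h, ← sum_unshuffles_antipode a b, dynkin, dynkin, unshuffles, List.map_append,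
    List.sum_append, List.map_map, List.map_map]
  induction unshuffles w with
  | nil => simp
  | cons p l ih =>
    simp only [List.map_cons, List.sum_cons, Function.comp_apply, wordProd_cons,
      antipodeWord, List.length_cons] at ih ⊢
    rw [add_add_add_comm, ih]
    simp only [succ_nsmul, mul_add, add_mul, mul_smul_comm, smul_mul_assoc, mul_neg, smul_neg,
      mul_assoc]
    abel

end Dynkin

variable {K : Type*} [Field K]

theorem dynkin_mem (w : List (Fin 2)) :
    dynkin (X K) (Y K) w ∈ LieSubalgebra.lieSpan K (NCSeries K) {X K, Y K} := by
  have hi : ∀ i : Fin 2, ![X K, Y K] i ∈ LieSubalgebra.lieSpan K (NCSeries K) {X K, Y K} :=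
    fun i => LieSubalgebra.subset_lieSpan (by fin_cases i <;> simp)
  induction w with
  | nil => simp [dynkin, unshuffles]
  | cons i w ih =>
    rw [dynkin_cons, ← Ring.lie_def]
    refine add_mem (LieSubalgebra.lie_mem _ (hi i) ih) ?_
    split
    · exact hi i
    · exact zero_mem _

theorem sum_smul_wordProd {f : NCSeries K} {k : ℕ} (hf : ∀ w, k ≤ w.length → f w = 0) :
    ∑ w ∈ wordsLT k, f w • wordProd (X K) (Y K) w = f := by
  ext v
  rw [sum_apply]
  simp only [smul_apply, wordProd_X_Y_apply]
  by_cases hv : v.length < k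
  · rw [Finset.sum_eq_single v]
    · simp
    · intro w _ hw; simp [hw.symm]
    · intro hv'; exact absurd (mem_wordsLT.2 hv) hv'
  · rw [hf v (by omega)]
    refine Finset.sum_eq_zero fun w hw => ?_
    have : v ≠ w := by
      rintro rfl
      exact hv (mem_wordsLT.1 hw)
    simp [this]

theorem coproduct_component (f : NCSeries K) (n : ℕ) (u v : List (Fin 2)) :
    coproduct (component n f) u v = if u.length + v.length = n then coproduct f u v else 0 := by
  have h : (shuffles u v).map (component n f) =
      (shuffles u v).map (fun w => if u.length + v.length = n then f w else 0) :=
    List.map_congr_left fun w hw => by rw [component, length_of_mem_shuffles hw]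
  rw [coproduct, h]
  split
  · rfl
  · simp

theorem coproduct_nil_right (f : NCSeries K) (u : List (Fin 2)) : coproduct f u [] = f u := by
  rw [coproduct, shuffles_nil_right]
  exact add_zero _

/-- Friedrichs' criterion: primitive series are Lie series. -/
theorem isLieSeries_of_coproduct_eq_zero [CharZero K] {f : NCSeries K} (h0 : f [] = 0)
    (h : ∀ u v, u ≠ [] → v ≠ [] → coproduct f u v = 0) : f.IsLieSeries := by
  intro n
  rcases Nat.eq_zero_or_pos n with rfl | hn
  · have : component 0 f = 0 := by
      ext w
      rw [component]
      split
      · rename_i hw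
        rw [List.length_eq_zero_iff.1 hw, h0, zero_apply]
      · rfl
    rw [this]
    exact zero_mem _
  · have e1 := sum_unshuffles (n + 1) (component n f) fun u v =>
      u.length • (wordProd (X K) (Y K) u * antipodeWord (X K) (Y K) v)
    -- For a primitive series only pairs with an empty word survive, and the weight `u.length`
    -- removes those with `u` empty. What remains is `n` times the component, so this component is
    -- `1 / n` times a combination of brackets.
    have e2 : ∑ u ∈ wordsLT (n + 1), ∑ v ∈ wordsLT (n + 1),
        (if u.length + v.length < n + 1 then coproduct (component n f) u v •
          (u.length • (wordProd (X K) (Y K) u * antipodeWord (X K) (Y K) v)) else 0) =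
        n • component n f := by
      rw [← sum_smul_wordProd (f := n • component n f) (k := n + 1) fun w hw => by
        change n • component n f w = 0
        rw [component, if_neg (by omega), smul_zero]]
      refine Finset.sum_congr rfl fun u hu => ?_
      rw [Finset.sum_eq_single []]
      · have hu' := mem_wordsLT.1 hu
        rw [if_pos (by simpa using hu'), coproduct_nil_right, antipodeWord, mul_one]
        change _ = (n • component n f u) • _
        by_cases hun : u.length = n
        · rw [hun, smul_comm, smul_assoc]
        · rw [component, if_neg hun, zero_smul, smul_zero, zero_smul]
      · intro v _ hv
        rcases eq_or_ne u [] with rfl | hu'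
        · simp
        · rw [coproduct_component, h u v hu' hv]
          simp
      · intro h; exact absurd (mem_wordsLT.2 (by simp)) h
    rw [e2] at e1
    have e3 : component n f = ((n : K)⁻¹) • ∑ w ∈ wordsLT (n + 1),
        component n f w • dynkin (X K) (Y K) w := by
      have : (n : K) ≠ 0 := Nat.cast_ne_zero.2 (by omega)
      change _ = ((n : K)⁻¹) • ∑ w ∈ wordsLT (n + 1), component n f w • List.sum _
      rw [e1, ← Nat.cast_smul_eq_nsmul K, smul_smul, inv_mul_cancel₀ this, one_smul]
    rw [e3]
    exact (LieSubalgebra.lieSpan K (NCSeries K) {X K, Y K}).smul_mem _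
      (sum_mem fun w _ => (LieSubalgebra.lieSpan K (NCSeries K) {X K, Y K}).smul_mem _
        (dynkin_mem w))

end NCSeries

end

noncomputable section

open Filter Topology

/-! Tangent vectors of `GT(K)` at the unit belong to `gt(K)`. -/

section Limit

variable {K A : Type*} [Field K] [TopologicalSpace K] [Ring A] [Algebra K A]

/-- A notion of convergence of sequences in an algebra which is compatible with the operations. -/
structure IsLimitNotion (C : (ℕ → A) → A → Prop) : Prop where
  add : ∀ {a b : ℕ → A} {x y : A}, C a x → C b y → C (fun k => a k + b k) (x + y)
  mul : ∀ {a b : ℕ → A} {x y : A}, C a x → C b y → C (fun k => a k * b k) (x * y)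
  smul : ∀ {c : ℕ → K} {d : K} {a : ℕ → A} {x : A}, Tendsto c atTop (𝓝 d) → C a x →
    C (fun k => c k • a k) (d • x)

/-- The sequence `u` equals `1 + ε a` up to higher order terms in `ε`. -/
def HasTangent (C : (ℕ → A) → A → Prop) (ε : ℕ → K) (u : ℕ → A) (a : A) : Prop :=
  ∃ b : ℕ → A, C b a ∧ ∀ k, u k = 1 + ε k • b k

/-- The cross term carries an additional factor `ε` and disappears in the limit, so tangents of
products add. -/
theorem HasTangent.mul {C : (ℕ → A) → A → Prop} (hC : IsLimitNotion (K := K) C) {ε : ℕ → K}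
    (hε : Tendsto ε atTop (𝓝 0)) {u v : ℕ → A} {a b : A} (hu : HasTangent C ε u a)
    (hv : HasTangent C ε v b) : HasTangent C ε (fun k => u k * v k) (a + b) := by
  obtain ⟨a', ha, hu⟩ := hu
  obtain ⟨b', hb, hv⟩ := hv
  refine ⟨fun k => a' k + b' k + ε k • (a' k * b' k), ?_, fun k => ?_⟩
  · have := hC.add (hC.add ha hb) (hC.smul hε (hC.mul ha hb))
    rwa [zero_smul, add_zero] at this
  · beta_reduce
    rw [hu, hv, mul_add, mul_one, add_mul, one_mul, smul_mul_smul_comm, smul_add, smul_add,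
      smul_smul]
    abel

/-- Convergence of sequences which are finite linear combinations of fixed elements. -/
def FiniteLimit (K : Type*) {A : Type*} [Field K] [TopologicalSpace K] [Ring A] [Algebra K A]
    (a : ℕ → A) (x : A) : Prop :=
  ∃ (ι : Type) (_ : Fintype ι) (m : ι → A) (c : ℕ → ι → K) (d : ι → K),
    (∀ k, a k = ∑ i, c k i • m i) ∧ x = ∑ i, d i • m i ∧
      ∀ i, Tendsto (fun k => c k i) atTop (𝓝 (d i))

theorem FiniteLimit.isLimitNotion [IsTopologicalRing K] :
    IsLimitNotion (K := K) (A := A) (FiniteLimit K) where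
  add := by
    rintro a b x y ⟨ι, _, m, c, d, h1, h2, h3⟩ ⟨κ, _, m', c', d', h1', h2', h3'⟩
    refine ⟨ι ⊕ κ, inferInstance, Sum.elim m m', fun k => Sum.elim (c k) (c' k), Sum.elim d d',
      fun k => ?_, ?_, ?_⟩
    · beta_reduce
      rw [h1, h1', Fintype.sum_sum_type]; rfl
    · rw [h2, h2', Fintype.sum_sum_type]; rfl
    · rintro (i | i)
      · exact h3 i
      · exact h3' i
  mul := by
    rintro a b x y ⟨ι, _, m, c, d, h1, h2, h3⟩ ⟨κ, _, m', c', d', h1', h2', h3'⟩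
    refine ⟨ι × κ, inferInstance, fun p => m p.1 * m' p.2, fun k p => c k p.1 * c' k p.2,
      fun p => d p.1 * d' p.2, fun k => ?_, ?_, fun p => (h3 p.1).mul (h3' p.2)⟩
    · beta_reduce
      rw [h1, h1', Finset.sum_mul_sum, Fintype.sum_prod_type]
      simp only [smul_mul_smul_comm]
    · rw [h2, h2', Finset.sum_mul_sum, Fintype.sum_prod_type]
      simp only [smul_mul_smul_comm]
  smul := by
    rintro e f a x he ⟨ι, _, m, c, d, h1, h2, h3⟩
    refine ⟨ι, inferInstance, m, fun k i => e k * c k i, fun i => f * d i, fun k => ?_, ?_,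
      fun i => he.mul (h3 i)⟩
    · beta_reduce
      rw [h1, Finset.smul_sum]
      simp only [smul_smul]
    · rw [h2, Finset.smul_sum]
      simp only [smul_smul]

/-- A point outside `W` is separated from it by a linear form vanishing on `W`, and such a form
passes to limits of coefficients. Thus neither a topology on the group algebra nor finite
codimension of the ideal is required. -/
theorem FiniteLimit.mem [IsTopologicalRing K] [T2Space K] {a : ℕ → A} {x : A}
    (h : FiniteLimit K a x) {W : Submodule K A} (hW : ∀ k, a k ∈ W) : x ∈ W := by
  obtain ⟨ι, _, m, c, d, h1, h2, h3⟩ := h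
  by_contra hx
  obtain ⟨l, hl, hlW⟩ := Submodule.exists_le_ker_of_notMem hx
  refine hl ?_
  have e1 : Tendsto (fun k => l (a k)) atTop (𝓝 (l x)) := by
    simp only [h1, h2, map_sum, map_smul, smul_eq_mul]
    exact tendsto_finsetSum _ fun i _ => (h3 i).mul_const _
  have e2 : ∀ k, l (a k) = 0 := fun k => hlW (hW k)
  simp only [e2] at e1
  exact tendsto_nhds_unique e1 tendsto_const_nhds

end Limit

namespace NCSeries

variable {K : Type*} [Field K] [TopologicalSpace K]

omit [Field K] in
theorem tendsto_iff {ι : Type*} {l : Filter ι} {f : ι → NCSeries K} {g : NCSeries K} :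
    Tendsto f l (𝓝 g) ↔ ∀ w, Tendsto (fun i => f i w) l (𝓝 (g w)) := tendsto_pi_nhds

instance [T2Space K] : T2Space (NCSeries K) := inferInstanceAs (T2Space (List (Fin 2) → K))

variable [IsTopologicalRing K]

theorem isLimitNotion :
    IsLimitNotion (K := K) (A := NCSeries K) (fun a x => Tendsto a atTop (𝓝 x)) where
  add := fun ha hb => tendsto_iff.2 fun w => (tendsto_iff.1 ha w).add (tendsto_iff.1 hb w)
  mul := fun ha hb => tendsto_iff.2 fun w => by
    simp only [mul_apply]
    exact tendsto_finsetSum _ fun i _ => (tendsto_iff.1 ha _).mul (tendsto_iff.1 hb _)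
  smul := fun hc ha => tendsto_iff.2 fun w => hc.mul (tendsto_iff.1 ha w)

theorem tendsto_subst {ι : Type*} {l : Filter ι} {f : ι → NCSeries K} {g : NCSeries K}
    (h : Tendsto f l (𝓝 g)) (a b : NCSeries K) :
    Tendsto (fun i => (f i).subst a b) l (𝓝 (g.subst a b)) := by
  refine tendsto_iff.2 fun w => ?_
  simp only [subst, truncEval_eq_sum, sum_apply, smul_apply]
  exact tendsto_finsetSum _ fun v _ => (tendsto_iff.1 h v).mul_const _

theorem tendsto_coproduct {ι : Type*} {l : Filter ι} {f : ι → NCSeries K} {g : NCSeries K}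
    (h : Tendsto f l (𝓝 g)) (u v : List (Fin 2)) :
    Tendsto (fun i => coproduct (f i) u v) l (𝓝 (coproduct g u v)) := by
  unfold coproduct
  induction shuffles u v with
  | nil => exact tendsto_const_nhds
  | cons w s ih => exact (tendsto_iff.1 h w).add ih

omit [TopologicalSpace K] [IsTopologicalRing K] in
theorem subst_one_add_smul (c : K) (f a b : NCSeries K) :
    (1 + c • f).subst a b = 1 + c • f.subst a b := by
  ext w
  rw [add_apply, smul_apply, subst, subst, truncEval_add, truncEval_smul, truncEval_one]
  rfl

omit [TopologicalSpace K] [IsTopologicalRing K] in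
theorem coproduct_one_add_smul (c : K) (f : NCSeries K) {u v : List (Fin 2)} (hu : u ≠ []) :
    coproduct (1 + c • f) u v = c * coproduct f u v := by
  have h : ∀ w ∈ shuffles u v, w ≠ [] := by
    rintro w hw rfl
    have := length_of_mem_shuffles hw
    have := List.length_pos_iff.2 hu
    simp only [List.length_nil] at *
    omega
  unfold coproduct
  revert h
  induction shuffles u v with
  | nil => intro _; exact (mul_zero c).symm
  | cons w s ih =>
    intro h
    have h1 : (1 + c • f) w = c * f w := by
      rw [add_apply, smul_apply, one_apply, if_neg (h w List.mem_cons_self), zero_add]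
    exact (congrArg₂ (· + ·) h1 (ih fun x hx => h x (List.mem_cons_of_mem _ hx))).trans
      (mul_add _ _ _).symm

variable {ε s : ℕ → K} {t : K} (h0 : ∀ k, ε k ≠ 0) (hε : Tendsto ε atTop (𝓝 0))
  (hs : Tendsto s atTop (𝓝 t))

theorem hasTangent_subst {ψ : ℕ → NCSeries K} {φ : NCSeries K} (hψ : Tendsto ψ atTop (𝓝 φ))
    (a b : NCSeries K) : HasTangent (fun a x => Tendsto a atTop (𝓝 x)) ε
      (fun k => (1 + ε k • ψ k).subst a b) (φ.subst a b) :=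
  ⟨_, tendsto_subst hψ a b, fun _ => subst_one_add_smul _ _ _ _⟩

include hε hs in
-- The exponent is `ε s / 2` times `z`; after division by `ε` only the linear term of the
-- exponential survives.
theorem hasTangent_exp {z : NCSeries K} (hz : z [] = 0) :
    HasTangent (fun a x => Tendsto a atTop (𝓝 x)) ε
      (fun k => (((1 + ε k * s k - 1) / 2) • z).exp) ((t / 2) • z) := by
  -- The exponential minus `1`, with one factor `ε` removed from each term: the linear term and the
  -- powers from the second on.
  let b : ℕ → NCSeries K := fun k w => (s k / 2) * z w +
    (if w = [] then 0 else ∑ j ∈ Finset.range (w.length - 1), (((j + 2).factorial : K)⁻¹) *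
      ((s k / 2) * (ε k * s k / 2) ^ (j + 1) * (z ^ (j + 2)) w))
  have hs2 : Tendsto (fun k => s k / 2) atTop (𝓝 (t / 2)) := hs.div_const 2
  refine ⟨b, tendsto_iff.2 fun w => ?_, fun k => ?_⟩
  · have h1 : Tendsto (fun k => b k w) atTop (𝓝 (t / 2 * z w + 0)) := by
      refine (hs2.mul_const _).add ?_
      split
      · exact tendsto_const_nhds
      · have h2 : Tendsto (fun k => ε k * s k / 2) atTop (𝓝 0) := by
          have := (hε.mul hs).div_const 2
          rwa [zero_mul, zero_div] at this
        have h3 : ∀ j ∈ Finset.range (w.length - 1), Tendsto (fun k => (((j + 2).factorial : K)⁻¹) *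
            ((s k / 2) * (ε k * s k / 2) ^ (j + 1) * (z ^ (j + 2)) w)) atTop (𝓝 0) := fun j _ => by
          have := ((hs2.mul (h2.pow (j + 1))).mul_const ((z ^ (j + 2)) w)).const_mul
            (((j + 2).factorial : K)⁻¹)
          rwa [zero_pow (by omega), mul_zero, zero_mul, mul_zero] at this
        have := tendsto_finsetSum _ h3
        rwa [Finset.sum_const_zero] at this
    rwa [add_zero] at h1
  · ext w
    have hc : (1 + ε k * s k - 1) / 2 = ε k * (s k / 2) := by ring
    beta_reduce
    rw [exp, truncExp, sum_apply, hc, add_apply, smul_apply]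
    rcases w with _ | ⟨a, w⟩
    · simp [b, hz]
    · have hb : b k (a :: w) = (s k / 2) * z (a :: w) + ∑ j ∈ Finset.range w.length,
          (((j + 2).factorial : K)⁻¹) *
            ((s k / 2) * (ε k * s k / 2) ^ (j + 1) * (z ^ (j + 2)) (a :: w)) := by
        simp [b]
      rw [hb, List.length_cons, Finset.sum_range_succ', Finset.sum_range_succ', mul_add,
        Finset.mul_sum]
      simp only [smul_pow, smul_apply, pow_zero, pow_one, zero_add, Nat.factorial_zero,
        Nat.factorial_one, Nat.cast_one, inv_one, one_mul]
      rw [add_comm _ ((1 : NCSeries K) (a :: w)), add_comm _ (ε k * (s k / 2) * z (a :: w)),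
        mul_assoc (ε k) (s k / 2)]
      congr 2
      refine Finset.sum_congr rfl fun j _ => ?_
      ring

include h0 hε in
-- Group-likeness of `1 + ε ψ` says that the reduced coproduct of `ψ` is `ε ψ ⊗ ψ`, which tends to
-- zero.
theorem coproduct_eq_zero_of_tangent [T2Space K] {ψ : ℕ → NCSeries K} {φ : NCSeries K}
    (hψ : Tendsto ψ atTop (𝓝 φ)) (hG : ∀ k, (1 + ε k • ψ k).IsGroupLike) :
    φ [] = 0 ∧ ∀ u v, u ≠ [] → v ≠ [] → coproduct φ u v = 0 := by
  constructor
  · have h1 : ∀ k, ψ k [] = 0 := fun k => by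
      have := (hG k).1
      rw [add_apply, smul_apply, one_apply, if_pos rfl, add_eq_left] at this
      exact (mul_eq_zero.1 this).resolve_left (h0 k)
    have h2 := tendsto_iff.1 hψ []
    simp only [h1] at h2
    exact tendsto_nhds_unique h2 tendsto_const_nhds
  · intro u v hu hv
    have h1 : ∀ k, coproduct (ψ k) u v = ε k * (ψ k u * ψ k v) := fun k => by
      have := (hG k).2 u v
      rw [coproduct_one_add_smul _ _ hu, add_apply, add_apply, smul_apply, smul_apply, one_apply,
        one_apply, if_neg hu, if_neg hv, zero_add, zero_add] at this
      refine mul_left_cancel₀ (h0 k) (this.trans ?_)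
      ring
    have h2 := tendsto_coproduct hψ u v
    simp only [h1] at h2
    have h3 := hε.mul ((tendsto_iff.1 hψ u).mul (tendsto_iff.1 hψ v))
    rw [zero_mul] at h3
    exact tendsto_nhds_unique h2 h3

end NCSeries

/-! ### Differentiating the relations of `GT(K)`. -/

section Tangent

variable {K : Type*} [Field K] [CharZero K] [TopologicalSpace K] [IsTopologicalRing K] [T2Space K]

omit [CharZero K] [IsTopologicalRing K] [T2Space K] in
theorem hasTangent_pbEval {ε : ℕ → K} {n : ℕ} (hn : 0 < n) {ψ : ℕ → NCSeries K} {φ : NCSeries K}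
    (hψ : Tendsto ψ atTop (𝓝 φ)) (g h : PureBraid4) :
    HasTangent (FiniteLimit K) ε (fun k => pbEval n (1 + ε k • ψ k) g h) (pbEval n φ g h) := by
  refine ⟨fun k => pbEval n (ψ k) g h, ⟨{w // w ∈ wordsLT n}, inferInstance, fun w => wordProd
    (truncLog K n (MonoidAlgebra.of K PureBraid4 g))
    (truncLog K n (MonoidAlgebra.of K PureBraid4 h)) w.1, fun k w => ψ k w.1, fun w => φ w.1,
    fun k => ?_, ?_, fun w => NCSeries.tendsto_iff.1 hψ w.1⟩, fun k => ?_⟩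
  · beta_reduce
    rw [pbEval, truncEval_eq_sum, ← Finset.sum_coe_sort]
  · rw [pbEval, truncEval_eq_sum, ← Finset.sum_coe_sort]
  · obtain ⟨n, rfl⟩ := Nat.exists_eq_add_of_le' hn
    beta_reduce
    rw [pbEval, truncEval_add, truncEval_smul, truncEval_one]
    rfl

/-- A limit of difference quotients of `GT(K)` at the unit belongs to `gt(K)`. -/
theorem mem_gtLie_of_tendsto {ε s : ℕ → K} {ψ : ℕ → NCSeries K} {t : K} {φ : NCSeries K}
    (h0 : ∀ k, ε k ≠ 0) (hε : Tendsto ε atTop (𝓝 0)) (hs : Tendsto s atTop (𝓝 t))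
    (hψ : Tendsto ψ atTop (𝓝 φ)) (hG : ∀ k, (1 + ε k * s k, 1 + ε k • ψ k) ∈ GT K) :
    (t, φ) ∈ gtLie K := by
  have hprim := NCSeries.coproduct_eq_zero_of_tangent h0 hε hψ fun k => (hG k).2.1
  have hC := NCSeries.isLimitNotion (K := K)
  -- Differentiation of a relation: a product identically `1` has tangent zero.
  have huniq : ∀ {u : ℕ → NCSeries K} {a : NCSeries K},
      HasTangent (fun a x => Tendsto a atTop (𝓝 x)) ε u a → (∀ k, u k = 1) → a = 0 := by
    rintro u a ⟨b, hb, hu⟩ h1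
    have hb0 : ∀ k, b k = 0 := fun k => by
      have h2 := hu k
      rw [h1, left_eq_add] at h2
      exact (smul_eq_zero_iff_right (h0 k)).1 h2
    simp only [funext hb0] at hb
    exact tendsto_nhds_unique hb tendsto_const_nhds
  have hid : HasTangent (fun a x => Tendsto a atTop (𝓝 x)) ε (fun k => 1 + ε k • ψ k) φ :=
    ⟨ψ, hψ, fun _ => rfl⟩
  have hz : (-NCSeries.ch K) [] = 0 :=
    NCSeries.mem_orderIdeal_one.1 (neg_mem NCSeries.ch_mem)
  refine ⟨NCSeries.isLieSeries_of_coproduct_eq_zero hprim.1 hprim.2, ?_, ?_, fun n => ?_⟩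
  · exact eq_neg_of_add_eq_zero_left
      (huniq (hid.mul hC hε (NCSeries.hasTangent_subst hψ _ _)) fun k => (hG k).2.2.1)
  · have h := huniq ((((((NCSeries.hasTangent_subst hψ _ _).mul hC hε
      (NCSeries.hasTangent_exp hε hs hz)).mul hC hε (NCSeries.hasTangent_subst hψ _ _)).mul hC hε
      (NCSeries.hasTangent_exp hε hs (z := NCSeries.Y K) rfl)).mul hC hε hid).mul hC hε
      (NCSeries.hasTangent_exp hε hs (z := NCSeries.X K) rfl)) fun k => (hG k).2.2.2.1
    rw [← h, smul_add, smul_add]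
    abel
  · rcases Nat.eq_zero_or_pos n with rfl | hn
    · exact mem_ideal_pow_zero _ _
    have hF := FiniteLimit.isLimitNotion (K := K) (A := MonoidAlgebra K PureBraid4)
    obtain ⟨a, ha, ha'⟩ := (hasTangent_pbEval (ε := ε) hn hψ pb12 (pb23 * pb24)).mul hF hε
      (hasTangent_pbEval hn hψ (pb13 * pb23) pb34)
    obtain ⟨b, hb, hb'⟩ := ((hasTangent_pbEval (ε := ε) hn hψ pb23 pb34).mul hF hε
      (hasTangent_pbEval hn hψ (pb12 * pb13) (pb24 * pb34))).mul hF hε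
      (hasTangent_pbEval hn hψ pb12 pb23)
    have hab := hF.add ha (hF.smul (tendsto_const_nhds (x := (-1 : K))) hb)
    have hmem : ∀ k, a k + (-1 : K) • b k ∈ (pbIdeal K ^ n).restrictScalars K := fun k => by
      have h1 := (hG k).2.2.2.2 n
      have h2 : ε k • (a k + (-1 : K) • b k) ∈ (pbIdeal K ^ n).restrictScalars K := by
        have : ε k • (a k + (-1 : K) • b k) = (1 + ε k • a k) - (1 + ε k • b k) := by
          rw [neg_one_smul, smul_add, smul_neg]; abel
        rw [this, ← ha', ← hb']
        exact h1
      have h3 := Submodule.smul_mem _ (ε k)⁻¹ h2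
      rwa [smul_smul, inv_mul_cancel₀ (h0 k), one_smul] at h3
    have h4 := hab.mem hmem
    rw [neg_one_smul, ← sub_eq_add_neg] at h4
    exact h4

end Tangent

end

noncomputable section

open Filter Topology

/-! Substitution as an algebra homomorphism. -/

namespace NCSeries

section Subst

variable {K : Type*} [Field K] {a b : NCSeries K} (ha : a ∈ orderIdeal K 1)
  (hb : b ∈ orderIdeal K 1)

theorem toTrunc_subst_eq_evalHom (f : NCSeries K) (n : ℕ) : toTrunc K n (f.subst a b) =
    evalHom (truncIdeal_pow n) (toTrunc_mem (n := n) ha) (toTrunc_mem (n := n) hb) f :=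
  toTrunc_subst ha hb f n

/-- Substitution of series without constant term. -/
def substHom : NCSeries K →ₐ[K] NCSeries K :=
  AlgHom.ofLinearMap
    { toFun := fun f => f.subst a b
      map_add' := fun f g => by
        ext w
        rw [add_apply, subst, truncEval_add]
        rfl
      map_smul' := fun c f => by
        ext w
        rw [RingHom.id_apply, smul_apply, subst, truncEval_smul]
        rfl }
    (by
      ext w
      change truncEval (w.length + 1) 1 a b w = _
      rw [truncEval_one])
    (fun f g => eq_of_toTrunc_eq fun n => by
      change toTrunc K n ((f * g).subst a b) = toTrunc K n (f.subst a b * g.subst a b)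
      rw [map_mul, toTrunc_subst_eq_evalHom ha hb, toTrunc_subst_eq_evalHom ha hb,
        toTrunc_subst_eq_evalHom ha hb, map_mul])

theorem substHom_apply (f : NCSeries K) : substHom ha hb f = f.subst a b := rfl

include ha hb

theorem X_subst : (X K).subst a b = a := eq_of_toTrunc_eq fun n => by
  rw [toTrunc_subst_eq_evalHom ha hb, evalHom_X]

theorem Y_subst : (Y K).subst a b = b := eq_of_toTrunc_eq fun n => by
  rw [toTrunc_subst_eq_evalHom ha hb, evalHom_Y]

omit ha hb in
theorem subst_mem {f : NCSeries K} (hf : f ∈ orderIdeal K 1) : f.subst a b ∈ orderIdeal K 1 :=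
  mem_orderIdeal_one.2 ((subst_apply_nil _ _ _).trans (mem_orderIdeal_one.1 hf))

theorem subst_subst {s t : NCSeries K} (hs : s ∈ orderIdeal K 1) (ht : t ∈ orderIdeal K 1)
    (f : NCSeries K) : (f.subst s t).subst a b = f.subst (s.subst a b) (t.subst a b) :=
  eq_of_toTrunc_eq fun n => by
    rw [toTrunc_subst_eq_evalHom ha hb, evalHom_subst _ _ _ hs ht,
      toTrunc_subst (subst_mem hs) (subst_mem ht), toTrunc_subst_eq_evalHom ha hb,
      toTrunc_subst_eq_evalHom ha hb]

theorem exp_subst {s : NCSeries K} (hs : s ∈ orderIdeal K 1) :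
    s.exp.subst a b = (s.subst a b).exp :=
  eq_of_toTrunc_eq fun n => by
    rw [toTrunc_subst_eq_evalHom ha hb, evalHom_exp _ _ _ hs, toTrunc_exp (subst_mem hs),
      toTrunc_subst_eq_evalHom ha hb]

theorem log_subst {u : NCSeries K} (hu : u - 1 ∈ orderIdeal K 1) :
    u.log.subst a b = (u.subst a b).log :=
  eq_of_toTrunc_eq fun n => by
    have : u.subst a b - 1 ∈ orderIdeal K 1 := by
      have := subst_mem (a := a) (b := b) hu
      rwa [← substHom_apply ha hb, map_sub, map_one] at this
    rw [toTrunc_subst_eq_evalHom ha hb, evalHom_log _ _ _ hu, toTrunc_log this,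
      toTrunc_subst_eq_evalHom ha hb]

omit ha hb in
theorem exp_sub_one_mem (a : NCSeries K) : a.exp - 1 ∈ orderIdeal K 1 := by
  rw [mem_orderIdeal_one, sub_apply, exp, truncExp]
  simp

variable [CharZero K]

omit hb in
theorem log_exp : a.exp.log = a := eq_of_toTrunc_eq fun n => by
  rw [toTrunc_log (exp_sub_one_mem a), toTrunc_exp ha,
    truncLog_truncExp (pow_eq_zero_of_mem (truncIdeal_pow n) (toTrunc_mem ha))]

omit ha hb [CharZero K] in
theorem log_mem (u : NCSeries K) : u.log ∈ orderIdeal K 1 := by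
  rw [mem_orderIdeal_one]
  simp [log, truncLog]

omit ha hb in
-- Identifies the binomial series at natural exponents with ordinary powers, the dense case in its
-- integrality.
theorem exp_nsmul_log {u : NCSeries K} (hu : u - 1 ∈ orderIdeal K 1) (m : ℕ) :
    ((m : K) • u.log).exp = u ^ m := eq_of_toTrunc_eq fun n => by
  have hN := truncIdeal_pow (K := K) n
  have hu' : toTrunc K n u - 1 ∈ truncIdeal K n := by
    rw [← map_one (toTrunc K n), ← map_sub]
    exact toTrunc_mem hu
  have hl : truncLog K n (toTrunc K n u) ∈ truncIdeal K n := truncLog_mem hu'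
  rw [toTrunc_exp (algebra_smul_mem _ (log_mem u)), map_smul, toTrunc_log hu, map_pow]
  induction m with
  | zero => rw [Nat.cast_zero, zero_smul, truncExp_zero hN, pow_zero]
  | succ m ih =>
    rw [Nat.cast_succ, add_smul, one_smul, truncExp_add hN (algebra_smul_mem _ hl) hl
      ((Commute.refl _).smul_left _), ih, truncExp_truncLog (pow_eq_zero_of_mem hN hu'), pow_succ]

omit hb [CharZero K] in
theorem conj_exp {f g : NCSeries K} (hfg : f * g = 1) (hgf : g * f = 1) :
    (f * a * g).exp = f * a.exp * g := eq_of_toTrunc_eq fun n => by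
  have h1 : f * a * g ∈ orderIdeal K 1 := Ideal.mul_mem_right _ _ (Ideal.mul_mem_left _ _ ha)
  let e : (Trunc K n)ˣ := ⟨toTrunc K n f, toTrunc K n g, by rw [← map_mul, hfg, map_one],
    by rw [← map_mul, hgf, map_one]⟩
  rw [toTrunc_exp h1, map_mul, map_mul, map_mul, map_mul, toTrunc_exp ha]
  exact (map_truncExp (conjAlgHom K e) n (toTrunc K n a)).symm

end Subst

/-! Series with integral coefficients. -/

section Integral

variable (p : ℕ) [Fact p.Prime]

/-- The ring `ℤ_p⟨⟨x, y⟩⟩`. -/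
def integralSeries : Subring (NCSeries ℚ_[p]) where
  carrier := {f | ∀ w, ‖f w‖ ≤ 1}
  mul_mem' := fun {f g} hf hg w => by
    rw [mul_apply]
    refine IsUltrametricDist.norm_sum_le_of_forall_le_of_nonneg zero_le_one fun i _ => ?_
    rw [norm_mul]
    exact mul_le_one₀ (hf _) (norm_nonneg _) (hg _)
  one_mem' := fun w => by
    rw [one_apply]
    split <;> simp
  add_mem' := fun {f g} hf hg w =>
    (IsUltrametricDist.norm_add_le_max _ _).trans (max_le (hf w) (hg w))
  zero_mem' := fun w => by simp
  neg_mem' := fun {f} hf w => by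
    rw [neg_apply, norm_neg]
    exact hf w

variable {p}

theorem X_mem_integralSeries : X ℚ_[p] ∈ integralSeries p := fun w => by
  rw [X]
  split <;> simp

theorem Y_mem_integralSeries : Y ℚ_[p] ∈ integralSeries p := fun w => by
  rw [Y]
  split <;> simp

theorem smul_mem_integralSeries {c : ℚ_[p]} (hc : ‖c‖ ≤ 1) {f : NCSeries ℚ_[p]}
    (hf : f ∈ integralSeries p) : c • f ∈ integralSeries p := fun w => by
  rw [smul_apply, norm_mul]
  exact mul_le_one₀ hc (norm_nonneg _) (hf w)

theorem wordProd_mem_integralSeries {a b : NCSeries ℚ_[p]} (ha : a ∈ integralSeries p)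
    (hb : b ∈ integralSeries p) (w : List (Fin 2)) : wordProd a b w ∈ integralSeries p := by
  induction w with
  | nil => exact one_mem _
  | cons i w ih =>
    rw [wordProd_cons]
    refine mul_mem ?_ ih
    fin_cases i
    · exact ha
    · exact hb

theorem subst_mem_integralSeries {f a b : NCSeries ℚ_[p]} (hf : f ∈ integralSeries p)
    (ha : a ∈ integralSeries p) (hb : b ∈ integralSeries p) : f.subst a b ∈ integralSeries p := by
  intro w
  rw [subst, truncEval_eq_sum]
  exact sum_mem (S := integralSeries p) (fun v _ => smul_mem_integralSeries (hf v)
    (wordProd_mem_integralSeries ha hb v)) w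

/-- The series `(1 + z) ^ t`. -/
def binomialSeries (z : NCSeries ℚ_[p]) (t : ℚ_[p]) : NCSeries ℚ_[p] := (t • (1 + z).log).exp

theorem continuous_binomialSeries (z : NCSeries ℚ_[p]) (w : List (Fin 2)) :
    Continuous fun t : ℚ_[p] => binomialSeries z t w := by
  simp only [binomialSeries, exp, truncExp, sum_apply, smul_apply, smul_pow]
  fun_prop

/-- For natural exponents this is a power of `1 + z`. Each coefficient is a polynomial in the
exponent, hence continuous, and the natural numbers are dense in the `p`-adic integers. -/
theorem binomialSeries_mem {z : NCSeries ℚ_[p]} (hz : z ∈ integralSeries p)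
    (hz0 : z ∈ orderIdeal ℚ_[p] 1) (t : ℤ_[p]) :
    binomialSeries z (t : ℚ_[p]) ∈ integralSeries p := by
  intro w
  have hclosed : IsClosed {t : ℤ_[p] | ‖binomialSeries z (t : ℚ_[p]) w‖ ≤ 1} :=
    isClosed_le ((continuous_binomialSeries z w).comp continuous_subtype_val).norm
      continuous_const
  refine PadicInt.denseRange_natCast.induction_on (p := fun t : ℤ_[p] =>
    ‖binomialSeries z (t : ℚ_[p]) w‖ ≤ 1) t hclosed fun m => ?_
  rw [PadicInt.coe_natCast, binomialSeries, exp_nsmul_log (by rwa [add_sub_cancel_left])]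
  exact pow_mem (add_mem (one_mem _) hz) m w

theorem binomialSeries_sub_one_mem (z : NCSeries ℚ_[p]) (t : ℚ_[p]) :
    binomialSeries z t - 1 ∈ orderIdeal ℚ_[p] 1 := exp_sub_one_mem _

theorem binomialSeries_subst {z a b : NCSeries ℚ_[p]} (hz0 : z ∈ orderIdeal ℚ_[p] 1)
    (ha : a ∈ orderIdeal ℚ_[p] 1) (hb : b ∈ orderIdeal ℚ_[p] 1) (t : ℚ_[p]) :
    (binomialSeries z t).subst a b = binomialSeries (z.subst a b) t := by
  have hz1 : (1 + z) - 1 ∈ orderIdeal ℚ_[p] 1 := by rwa [add_sub_cancel_left]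
  rw [binomialSeries, exp_subst ha hb (algebra_smul_mem _ (log_mem _)), ← substHom_apply ha hb,
    map_smul, substHom_apply, log_subst ha hb hz1, ← substHom_apply ha hb, map_add, map_one]
  rfl

theorem binomialSeries_exp_sub_one {a : NCSeries ℚ_[p]} (ha : a ∈ orderIdeal ℚ_[p] 1)
    (t : ℚ_[p]) : binomialSeries (a.exp - 1) t = (t • a).exp := by
  rw [binomialSeries, add_sub_cancel, log_exp ha]

/-- The part of degree one of `(1 + x) ^ t`. -/
theorem binomialSeries_apply_singleton (z : NCSeries ℚ_[p])
    (t : ℚ_[p]) (i : Fin 2) : binomialSeries z t [i] = t * z [i] := by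
  have h1 : ((1 + z).log) [i] = z [i] := by
    simp [log, truncLog]
  simp [binomialSeries, exp, truncExp, Finset.sum_range_succ, one_apply, h1]

end Integral

end NCSeries

end

noncomputable section

/-! Right multiplication in `GT` as a linear operator. -/

namespace NCSeries

section Operator

variable {K : Type*} [Field K]

/-- The operator `h ↦ h(a, b) f`. -/
def substMul {a b : NCSeries K} (ha : a ∈ orderIdeal K 1) (hb : b ∈ orderIdeal K 1)
    (f : NCSeries K) : Module.End K (NCSeries K) :=
  LinearMap.mulRight K f ∘ₗ (substHom ha hb).toLinearMap

theorem substMul_apply {a b : NCSeries K} (ha : a ∈ orderIdeal K 1) (hb : b ∈ orderIdeal K 1)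
    (f h : NCSeries K) : substMul ha hb f h = h.subst a b * f := rfl

end Operator

end NCSeries

theorem sub_one_pow_eq_sum {K B : Type*} [Field K] [Ring B] [Algebra K B] (x : B) (n : ℕ) :
    (x - 1) ^ n = ∑ k ∈ Finset.range (n + 1), ((-1 : K) ^ (n - k) * (n.choose k : K)) • x ^ k := by
  rw [sub_eq_add_neg, ((Commute.one_right x).neg_right).add_pow]
  refine Finset.sum_congr rfl fun k _ => ?_
  rw [Algebra.smul_def, map_mul, map_pow, map_neg, map_one, map_natCast, mul_assoc]
  exact (((Commute.neg_one_right (x ^ k)).pow_right _).mul_right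
    (Nat.cast_commute (n.choose k) (x ^ k)).symm).eq

theorem pow_eq_sum_sub_one_pow {B : Type*} [Ring B] (x : B) (n : ℕ) :
    x ^ n = ∑ k ∈ Finset.range (n + 1), n.choose k • (x - 1) ^ k := by
  conv_lhs => rw [← sub_add_cancel x 1, (Commute.one_right (x - 1)).add_pow]
  refine Finset.sum_congr rfl fun k _ => ?_
  rw [one_pow, mul_one, nsmul_eq_mul, (Nat.cast_commute _ _).eq]

section GT

open NCSeries

variable {K : Type*} [Field K]

/-- Right multiplication by `g` on the second components. -/
def gtRight (g : K × NCSeries K) : Module.End K (NCSeries K) :=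
  substMul (algebra_smul_mem g.1 (conj_mem_orderIdeal g.2)) (algebra_smul_mem g.1 Y_mem) g.2

theorem gtMul_eq (h g : K × NCSeries K) : gtMul h g = (h.1 * g.1, gtRight g h.2) := rfl

theorem gtPow_eq (g : K × NCSeries K) (n : ℕ) : gtPow g n = (g.1 ^ n, (gtRight g ^ n) 1) := by
  induction n with
  | zero => rw [gtPow, pow_zero, pow_zero, Module.End.one_apply]
  | succ n ih => rw [gtPow, ih, gtMul_eq, pow_succ, pow_succ' (gtRight g), Module.End.mul_apply]

/-- By linearity of the group law in its left factor, the formal binomial sum is a genuine power of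
an operator. Estimates can then be made one application at a time. -/
theorem gtSubOnePow_eq (g : K × NCSeries K) (n : ℕ) :
    gtSubOnePow g n = ((g.1 - 1) ^ n, ((gtRight g - 1) ^ n) 1) := by
  rw [sub_one_pow_eq_sum (K := K) g.1, sub_one_pow_eq_sum (K := K) (gtRight g), gtSubOnePow]
  simp only [gtPow_eq, LinearMap.sum_apply, LinearMap.smul_apply]
  refine Prod.ext ?_ ?_
  · simp only [Prod.fst_sum, Prod.smul_fst]
  · simp only [Prod.snd_sum, Prod.smul_snd]

end GT

namespace NCSeries

/-! The estimate for the powers of the operator `h ↦ h(a, b) f - h`. -/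

section Estimate

variable {K : Type*} [Field K] {a b f : NCSeries K} {lam : K}
  (ha : a ∈ orderIdeal K 1) (hb : b ∈ orderIdeal K 1) (hf : f - 1 ∈ orderIdeal K 1)
  (ha' : a - lam • X K ∈ orderIdeal K 2) (hb' : b - lam • Y K ∈ orderIdeal K 2)

include ha hb ha' hb' in
-- The operator is triangular for the filtration by order, with diagonal entry `λ` to the length of
-- the word.
theorem wordProd_sub_mem (v : List (Fin 2)) :
    wordProd a b v - lam ^ v.length • wordProd (X K) (Y K) v ∈ orderIdeal K (v.length + 1) := by
  induction v with
  | nil => simp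
  | cons i v ih =>
    have h1 : ![a, b] i - lam • ![X K, Y K] i ∈ orderIdeal K 2 := by
      fin_cases i
      · exact ha'
      · exact hb'
    have h2 : lam • ![X K, Y K] i ∈ orderIdeal K 1 := by
      refine algebra_smul_mem _ ?_
      fin_cases i
      · exact X_mem
      · exact Y_mem
    have e : wordProd a b (i :: v) - lam ^ (i :: v).length • wordProd (X K) (Y K) (i :: v) =
        (![a, b] i - lam • ![X K, Y K] i) * wordProd a b v +
          lam • ![X K, Y K] i * (wordProd a b v - lam ^ v.length • wordProd (X K) (Y K) v) := by
      rw [wordProd_cons, wordProd_cons, List.length_cons, pow_succ', sub_mul, mul_sub,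
        smul_mul_smul_comm]
      abel
    rw [e]
    refine add_mem ?_ ?_
    · have := mul_mem_orderIdeal h1 (wordProd_mem_orderIdeal ha hb v)
      rwa [add_comm 2] at this
    · have := mul_mem_orderIdeal h2 ih
      rwa [add_comm 1] at this

include ha hb hf ha' hb' in
theorem wordProd_mul_sub_mem (v : List (Fin 2)) :
    wordProd a b v * f - lam ^ v.length • wordProd (X K) (Y K) v ∈
      orderIdeal K (v.length + 1) := by
  have e : wordProd a b v * f - lam ^ v.length • wordProd (X K) (Y K) v =
      wordProd a b v * (f - 1) +
        (wordProd a b v - lam ^ v.length • wordProd (X K) (Y K) v) := by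
    rw [mul_sub, mul_one]
    abel
  rw [e]
  exact add_mem (mul_mem_orderIdeal (wordProd_mem_orderIdeal ha hb v) hf)
    (wordProd_sub_mem ha hb ha' hb' v)

theorem substMul_apply_word (c : NCSeries K) (w : List (Fin 2)) :
    substMul ha hb f c w = ∑ v ∈ wordsLT (w.length + 1), c v * (wordProd a b v * f) w := by
  have h : (c.subst a b - truncEval (w.length + 1) c a b) * f ∈ orderIdeal K (w.length + 1) :=
    Ideal.mul_mem_right _ _ (subst_sub_mem ha hb c _)
  have h1 := h w (Nat.lt_succ_self _)
  rw [sub_mul, sub_apply, sub_eq_zero] at h1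
  rw [substMul_apply, h1, truncEval_eq_sum, Finset.sum_mul, sum_apply]
  simp only [smul_mul_assoc, smul_apply]

theorem sum_wordsLT_ite (c : NCSeries K) (w : List (Fin 2)) :
    ∑ v ∈ wordsLT (w.length + 1), c v * (if w = v then 1 else 0) = c w := by
  rw [Finset.sum_eq_single w]
  · simp
  · intro v _ hv; simp [hv.symm]
  · intro h; exact absurd (mem_wordsLT.2 (Nat.lt_succ_self _)) h

end Estimate

section Norm

variable {p : ℕ} [Fact p.Prime] {a b f : NCSeries ℚ_[p]} {lam : ℚ_[p]} {r : ℝ}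
  (ha : a ∈ orderIdeal ℚ_[p] 1) (hb : b ∈ orderIdeal ℚ_[p] 1) (hf : f - 1 ∈ orderIdeal ℚ_[p] 1)
  (ha' : a - lam • X ℚ_[p] ∈ orderIdeal ℚ_[p] 2) (hb' : b - lam • Y ℚ_[p] ∈ orderIdeal ℚ_[p] 2)
  (ia : a ∈ integralSeries p) (ib : b ∈ integralSeries p) (ic : f ∈ integralSeries p)
  (hlam : ‖lam - 1‖ ≤ r) (hr : r ≤ 1)

include hlam hr

theorem norm_pow_sub_one_le (n : ℕ) : ‖lam ^ n - 1‖ ≤ r := by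
  have h1 : ‖lam‖ ≤ 1 := by
    have := IsUltrametricDist.norm_add_le_max (lam - 1) 1
    rw [sub_add_cancel, norm_one] at this
    exact this.trans (max_le (hlam.trans hr) le_rfl)
  induction n with
  | zero => simpa using (norm_nonneg _).trans hlam
  | succ n ih =>
    have e : lam ^ (n + 1) - 1 = (lam ^ n - 1) * lam + (lam - 1) := by ring
    rw [e]
    refine (IsUltrametricDist.norm_add_le_max _ _).trans (max_le ?_ hlam)
    rw [norm_mul]
    exact (mul_le_of_le_one_right (norm_nonneg _) h1).trans ih

include hf ha' hb' ia ib ic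

/-- Each application of the operator improves the divisibility of the coefficients. -/
theorem norm_substMul_sub_le {n : ℕ} {c : NCSeries ℚ_[p]}
    (hc : ∀ w, ‖c w‖ ≤ r ^ (n - w.length)) (w : List (Fin 2)) :
    ‖(substMul ha hb f - 1) c w‖ ≤ r ^ (n + 1 - w.length) := by
  have hr0 : 0 ≤ r := (norm_nonneg _).trans hlam
  rw [LinearMap.sub_apply, Module.End.one_apply, sub_apply, substMul_apply_word,
    ← sum_wordsLT_ite c w, ← Finset.sum_sub_distrib]
  refine IsUltrametricDist.norm_sum_le_of_forall_le_of_nonneg (pow_nonneg hr0 _) fun v hv => ?_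
  rw [← mul_sub, norm_mul]
  -- Off the diagonal, a contributing word is strictly shorter than `w`, so the old bound at it
  -- already has the larger exponent and integrality of the matrix entry suffices.
  rcases (Nat.lt_succ_iff.1 (mem_wordsLT.1 hv)).lt_or_eq with h | h
  · have hvw : w ≠ v := by
      rintro rfl
      exact lt_irrefl _ h
    rw [if_neg hvw, sub_zero]
    refine (mul_le_of_le_one_right (norm_nonneg _)
      (mul_mem (wordProd_mem_integralSeries ia ib v) ic w)).trans ((hc v).trans ?_)
    exact pow_le_pow_of_le_one hr0 hr (by omega)
  -- Among words of the length of `w`, only `w` itself has a nonzero entry, namely `λ ^ w.length -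
  -- 1`; it supplies the new factor `r`.
  · have h1 := wordProd_mul_sub_mem ha hb hf ha' hb' v w (by omega)
    rw [sub_apply, sub_eq_zero, smul_apply, wordProd_X_Y_apply] at h1
    have h2 : ‖(wordProd a b v * f) w - (if w = v then 1 else 0)‖ ≤ r := by
      rw [h1]
      split
      · rw [mul_one]
        exact norm_pow_sub_one_le hlam hr _
      · simpa using hr0
    refine (mul_le_mul (hc v) h2 (norm_nonneg _) (pow_nonneg hr0 _)).trans ?_
    rw [← pow_succ]
    exact pow_le_pow_of_le_one hr0 hr (by omega)

theorem norm_substMul_sub_pow_le (n : ℕ) (w : List (Fin 2)) :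
    ‖((substMul ha hb f - 1) ^ n) 1 w‖ ≤ r ^ (n - w.length) := by
  induction n generalizing w with
  | zero =>
    rw [pow_zero, Module.End.one_apply, one_apply, Nat.zero_sub, pow_zero]
    split <;> simp
  | succ n ih =>
    rw [pow_succ', Module.End.mul_apply]
    exact norm_substMul_sub_le ha hb hf ha' hb' ia ib ic hlam hr ih w

end Norm

end NCSeries

end

noncomputable section

open Filter Topology

/-! The `2`-adic logarithm as a limit of difference quotients. -/

section Padic

theorem norm_inv_natCast {n : ℕ} (hn : n ≠ 0) :
    ∃ v : ℕ, 2 ^ v ≤ n ∧ ‖((n : ℚ_[2])⁻¹)‖ = 2 ^ v := by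
  refine ⟨padicValNat 2 n, Nat.le_of_dvd (Nat.pos_of_ne_zero hn) pow_padicValNat_dvd, ?_⟩
  rw [norm_inv, Padic.norm_eq_zpow_neg_valuation (Nat.cast_ne_zero.2 hn), Padic.valuation_natCast,
    zpow_neg, inv_inv, zpow_natCast]
  simp

theorem norm_inv_natCast_le (n : ℕ) : ‖((n : ℚ_[2])⁻¹)‖ ≤ n := by
  rcases eq_or_ne n 0 with rfl | hn
  · simp
  · obtain ⟨v, hv, h⟩ := norm_inv_natCast hn
    rw [h]
    exact_mod_cast hv

/-- The limit is the binomial coefficient of `-1`, as `2 ^ k` tends to zero. The recursion combines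
Pascal's rule with `N binom(N - 1, n) = (n + 1) binom(N, n + 1)`. -/
theorem tendsto_choose_two_pow (n : ℕ) :
    Tendsto (fun k : ℕ => ((2 ^ k - 1).choose n : ℚ_[2])) atTop (𝓝 ((-1) ^ n)) := by
  have h2 : Tendsto (fun k : ℕ => (2 : ℚ_[2]) ^ k) atTop (𝓝 0) :=
    tendsto_pow_atTop_nhds_zero_of_norm_lt_one (by
      have := Padic.norm_p (p := 2)
      norm_num at this ⊢
      rw [this]; norm_num)
  induction n with
  | zero => simp
  | succ n ih =>
    have h3 : Tendsto (fun k : ℕ => (2 : ℚ_[2]) ^ k * ((2 ^ k - 1).choose n : ℚ_[2]) *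
        ((n + 1 : ℕ) : ℚ_[2])⁻¹ - ((2 ^ k - 1).choose n : ℚ_[2])) atTop
        (𝓝 (0 * (-1) ^ n * ((n + 1 : ℕ) : ℚ_[2])⁻¹ - (-1) ^ n)) :=
      ((h2.mul ih).mul_const _).sub ih
    rw [zero_mul, zero_mul, zero_sub] at h3
    rw [pow_succ, mul_neg_one]
    refine h3.congr fun k => ?_
    obtain ⟨m, hm⟩ : ∃ m, 2 ^ k = m + 1 := ⟨2 ^ k - 1, by have := Nat.one_le_two_pow (n := k); omega⟩
    have h4 : (2 : ℚ_[2]) ^ k = ((m + 1 : ℕ) : ℚ_[2]) := by rw [← hm]; push_cast; rfl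
    have h5 : ((m + 1 : ℕ) : ℚ_[2]) * (m.choose n : ℚ_[2]) =
        ((m + 1).choose (n + 1) : ℚ_[2]) * ((n + 1 : ℕ) : ℚ_[2]) := by
      exact_mod_cast Nat.add_one_mul_choose_eq m n
    have h6 : ((n + 1 : ℕ) : ℚ_[2]) ≠ 0 := Nat.cast_ne_zero.2 (by omega)
    rw [h4, hm, Nat.add_sub_cancel, h5, mul_inv_cancel_right₀ h6, Nat.choose_succ_succ]
    push_cast
    ring

theorem summable_bound (D : ℝ) : Summable fun n : ℕ => ((n : ℝ) + 1) * (D * (1 / 4) ^ n) := by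
  have h1 : Summable fun n : ℕ => ((n : ℝ) ^ 1 * (1 / 4) ^ n) :=
    summable_pow_mul_geometric_of_norm_lt_one 1 (by norm_num)
  have h2 : Summable fun n : ℕ => ((1 / 4 : ℝ)) ^ n :=
    summable_geometric_of_lt_one (by norm_num) (by norm_num)
  refine ((h1.add h2).mul_left D).congr fun n => ?_
  ring

variable {u : ℕ → ℚ_[2]} {D : ℝ} (hu : ∀ n, ‖u n‖ ≤ D * (1 / 4) ^ n)

include hu

theorem norm_div_mul_le {c : ℚ_[2]} (hc : ‖c‖ ≤ 1) (n : ℕ) :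
    ‖c / ((n : ℚ_[2]) + 1) * u n‖ ≤ ((n : ℝ) + 1) * (D * (1 / 4) ^ n) := by
  rw [norm_mul, div_eq_mul_inv, norm_mul]
  refine mul_le_mul ?_ (hu n) (norm_nonneg _) (by positivity)
  refine (mul_le_of_le_one_left (norm_nonneg _) hc).trans ?_
  exact_mod_cast norm_inv_natCast_le (n + 1)

theorem summable_log : Summable fun n : ℕ => (-1) ^ n / ((n : ℚ_[2]) + 1) * u n :=
  Summable.of_norm_bounded (summable_bound D) fun n => norm_div_mul_le hu (by simp) n

/-- If `u n = (g - 1) ^ (n + 1)`, this expresses `ln g` as a limit of `(g ^ N - 1) / N`. -/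
theorem tendsto_sum_choose : Tendsto
    (fun k : ℕ => ∑ n ∈ Finset.range (2 ^ k), ((2 ^ k - 1).choose n : ℚ_[2]) /
      ((n : ℚ_[2]) + 1) * u n) atTop
    (𝓝 (∑' n : ℕ, (-1) ^ n / ((n : ℚ_[2]) + 1) * u n)) := by
  have h1 : ∀ k n : ℕ, ‖((2 ^ k - 1).choose n : ℚ_[2]) / ((n : ℚ_[2]) + 1) * u n‖ ≤
      ((n : ℝ) + 1) * (D * (1 / 4) ^ n) := fun k n => by
    generalize (2 ^ k - 1).choose n = m
    exact norm_div_mul_le hu (IsUltrametricDist.norm_natCast_le_one ℚ_[2] m) n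
  have h2 : ∀ n : ℕ, Tendsto (fun k : ℕ => ((2 ^ k - 1).choose n : ℚ_[2]) / ((n : ℚ_[2]) + 1) * u n)
      atTop (𝓝 ((-1) ^ n / ((n : ℚ_[2]) + 1) * u n)) := fun n =>
    ((tendsto_choose_two_pow n).div_const _).mul_const _
  have h := tendsto_tsum_of_dominated_convergence (summable_bound D) h2
    (Eventually.of_forall h1)
  -- The binomial coefficients vanish from `n = 2 ^ k` on, so the finite sum is the full series and
  -- dominated convergence applies.
  refine h.congr fun k => ?_
  rw [tsum_eq_sum (s := Finset.range (2 ^ k))]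
  intro n hn
  rw [Finset.mem_range, not_lt] at hn
  have := Nat.one_le_two_pow (n := k)
  rw [Nat.choose_eq_zero_of_lt (by omega), Nat.cast_zero, zero_div, zero_mul]

end Padic

/-- `(x ^ N - 1) / N` in terms of the powers of `x - 1`. -/
theorem pow_sub_one_eq_sum {K B : Type*} [Field K] [CharZero K] [Ring B] [Algebra K B] (x : B)
    {N : ℕ} (hN : N ≠ 0) : (N : K)⁻¹ • (x ^ N - 1) = ∑ n ∈ Finset.range N,
      (((N - 1).choose n : K) / ((n : K) + 1)) • (x - 1) ^ (n + 1) := by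
  rw [pow_eq_sum_sub_one_pow x N, Finset.sum_range_succ', Nat.choose_zero_right, pow_zero,
    one_nsmul, add_sub_cancel_right, Finset.smul_sum]
  refine Finset.sum_congr rfl fun n _ => ?_
  obtain ⟨m, rfl⟩ := Nat.exists_eq_succ_of_ne_zero hN
  rw [← Nat.cast_smul_eq_nsmul K, smul_smul]
  congr 1
  have h5 : ((m + 1 : ℕ) : K) * (m.choose n : K) =
      ((m + 1).choose (n + 1) : K) * ((n + 1 : ℕ) : K) := by
    exact_mod_cast Nat.add_one_mul_choose_eq m n
  have h6 : ((n + 1 : ℕ) : K) ≠ 0 := Nat.cast_ne_zero.2 (by omega)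
  have h7 : ((m + 1 : ℕ) : K) ≠ 0 := Nat.cast_ne_zero.2 (by omega)
  rw [inv_mul_eq_iff_eq_mul₀ h7, Nat.succ_sub_one, ← Nat.cast_succ n, ← mul_div_assoc,
    eq_div_iff h6]
  exact h5.symm

/-! ### The logarithm of the number `λ`. -/

section Ln

variable {lam : ℚ_[2]}

theorem norm_pow_succ_le {x : ℚ_[2]} (hx : ‖x‖ ≤ 1 / 4) (n : ℕ) :
    ‖x ^ (n + 1)‖ ≤ 1 / 4 * (1 / 4) ^ n := by
  rw [norm_pow, ← pow_succ']
  exact pow_le_pow_left₀ (norm_nonneg _) hx _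

theorem tendsto_pow_two_pow (hlam : ‖lam - 1‖ ≤ 1 / 4) :
    Tendsto (fun k : ℕ => (((2 ^ k : ℕ) : ℚ_[2]))⁻¹ * (lam ^ 2 ^ k - 1)) atTop
      (𝓝 (padicLn 2 lam)) := by
  refine (tendsto_sum_choose (norm_pow_succ_le hlam)).congr fun k => ?_
  rw [← smul_eq_mul, pow_sub_one_eq_sum (K := ℚ_[2]) lam (by positivity)]
  rfl

/-- The first term has norm `1 / 4` and all others at most `1 / 8`, so it dominates by the
ultrametric inequality. The exact valuation of `λ - 1` is essential. -/
theorem norm_padicLn (hlam : ‖lam - 1‖ = 1 / 4) : ‖padicLn 2 lam‖ = 1 / 4 := by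
  have hs := summable_log (norm_pow_succ_le hlam.le)
  rw [padicLn, hs.tsum_eq_zero_add]
  have h1 : ‖∑' n : ℕ, (-1) ^ (n + 1) / (((n + 1 : ℕ) : ℚ_[2]) + 1) * (lam - 1) ^ (n + 1 + 1)‖ ≤
      1 / 8 := by
    refine IsUltrametricDist.norm_tsum_le_of_forall_le_of_nonneg (by norm_num) fun n => ?_
    refine (norm_div_mul_le (norm_pow_succ_le hlam.le) (by simp) (n + 1)).trans ?_
    -- The crude bound of the norm of `1 / (n + 2)` by `n + 2` is enough against the geometric
    -- decay.
    have h2 : ((n : ℝ) + 2) * (1 / 4) ^ n ≤ 2 := by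
      induction n with
      | zero => norm_num
      | succ n ih =>
        rw [pow_succ]
        push_cast
        have : (0 : ℝ) < (1 / 4) ^ n := by positivity
        nlinarith [(Nat.cast_nonneg n : (0 : ℝ) ≤ n)]
    rw [pow_succ]
    push_cast
    nlinarith
  have h0 : (-1) ^ 0 / (((0 : ℕ) : ℚ_[2]) + 1) * (lam - 1) ^ (0 + 1) = lam - 1 := by simp
  rw [h0]
  have h3 : ‖lam - 1‖ ≠
      ‖∑' n : ℕ, (-1) ^ (n + 1) / (((n + 1 : ℕ) : ℚ_[2]) + 1) * (lam - 1) ^ (n + 1 + 1)‖ := by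
    rw [hlam]
    intro h
    rw [← h] at h1
    norm_num at h1
  rw [IsUltrametricDist.norm_add_eq_max_of_norm_ne_norm h3, hlam, max_eq_left]
  exact h1.trans (by norm_num)

end Ln

end

noncomputable section

open Filter Topology

namespace NCSeries

/-! ### The coordinates `e^x - 1` and `e^y - 1`. -/

section Hat

variable {K : Type*} [Field K]

/-- The substitution `x ↦ e^x - 1`, `y ↦ e^y - 1`. -/
def hatHom (K : Type*) [Field K] : NCSeries K →ₐ[K] NCSeries K :=
  substHom (exp_sub_one_mem (X K)) (exp_sub_one_mem (Y K))

theorem hatHom_apply (c : NCSeries K) :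
    hatHom K c = c.subst ((X K).exp - 1) ((Y K).exp - 1) := rfl

theorem hatHom_apply_word (c : NCSeries K) (w : List (Fin 2)) : hatHom K c w =
    ∑ v ∈ wordsLT (w.length + 1), c v * wordProd ((X K).exp - 1) ((Y K).exp - 1) v w := by
  rw [hatHom_apply, subst, truncEval_eq_sum, sum_apply]
  rfl

theorem exp_sub_one_subst {a b s : NCSeries K} (ha : a ∈ orderIdeal K 1)
    (hb : b ∈ orderIdeal K 1) (hs : s ∈ orderIdeal K 1) :
    (s.exp - 1).subst a b = (s.subst a b).exp - 1 := by
  rw [← substHom_apply ha hb, map_sub, map_one, substHom_apply, exp_subst ha hb hs]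

theorem hatHom_subst {c a b : NCSeries K} (ha : a ∈ orderIdeal K 1) (hb : b ∈ orderIdeal K 1) :
    (hatHom K c).subst a b = c.subst (a.exp - 1) (b.exp - 1) := by
  rw [hatHom_apply, subst_subst ha hb (exp_sub_one_mem _) (exp_sub_one_mem _),
    exp_sub_one_subst ha hb X_mem, exp_sub_one_subst ha hb Y_mem, X_subst ha hb, Y_subst ha hb]

theorem subst_swap_swap (f : NCSeries K) : (f.subst (Y K) (X K)).subst (Y K) (X K) = f := by
  rw [subst_subst Y_mem X_mem Y_mem X_mem, X_subst Y_mem X_mem, Y_subst Y_mem X_mem]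
  exact eq_of_toTrunc_eq fun n => by rw [toTrunc_subst X_mem Y_mem, ← toTrunc_self]

theorem subst_swap_mul {f : NCSeries K} (h : f * f.subst (Y K) (X K) = 1) :
    f.subst (Y K) (X K) * f = 1 := by
  have := congrArg (substHom (Y_mem (K := K)) X_mem) h
  rw [map_mul, map_one, substHom_apply, substHom_apply, subst_swap_swap] at this
  exact this

/-- Duality yields the inverse by exchanging the letters, so its integrality in the new coordinates
follows from that of `f`. -/
theorem inverse_eq_subst_swap {f : NCSeries K} (h : f * f.subst (Y K) (X K) = 1) :
    Ring.inverse f = f.subst (Y K) (X K) := by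
  have hu : IsUnit f := ⟨⟨f, _, h, subst_swap_mul h⟩, rfl⟩
  rw [← mul_one (Ring.inverse f), ← h, ← mul_assoc, Ring.inverse_mul_cancel _ hu, one_mul]

end Hat

/-! ### The logarithm in the new coordinates: integrality, estimate and tangency. -/

section Conj

variable (lam : ℚ_[2]) (c : NCSeries ℚ_[2])

/-- The series `f x^λ f⁻¹ - 1` in terms of `x̂` and `ŷ`. -/
def hatConj : NCSeries ℚ_[2] :=
  c * (binomialSeries (X ℚ_[2]) lam - 1) * c.subst (Y ℚ_[2]) (X ℚ_[2])

/-- The series `y^λ - 1` in terms of `x̂` and `ŷ`. -/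
def hatPow : NCSeries ℚ_[2] := binomialSeries (Y ℚ_[2]) lam - 1

theorem hatConj_mem : hatConj lam c ∈ orderIdeal ℚ_[2] 1 :=
  Ideal.mul_mem_right _ _ (Ideal.mul_mem_left _ _ (binomialSeries_sub_one_mem _ _))

theorem hatPow_mem : hatPow lam ∈ orderIdeal ℚ_[2] 1 := binomialSeries_sub_one_mem _ _

theorem binomialSeries_sub_smul_mem (z : NCSeries ℚ_[2]) (hz : z [] = 0) :
    binomialSeries z lam - 1 - lam • z ∈ orderIdeal ℚ_[2] 2 := by
  intro w hw
  rcases w with _ | ⟨i, _ | ⟨j, w⟩⟩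
  · have := mem_orderIdeal_one.1 (binomialSeries_sub_one_mem z lam)
    rw [sub_apply, this, smul_apply, hz, mul_zero, sub_zero]
  · rw [sub_apply, sub_apply, binomialSeries_apply_singleton, smul_apply, one_apply,
      if_neg (by simp), sub_zero, sub_self]
  · simp at hw

theorem hatPow_sub_mem : hatPow lam - lam • Y ℚ_[2] ∈ orderIdeal ℚ_[2] 2 :=
  binomialSeries_sub_smul_mem _ _ rfl

variable {c}

theorem hatConj_sub_mem (hc : c [] = 1) :
    hatConj lam c - lam • X ℚ_[2] ∈ orderIdeal ℚ_[2] 2 := by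
  have h1 : c - 1 ∈ orderIdeal ℚ_[2] 1 := mem_orderIdeal_one.2 (by
    rw [sub_apply, hc, one_apply, if_pos rfl, sub_self])
  have h2 : c.subst (Y ℚ_[2]) (X ℚ_[2]) - 1 ∈ orderIdeal ℚ_[2] 1 := mem_orderIdeal_one.2 (by
    rw [sub_apply, subst_apply_nil, hc, one_apply, if_pos rfl, sub_self])
  have h3 := binomialSeries_sub_one_mem (X ℚ_[2]) lam
  have e : hatConj lam c - lam • X ℚ_[2] =
      (c - 1) * (binomialSeries (X ℚ_[2]) lam - 1) * c.subst (Y ℚ_[2]) (X ℚ_[2]) +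
        (binomialSeries (X ℚ_[2]) lam - 1) * (c.subst (Y ℚ_[2]) (X ℚ_[2]) - 1) +
        (binomialSeries (X ℚ_[2]) lam - 1 - lam • X ℚ_[2]) := by
    rw [hatConj]
    generalize binomialSeries (X ℚ_[2]) lam - 1 = z
    rw [sub_mul, sub_mul, one_mul, mul_sub, mul_one]
    abel
  rw [e]
  refine add_mem (add_mem ?_ ?_) (binomialSeries_sub_smul_mem lam _ rfl)
  · exact Ideal.mul_mem_right _ _ (mul_mem_orderIdeal h1 h3)
  · exact mul_mem_orderIdeal h3 h2

theorem hatConj_mem_integralSeries (u : ℤ_[2]) (hc : c ∈ integralSeries 2) :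
    hatConj (u : ℚ_[2]) c ∈ integralSeries 2 :=
  mul_mem (mul_mem hc (sub_mem (binomialSeries_mem X_mem_integralSeries X_mem u) (one_mem _)))
    (subst_mem_integralSeries hc Y_mem_integralSeries X_mem_integralSeries)

theorem hatPow_mem_integralSeries (u : ℤ_[2]) : hatPow (u : ℚ_[2]) ∈ integralSeries 2 :=
  sub_mem (binomialSeries_mem Y_mem_integralSeries Y_mem u) (one_mem _)

theorem hatHom_hatPow : hatHom ℚ_[2] (hatPow lam) = (lam • Y ℚ_[2]).exp - 1 := by
  rw [hatPow, map_sub, map_one, hatHom_apply,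
    binomialSeries_subst Y_mem (exp_sub_one_mem _) (exp_sub_one_mem _),
    Y_subst (exp_sub_one_mem _) (exp_sub_one_mem _), binomialSeries_exp_sub_one Y_mem]

theorem hatHom_hatConj {f : NCSeries ℚ_[2]} (hf : f = hatHom ℚ_[2] c)
    (hd : f * f.subst (Y ℚ_[2]) (X ℚ_[2]) = 1) : hatHom ℚ_[2] (hatConj lam c) =
      (lam • (f * X ℚ_[2] * Ring.inverse f)).exp - 1 := by
  have h1 : hatHom ℚ_[2] (c.subst (Y ℚ_[2]) (X ℚ_[2])) = f.subst (Y ℚ_[2]) (X ℚ_[2]) := by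
    rw [hf, hatHom_subst Y_mem X_mem, hatHom_apply, subst_subst (exp_sub_one_mem _)
      (exp_sub_one_mem _) Y_mem X_mem, X_subst (exp_sub_one_mem _) (exp_sub_one_mem _),
      Y_subst (exp_sub_one_mem _) (exp_sub_one_mem _)]
  have h2 : hatHom ℚ_[2] (binomialSeries (X ℚ_[2]) lam) = (lam • X ℚ_[2]).exp := by
    rw [hatHom_apply, binomialSeries_subst X_mem (exp_sub_one_mem _) (exp_sub_one_mem _),
      X_subst (exp_sub_one_mem _) (exp_sub_one_mem _), binomialSeries_exp_sub_one X_mem]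
  rw [hatConj, map_mul, map_mul, map_sub, map_one, h1, h2, ← hf, inverse_eq_subst_swap hd,
    ← smul_mul_assoc, ← mul_smul_comm, conj_exp (algebra_smul_mem _ X_mem) hd (subst_swap_mul hd),
    mul_sub, mul_one, sub_mul, hd]

/-- Right multiplication by `(λ, f)` in terms of the coordinates `x̂` and `ŷ`. -/
def hatRight (c : NCSeries ℚ_[2]) : Module.End ℚ_[2] (NCSeries ℚ_[2]) :=
  substMul (hatConj_mem lam c) (hatPow_mem lam) c

/-- The change of coordinates intertwines right multiplication with an integral operator, on which
the norm estimate is available. -/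
theorem gtRight_hatHom {f : NCSeries ℚ_[2]} (hf : f = hatHom ℚ_[2] c)
    (hd : f * f.subst (Y ℚ_[2]) (X ℚ_[2]) = 1) (h : NCSeries ℚ_[2]) :
    gtRight (lam, f) (hatHom ℚ_[2] h) = hatHom ℚ_[2] (hatRight lam c h) := by
  rw [gtRight, hatRight, substMul_apply, substMul_apply, map_mul, ← hf,
    hatHom_subst (algebra_smul_mem _ (conj_mem_orderIdeal _)) (algebra_smul_mem _ Y_mem),
    hatHom_apply (h.subst _ _), subst_subst (exp_sub_one_mem _) (exp_sub_one_mem _)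
      (hatConj_mem lam c) (hatPow_mem lam), ← hatHom_apply, ← hatHom_apply, hatHom_hatPow,
    hatHom_hatConj lam hf hd]

theorem gtRight_pow_one {f : NCSeries ℚ_[2]} (hf : f = hatHom ℚ_[2] c)
    (hd : f * f.subst (Y ℚ_[2]) (X ℚ_[2]) = 1) (n : ℕ) :
    (gtRight (lam, f) ^ n) 1 = hatHom ℚ_[2] ((hatRight lam c ^ n) 1) := by
  induction n with
  | zero => rw [pow_zero, pow_zero, Module.End.one_apply, map_one (hatHom ℚ_[2])]
  | succ n ih => rw [pow_succ', pow_succ', Module.End.mul_apply, Module.End.mul_apply, ih,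
      gtRight_hatHom lam hf hd]

theorem gtRight_sub_one_pow_one {f : NCSeries ℚ_[2]} (hf : f = hatHom ℚ_[2] c)
    (hd : f * f.subst (Y ℚ_[2]) (X ℚ_[2]) = 1) (n : ℕ) :
    ((gtRight (lam, f) - 1) ^ n) 1 = hatHom ℚ_[2] (((hatRight lam c - 1) ^ n) 1) := by
  induction n with
  | zero => rw [pow_zero, pow_zero, Module.End.one_apply, map_one (hatHom ℚ_[2])]
  | succ n ih => rw [pow_succ', pow_succ', Module.End.mul_apply, Module.End.mul_apply, ih,
      LinearMap.sub_apply, LinearMap.sub_apply, Module.End.one_apply, Module.End.one_apply,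
      gtRight_hatHom lam hf hd, map_sub]

/-- The logarithm in terms of the coordinates `x̂` and `ŷ`. -/
def hatLog (c : NCSeries ℚ_[2]) : NCSeries ℚ_[2] := fun w =>
  ∑' n : ℕ, (-1) ^ n / ((n : ℚ_[2]) + 1) * ((hatRight lam c - 1) ^ (n + 1)) 1 w

variable {lam} {u : ℤ_[2]} (hu : lam = u) (hlam : ‖lam - 1‖ = 1 / 4) (h1 : c [] = 1)
  (hc : c ∈ integralSeries 2)

include hu hlam h1 hc

theorem norm_hatRight_pow_le (n : ℕ) (w : List (Fin 2)) :
    ‖((hatRight lam c - 1) ^ n) 1 w‖ ≤ (1 / 4) ^ (n - w.length) := by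
  subst hu
  refine norm_substMul_sub_pow_le (hatConj_mem _ c) (hatPow_mem _) ?_ (hatConj_sub_mem _ h1)
    (hatPow_sub_mem _) (hatConj_mem_integralSeries u hc) (hatPow_mem_integralSeries u) hc hlam.le
    (by norm_num) n w
  exact mem_orderIdeal_one.2 (by rw [sub_apply, h1, one_apply, if_pos rfl, sub_self])

theorem norm_hatRight_pow_succ_le (w : List (Fin 2)) (n : ℕ) :
    ‖((hatRight lam c - 1) ^ (n + 1)) 1 w‖ ≤ 4 ^ w.length * (1 / 4) ^ n := by
  refine (norm_hatRight_pow_le hu hlam h1 hc _ w).trans ?_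
  have e : (1 / 4 : ℝ) ^ (n + 1 - w.length) =
      4 ^ w.length * (1 / 4) ^ (w.length + (n + 1 - w.length)) := by
    rw [pow_add, ← mul_assoc, ← mul_pow]
    norm_num
  rw [e]
  exact mul_le_mul_of_nonneg_left
    (pow_le_pow_of_le_one (by norm_num) (by norm_num) (by omega)) (by positivity)

theorem hasSum_hatLog (w : List (Fin 2)) :
    HasSum (fun n : ℕ => (-1) ^ n / ((n : ℚ_[2]) + 1) * ((hatRight lam c - 1) ^ (n + 1)) 1 w)
      (hatLog lam c w) :=
  (summable_log (norm_hatRight_pow_succ_le hu hlam h1 hc w)).hasSum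

/-- The denominator `n + 1` costs `2 ^ v` with `2 ^ v ≤ n + 1`, while the operator gains `4 ^ d`
with `d = n + 1 - w.length`. Every term of the series is thereby bounded by `2 ^ s`. -/
theorem norm_hatLog_le {s : ℕ} {w : List (Fin 2)} (hw : w.length < 2 ^ (s + 1)) :
    ‖hatLog lam c w‖ ≤ 2 ^ s := by
  refine IsUltrametricDist.norm_tsum_le_of_forall_le_of_nonneg (by positivity) fun n => ?_
  obtain ⟨v, hv, hv'⟩ := norm_inv_natCast (Nat.succ_ne_zero n)
  have e : ‖(-1) ^ n / ((n : ℚ_[2]) + 1)‖ = 2 ^ v := by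
    rw [div_eq_mul_inv, norm_mul, norm_pow, norm_neg, norm_one, one_pow, one_mul, ← Nat.cast_succ,
      hv']
  rw [norm_mul, e]
  set d := n + 1 - w.length with hd
  -- Indeed `2 ^ v ≤ n + 1 ≤ w.length + d < 2 ^ (s + 1) * 4 ^ d`.
  have h2 : v ≤ s + 2 * d := by
    have h3 : d < 4 ^ d := Nat.lt_pow_self (by norm_num)
    have h4 : 2 ^ v < 2 ^ (s + 2 * d + 1) := by
      have h5 : (2 : ℕ) ^ (s + 2 * d + 1) = 2 ^ (s + 1) * 4 ^ d := by
        rw [show s + 2 * d + 1 = s + 1 + 2 * d by ring, pow_add, pow_mul]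
        norm_num
      have h6 : (2 : ℕ) ≤ 2 ^ (s + 1) := by
        rw [pow_succ]
        have := Nat.one_le_two_pow (n := s)
        omega
      rw [h5]
      have h7 : n + 1 ≤ w.length + d := by omega
      rcases Nat.eq_zero_or_pos d with h8 | h8
      · rw [h8, pow_zero, mul_one]
        have : Nat.succ n = n + 1 := rfl
        omega
      · have h9 : 2 ^ (s + 1) + d ≤ 2 ^ (s + 1) * 4 ^ d := by nlinarith
        have : Nat.succ n = n + 1 := rfl
        omega
    have := (Nat.pow_lt_pow_iff_right (by norm_num : 1 < 2)).1 h4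
    omega
  calc (2 : ℝ) ^ v * ‖((hatRight lam c - 1) ^ (n + 1)) 1 w‖
      ≤ 2 ^ (s + 2 * d) * (1 / 4) ^ d := by
        refine mul_le_mul (pow_le_pow_right₀ (by norm_num) h2)
          (norm_hatRight_pow_le hu hlam h1 hc _ w) (norm_nonneg _) (by positivity)
    _ = 2 ^ s := by
        rw [pow_add, pow_mul, mul_assoc, ← mul_pow]
        norm_num

omit hu hlam hc in
-- The operator preserves constant terms. The empty word lies in no dyadic block, so its coefficient
-- has to vanish in the final estimate.
theorem hatLog_apply_nil : hatLog lam c [] = 0 := by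
  have h : ∀ n : ℕ, ((hatRight lam c - 1) ^ (n + 1)) 1 [] = 0 := fun n => by
    rw [pow_succ', Module.End.mul_apply, LinearMap.sub_apply, Module.End.one_apply, sub_apply,
      hatRight, substMul_apply, mul_nil, subst_apply_nil, h1, mul_one, sub_self]
  simp only [hatLog, h, mul_zero, tsum_zero]

theorem tendsto_hatLog : Tendsto (fun k : ℕ => (((2 ^ k : ℕ) : ℚ_[2]))⁻¹ •
    ((hatRight lam c ^ 2 ^ k) 1 - 1)) atTop (𝓝 (hatLog lam c)) := by
  refine tendsto_iff.2 fun w => ?_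
  refine (tendsto_sum_choose (norm_hatRight_pow_succ_le hu hlam h1 hc w)).congr fun k => ?_
  have h := LinearMap.congr_fun (pow_sub_one_eq_sum (K := ℚ_[2]) (hatRight lam c)
    (N := 2 ^ k) (by positivity)) 1
  rw [LinearMap.smul_apply, LinearMap.sub_apply, Module.End.one_apply] at h
  rw [h, LinearMap.sum_apply, sum_apply]
  rfl

/-- A coefficient after the change of coordinates is a finite combination of coefficients before it,
so coefficientwise sums carry over. -/
theorem hasSum_gtLogTerm {f : NCSeries ℚ_[2]} (hf : f = hatHom ℚ_[2] c)
    (hd : f * f.subst (Y ℚ_[2]) (X ℚ_[2]) = 1) :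
    HasSum (gtLogTerm (lam, f)) (padicLn 2 lam, hatHom ℚ_[2] (hatLog lam c)) := by
  have e : gtLogTerm (lam, f) = fun n : ℕ => ((-1) ^ n / ((n : ℚ_[2]) + 1) * (lam - 1) ^ (n + 1),
      ((-1) ^ n / ((n : ℚ_[2]) + 1)) • hatHom ℚ_[2] (((hatRight lam c - 1) ^ (n + 1)) 1)) := by
    ext1 n
    rw [gtLogTerm, gtSubOnePow_eq, gtRight_sub_one_pow_one lam hf hd]
    rfl
  rw [e]
  refine HasSum.prodMk (summable_log (norm_pow_succ_le hlam.le)).hasSum ?_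
  refine Pi.hasSum.2 fun w => ?_
  change HasSum (fun n : ℕ => ((-1) ^ n / ((n : ℚ_[2]) + 1)) *
    hatHom ℚ_[2] (((hatRight lam c - 1) ^ (n + 1)) 1) w) (hatHom ℚ_[2] (hatLog lam c) w)
  simp only [hatHom_apply_word, Finset.mul_sum, ← mul_assoc]
  exact hasSum_sum fun v _ => (hasSum_hatLog hu hlam h1 hc v).mul_right _

/-- The words are sorted by dyadic blocks of lengths. On the block of index `s` the logarithm has
norm at most `2 ^ s`, and division by `ln λ`, of norm `1 / 4`, makes this `2 ^ (s + 2)`. -/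
theorem hatLog_mem_psiEstimate :
    (padicLn 2 lam)⁻¹ • hatHom ℚ_[2] (hatLog lam c) ∈ psiEstimate := by
  have hln := norm_padicLn hlam
  let d : ℕ → NCSeries ℚ_[2] := fun s w =>
    if 2 ^ s ≤ w.length ∧ w.length < 2 ^ (s + 1) then hatLog lam c w else 0
  refine ⟨fun s => (padicLn 2 lam)⁻¹ • hatHom ℚ_[2] (d s), fun s =>
    ⟨hatHom ℚ_[2] ((2 ^ (s + 2) * (padicLn 2 lam)⁻¹) • d s), ⟨_, fun w => ?_, fun w hw => ?_, rfl⟩,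
      ?_⟩, ?_⟩
  · rw [smul_apply, norm_mul, norm_mul, norm_inv, hln]
    have h2 : ‖(2 : ℚ_[2]) ^ (s + 2)‖ = ((2 : ℝ) ^ (s + 2))⁻¹ := by
      have := Padic.norm_p_pow (p := 2) (s + 2)
      rw [zpow_neg, zpow_natCast] at this
      exact_mod_cast this
    have h3 : ‖d s w‖ ≤ 2 ^ s := by
      simp only [d]
      split
      · rename_i h; exact norm_hatLog_le hu hlam h1 hc h.2
      · rw [norm_zero]; positivity
    rw [h2]
    calc ((2 : ℝ) ^ (s + 2))⁻¹ * (1 / 4)⁻¹ * ‖d s w‖ ≤ (2 ^ (s + 2))⁻¹ * (1 / 4)⁻¹ * 2 ^ s :=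
          mul_le_mul_of_nonneg_left h3 (by positivity)
      _ = 1 := by
          rw [pow_add]
          field_simp
          norm_num
  · rw [smul_apply]
    simp only [d]
    rw [if_neg (by omega), mul_zero]
  · have h2 : (2 : ℚ_[2]) ^ (s + 2) ≠ 0 := pow_ne_zero _ two_ne_zero
    rw [map_smul, smul_smul, inv_mul_cancel_left₀ h2]
  · refine Pi.hasSum.2 fun w => ?_
    change HasSum (fun s => (padicLn 2 lam)⁻¹ * hatHom ℚ_[2] (d s) w)
      ((padicLn 2 lam)⁻¹ * hatHom ℚ_[2] (hatLog lam c) w)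
    refine HasSum.mul_left _ ?_
    simp only [hatHom_apply_word]
    refine hasSum_sum fun v _ => HasSum.mul_right _ ?_
    rcases eq_or_ne v.length 0 with hv | hv
    · rw [List.length_eq_zero_iff.1 hv, hatLog_apply_nil h1]
      convert! hasSum_zero with s
      simp only [d]
      rw [if_neg]
      have := Nat.one_le_two_pow (n := s)
      simp only [List.length_nil]
      omega
    -- A nonempty word lies in exactly one block, that of the binary logarithm of its length, so the
    -- sum over blocks has a single term at each word.
    · have h2 : 2 ^ Nat.log 2 v.length ≤ v.length ∧ v.length < 2 ^ (Nat.log 2 v.length + 1) :=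
        ⟨Nat.pow_log_le_self 2 hv, Nat.lt_pow_succ_log_self (by norm_num) _⟩
      have h3 : d (Nat.log 2 v.length) v = hatLog lam c v := if_pos h2
      rw [← h3]
      refine hasSum_single _ fun s hs => if_neg fun h => hs ?_
      exact (Nat.log_eq_of_pow_le_of_lt_pow h.1 h.2).symm

/-- With `ε = 2 ^ k ln λ` the pairs `(g ^ (2 ^ k) - 1) / ε` tend to this element, and the powers `g
^ (2 ^ k)` lie in `GT`. -/
theorem mem_gtLie_hatLog {f : NCSeries ℚ_[2]} (hf : f = hatHom ℚ_[2] c)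
    (hG : (lam, f) ∈ GT ℚ_[2]) :
    (1, (padicLn 2 lam)⁻¹ • hatHom ℚ_[2] (hatLog lam c)) ∈ gtLie ℚ_[2] := by
  have hln : padicLn 2 lam ≠ 0 := fun h => by
    have := norm_padicLn hlam
    rw [h, norm_zero] at this
    norm_num at this
  have hd := hG.2.2.1
  have h2 : ∀ k : ℕ, ((2 ^ k : ℕ) : ℚ_[2]) ≠ 0 := fun k => Nat.cast_ne_zero.2 (by positivity)
  have hε : Tendsto (fun k : ℕ => ((2 ^ k : ℕ) : ℚ_[2]) * padicLn 2 lam) atTop (𝓝 0) := by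
    have h3 : Tendsto (fun k : ℕ => (2 : ℚ_[2]) ^ k) atTop (𝓝 0) :=
      tendsto_pow_atTop_nhds_zero_of_norm_lt_one (by
        have := Padic.norm_p (p := 2)
        norm_num at this ⊢
        rw [this]; norm_num)
    have := h3.mul_const (padicLn 2 lam)
    rw [zero_mul] at this
    exact_mod_cast this
  have hs := (tendsto_pow_two_pow hlam.le).const_mul (padicLn 2 lam)⁻¹
  rw [inv_mul_cancel₀ hln] at hs
  have hψ := isLimitNotion.smul (tendsto_const_nhds (x := (padicLn 2 lam)⁻¹))
    (tendsto_subst (tendsto_hatLog hu hlam h1 hc) ((X ℚ_[2]).exp - 1) ((Y ℚ_[2]).exp - 1))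
  refine mem_gtLie_of_tendsto (fun k => mul_ne_zero (h2 k) hln) hε hs hψ fun k => ?_
  have e1 : 1 + ((2 ^ k : ℕ) : ℚ_[2]) * padicLn 2 lam * ((padicLn 2 lam)⁻¹ *
      (((2 ^ k : ℕ) : ℚ_[2])⁻¹ * (lam ^ 2 ^ k - 1))) = lam ^ 2 ^ k := by
    have := h2 k
    field_simp
    ring
  have e2 : (1 : NCSeries ℚ_[2]) + (((2 ^ k : ℕ) : ℚ_[2]) * padicLn 2 lam) • (padicLn 2 lam)⁻¹ •
      hatHom ℚ_[2] ((((2 ^ k : ℕ) : ℚ_[2]))⁻¹ • ((hatRight lam c ^ 2 ^ k) 1 - 1)) =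
      (gtRight (lam, f) ^ 2 ^ k) 1 := by
    rw [map_smul, smul_smul, smul_smul, mul_inv_cancel_right₀ hln, mul_inv_cancel₀ (h2 k),
      one_smul, map_sub, map_one (hatHom ℚ_[2]), add_sub_cancel, gtRight_pow_one lam hf hd]
  have h3 : gtMul (1, 1) (lam, f) = (lam, f) := by
    rw [gtMul_eq, one_mul, gtRight, substMul_apply,
      ← substHom_apply (algebra_smul_mem _ (conj_mem_orderIdeal _)) (algebra_smul_mem _ Y_mem),
      map_one, one_mul]
  obtain ⟨m, hm⟩ := Nat.exists_eq_succ_of_ne_zero (n := 2 ^ k) (by positivity)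
  have h5 := gtPow_succ_mem_GT hG h3 m
  rw [← Nat.succ_eq_add_one, ← hm, gtPow_eq] at h5
  change (_, 1 + _ • _ • hatHom ℚ_[2] _) ∈ _
  rw [e1, e2]
  exact h5

end Conj

end NCSeries

end

theorem propositionA2 (lam : ℚ_[2]) (f : NCSeries ℚ_[2]) (hg : (lam, f) ∈ GTp 2)
    (hlam : ∃ t : ℤ_[2], lam = 1 + 4 + 8 * (t : ℚ_[2])) :
    Summable (gtLogTerm (lam, f)) ∧ padicLn 2 lam ≠ 0 ∧
      ∃ ψ : NCSeries ℚ_[2],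
        (padicLn 2 lam)⁻¹ • gtLog (lam, f) = (1, ψ) ∧
        (1, ψ) ∈ gtLie ℚ_[2] ∧
        ψ ∈ psiEstimate := by
  obtain ⟨hG, ⟨u, hu⟩, c, hc, -, hf⟩ := hg
  obtain ⟨t, ht⟩ := hlam
  have h1 : c [] = 1 := by
    rw [← NCSeries.subst_apply_nil c ((NCSeries.X ℚ_[2]).exp - 1) ((NCSeries.Y ℚ_[2]).exp - 1),
      ← hf]
    exact hG.2.1.1
  -- In `λ - 1 = 4 + 8 t` the first summand dominates, so the valuation is exactly two.
  have hnorm : ‖lam - 1‖ = 1 / 4 := by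
    have e : lam - 1 = 4 + 8 * (t : ℚ_[2]) := by rw [ht]; ring
    have h2 : ‖(2 : ℚ_[2])‖ = 1 / 2 := by
      have := Padic.norm_p (p := 2)
      norm_num at this ⊢
      exact this
    have h4 : ‖(4 : ℚ_[2])‖ = 1 / 4 := by
      rw [show (4 : ℚ_[2]) = 2 * 2 by norm_num, norm_mul, h2]; norm_num
    have h8 : ‖8 * (t : ℚ_[2])‖ ≤ 1 / 8 := by
      rw [show (8 : ℚ_[2]) = 2 * 2 * 2 by norm_num, norm_mul, norm_mul, norm_mul, h2]
      have := PadicInt.norm_le_one t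
      rw [PadicInt.norm_def] at this
      linarith
    have hne : ‖(4 : ℚ_[2])‖ ≠ ‖8 * (t : ℚ_[2])‖ := by
      rw [h4]
      intro h
      rw [← h] at h8
      norm_num at h8
    rw [e, IsUltrametricDist.norm_add_eq_max_of_norm_ne_norm hne, h4, max_eq_left]
    exact h8.trans (by norm_num)
  have hln : padicLn 2 lam ≠ 0 := fun h => by
    have := norm_padicLn hnorm
    rw [h, norm_zero] at this
    norm_num at this
  have hS := NCSeries.hasSum_gtLogTerm hu hnorm h1 hc hf hG.2.2.1
  refine ⟨hS.summable, hln, _, ?_, NCSeries.mem_gtLie_hatLog hu hnorm h1 hc hf hG,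
    NCSeries.hatLog_mem_psiEstimate hu hnorm h1 hc⟩
  rw [gtLog, hS.tsum_eq]
  exact Prod.ext (inv_mul_cancel₀ hln) rfl
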